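/- A real random access machine has two-dimensional arrays of natural numbers and two-dimensional arrays of real numbers as its memory, and runs a fixed finite program (assignments, branching, while-loops). Its elementary operations are reading or writing an array entry, addition, subtraction (truncated at $0$ on natural numbers) and comparison of two natural numbers or of two real numbers, Boolean operations and branching; each of these, as well as each call to an independence oracle (which, for a set $S\subseteq V$ given by its characteristic vector in a row of an array, tells whether $S$ is independent), takes one time step. Consider the following problem, Double MC-Multiway-Cut on trees. The input consists of a tree $G=(V,E)$ on $V=\{0,\dots,n-1\}$, given by $n$ and its adjacency matrix, edge weights $w\in\mathbb{R}_{\ge 0}^E$, and two matroids $\mathcal{M}_1,\mathcal{M}_2$ on the ground set $V$, both of rank $k\ge 1$ and given only by independence oracles. For $X\subseteq V$ let $d_w(X)$ be the sum of $w(e)$ over the edges $e$ with exactly one endpoint in $X$. A partition $\{V_1,\dots,V_k\}$ of $V$ is feasible if there are a basis $B_1$ of $\mathcal{M}_1$ and a (possibly different) basis $B_2$ of $\mathcal{M}_2$ such that $|B_j\cap V_i|=1$ for all $i\in\{1,\dots,k\}$ and $j\in\{1,2\}$. The task is to find a feasible partition that minimizes $\sum_{i=1}^k d_w(V_i)$ over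 all feasible partitions. **Theorem.** This problem can be solved in polynomial time: there are one program for such a machine and one polynomial $p$ such that, on every input as above, the program halts after at most $p(n)$ elementary operations and oracle calls, and outputs (as a list that assigns to every vertex the index of its part) a feasible partition minimizing $\sum_{i=1}^k d_w(V_i)$. -/

import Mathlib

/-! ### Double matroid-constrained multiway cut -/

section Problem

variable {V : Type*}

/-- `δ_G(X)`: the edges of `G` with exactly one endpoint in `X`. -/
def cutEdges (G : SimpleGraph V) (X : Set V) : Set (Sym2 V) :=
  {e | e ∈ G.edgeSet ∧ ∃ u v, u ∈ X ∧ v ∉ X ∧ e = s(u, v)}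

open Classical in
/-- `d_w(X)`: the total weight of the edges of `G` leaving `X`. -/
noncomputable def cutWeight [Fintype V] (G : SimpleGraph V) (w : Sym2 V → ℝ) (X : Set V) : ℝ :=
  ∑ e with e ∈ cutEdges G X, w e

/-- The family `P 0, …, P (k - 1)` is a partition of `V` and, for each of the two matroids, some
basis has exactly one element in every part. The two bases need not be equal. (Every part is
nonempty, because it meets a basis.) -/
def IsFeasiblePartition {k : ℕ} (M : Fin 2 → Matroid V) (P : Fin k → Set V) : Prop :=
  (∀ v, ∃! i, v ∈ P i) ∧
    ∀ j, ∃ B : Set V, (M j).IsBase B ∧ ∀ i, (B ∩ P i).ncard = 1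

/-- `P` is an optimal solution: it is feasible and minimizes `∑ i, d_w (P i)`. -/
def IsOptimalPartition [Fintype V] {k : ℕ} (G : SimpleGraph V) (w : Sym2 V → ℝ)
    (M : Fin 2 → Matroid V) (P : Fin k → Set V) : Prop :=
  IsFeasiblePartition M P ∧
    ∀ Q : Fin k → Set V, IsFeasiblePartition M Q →
      ∑ i, cutWeight G w (P i) ≤ ∑ i, cutWeight G w (Q i)

end Problem

/-! ### Machine model

A program is a finite imperative program working on an unbounded random access memory. The memory
consists of two-dimensional arrays of natural numbers and two-dimensional arrays of real numbers
(an array entry `A[0][0]` serves as a scalar variable). The elementary operations are reading and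
writing an entry, addition, subtraction and comparison of natural numbers, addition, subtraction
and comparison of real numbers, Boolean connectives, branching, and one call of an independence
oracle; each of them costs one unit of time. There is no multiplication, and there is no conversion
between natural and real numbers. -/

namespace OracleRAM

/-- The content of the memory: `s.nat A i j` is the entry `A[i][j]` of the `A`-th array of natural
numbers, and `s.real A i j` is the entry `A[i][j]` of the `A`-th array of real numbers. -/
structure Store where
  nat : ℕ → ℕ → ℕ → ℕ
  real : ℕ → ℕ → ℕ → ℝ

/-- The memory after `A[i][j] := x` for an array of natural numbers. -/
def Store.writeNat (s : Store) (A i j x : ℕ) : Store where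
  nat := fun A' i' j' => if A' = A ∧ i' = i ∧ j' = j then x else s.nat A' i' j'
  real := s.real

open Classical in
/-- The memory after `A[i][j] := x` for an array of real numbers. -/
noncomputable def Store.writeReal (s : Store) (A i j : ℕ) (x : ℝ) : Store where
  nat := s.nat
  real := fun A' i' j' => if A' = A ∧ i' = i ∧ j' = j then x else s.real A' i' j'

/-- Expressions of natural number type. -/
inductive NatExpr where
  | const (c : ℕ)
  | read (A : ℕ) (i j : NatExpr)
  | add (a b : NatExpr)
  | sub (a b : NatExpr)

/-- The value of an expression; subtraction is truncated at `0`. -/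
def NatExpr.eval (s : Store) : NatExpr → ℕ
  | .const c => c
  | .read A i j => s.nat A (i.eval s) (j.eval s)
  | .add a b => a.eval s + b.eval s
  | .sub a b => a.eval s - b.eval s

/-- The number of elementary operations needed to evaluate an expression. -/
def NatExpr.cost : NatExpr → ℕ
  | .const _ => 1
  | .read _ i j => i.cost + j.cost + 1
  | .add a b => a.cost + b.cost + 1
  | .sub a b => a.cost + b.cost + 1

/-- Expressions of real number type. -/
inductive RealExpr where
  | zero
  | read (A : ℕ) (i j : NatExpr)
  | add (a b : RealExpr)
  | sub (a b : RealExpr)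

/-- The value of an expression. -/
noncomputable def RealExpr.eval (s : Store) : RealExpr → ℝ
  | .zero => 0
  | .read A i j => s.real A (i.eval s) (j.eval s)
  | .add a b => a.eval s + b.eval s
  | .sub a b => a.eval s - b.eval s

/-- The number of elementary operations needed to evaluate an expression. -/
def RealExpr.cost : RealExpr → ℕ
  | .zero => 1
  | .read _ i j => i.cost + j.cost + 1
  | .add a b => a.cost + b.cost + 1
  | .sub a b => a.cost + b.cost + 1

/-- Tests. `indep m A i` is a call of the `m`-th independence oracle on the set whose
characteristic vector is (up to replacing nonzero entries by `1`) the row `A[i]`. -/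
inductive Test where
  | natLe (a b : NatExpr)
  | realLe (a b : RealExpr)
  | indep (m : Fin 2) (A : ℕ) (i : NatExpr)
  | not (b : Test)
  | and (b c : Test)

/-- A pair of oracles answering queries about subsets of `{0, …, n - 1}`. -/
abbrev Oracles (n : ℕ) := Fin 2 → Set (Fin n) → Prop

/-- The outcome of a test. -/
def Test.holds {n : ℕ} (O : Oracles n) (s : Store) : Test → Prop
  | .natLe a b => a.eval s ≤ b.eval s
  | .realLe a b => a.eval s ≤ b.eval s
  | .indep m A i => O m {v : Fin n | s.nat A (i.eval s) v ≠ 0}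
  | .not b => ¬ b.holds O s
  | .and b c => b.holds O s ∧ c.holds O s

/-- The number of elementary operations and oracle calls needed to evaluate a test. -/
def Test.cost : Test → ℕ
  | .natLe a b => a.cost + b.cost + 1
  | .realLe a b => a.cost + b.cost + 1
  | .indep _ _ i => i.cost + 1
  | .not b => b.cost + 1
  | .and b c => b.cost + c.cost + 1

/-- Programs. -/
inductive Program where
  | skip
  | setNat (A : ℕ) (i j a : NatExpr)
  | setReal (A : ℕ) (i j : NatExpr) (a : RealExpr)
  | seq (p q : Program)
  | ite (b : Test) (p q : Program)
  | while (b : Test) (p : Program)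

/-- `Exec O p s s' t`: with oracles `O`, the program `p` started on the memory content `s` halts
with the memory content `s'` after `t` elementary operations and oracle calls. -/
inductive Exec {n : ℕ} (O : Oracles n) : Program → Store → Store → ℕ → Prop where
  | skip (s : Store) : Exec O .skip s s 1
  | setNat (A : ℕ) (i j a : NatExpr) (s : Store) :
      Exec O (.setNat A i j a) s (s.writeNat A (i.eval s) (j.eval s) (a.eval s))
        (i.cost + j.cost + a.cost + 1)
  | setReal (A : ℕ) (i j : NatExpr) (a : RealExpr) (s : Store) :
      Exec O (.setReal A i j a) s (s.writeReal A (i.eval s) (j.eval s) (a.eval s))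
        (i.cost + j.cost + a.cost + 1)
  | seq {p q : Program} {s s' s'' : Store} {t t' : ℕ} :
      Exec O p s s' t → Exec O q s' s'' t' → Exec O (.seq p q) s s'' (t + t')
  | iteTrue {b : Test} {p q : Program} {s s' : Store} {t : ℕ} :
      b.holds O s → Exec O p s s' t → Exec O (.ite b p q) s s' (b.cost + 1 + t)
  | iteFalse {b : Test} {p q : Program} {s s' : Store} {t : ℕ} :
      ¬ b.holds O s → Exec O q s s' t → Exec O (.ite b p q) s s' (b.cost + 1 + t)
  | whileTrue {b : Test} {p : Program} {s s' s'' : Store} {t t' : ℕ} :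
      b.holds O s → Exec O p s s' t → Exec O (.while b p) s' s'' t' →
        Exec O (.while b p) s s'' (b.cost + 1 + t + t')
  | whileFalse {b : Test} {p : Program} {s : Store} :
      ¬ b.holds O s → Exec O (.while b p) s s (b.cost + 1)

/-- The machine is deterministic: the result and the running time are unique. -/
theorem Exec.unique {n : ℕ} {O : Oracles n} {p : Program} {s s₁ s₂ : Store} {t₁ t₂ : ℕ}
    (h₁ : Exec O p s s₁ t₁) (h₂ : Exec O p s s₂ t₂) : s₁ = s₂ ∧ t₁ = t₂ := by
  induction h₁ generalizing s₂ t₂ with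
  | skip s => cases h₂; exact ⟨rfl, rfl⟩
  | setNat => cases h₂; exact ⟨rfl, rfl⟩
  | setReal => cases h₂; exact ⟨rfl, rfl⟩
  | seq _ _ ih ih' =>
    cases h₂ with
    | seq h h' =>
      obtain ⟨rfl, rfl⟩ := ih h
      obtain ⟨rfl, rfl⟩ := ih' h'
      exact ⟨rfl, rfl⟩
  | iteTrue hb _ ih =>
    cases h₂ with
    | iteTrue _ h => obtain ⟨rfl, rfl⟩ := ih h; exact ⟨rfl, rfl⟩
    | iteFalse hb' _ => exact absurd hb hb'
  | iteFalse hb _ ih =>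
    cases h₂ with
    | iteTrue hb' _ => exact absurd hb' hb
    | iteFalse _ h => obtain ⟨rfl, rfl⟩ := ih h; exact ⟨rfl, rfl⟩
  | whileTrue hb _ _ ih ih' =>
    cases h₂ with
    | whileTrue _ h h' =>
      obtain ⟨rfl, rfl⟩ := ih h
      obtain ⟨rfl, rfl⟩ := ih' h'
      exact ⟨rfl, rfl⟩
    | whileFalse hb' => exact absurd hb hb'
  | whileFalse hb =>
    cases h₂ with
    | whileTrue hb' _ _ => exact absurd hb' hb
    | whileFalse _ => exact ⟨rfl, rfl⟩

open Classical in
/-- The initial memory content for a graph `G` on `{0, …, n - 1}` with edge weights `w`: the number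
`n` is stored in entry `[0][0]` of array `0` of natural numbers, the adjacency matrix of `G` in
array `1` of natural numbers, and the weight of each edge `uv` in the entries `[u][v]` and `[v][u]`
of array `0` of real numbers. All other entries are `0`. The matroids are not part of the
memory; they are accessible only through the oracles. -/
noncomputable def inputStore {n : ℕ} (G : SimpleGraph (Fin n)) (w : Sym2 (Fin n) → ℝ) : Store where
  nat := fun A i j =>
    if A = 0 ∧ i = 0 ∧ j = 0 then n
    else if A = 1 ∧ ∃ u v : Fin n, i = u ∧ j = v ∧ G.Adj u v then 1
    else 0
  real := fun A i j =>
    if h : A = 0 ∧ i < n ∧ j < n then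
      if G.Adj ⟨i, h.2.1⟩ ⟨j, h.2.2⟩ then w s(⟨i, h.2.1⟩, ⟨j, h.2.2⟩) else 0
    else 0

/-- The family of `k` vertex sets described by the final memory content: the vertex `v` is in the
part whose index is the entry `[0][v]` of array `2` of natural numbers. -/
def outputParts (n k : ℕ) (s : Store) : Fin k → Set (Fin n) :=
  fun i => {v | s.nat 2 0 v = i}

end OracleRAM

/-!
The optimum is computed by one weighted matroid intersection.

A set `J` of edges is kept, which means that the endpoints of each of them have to be in the same
part of the partition; the parts are unions of components of the forest `J`. This is compatible with
a feasible partition if, for each of the two matroids, distinct endpoints can be assigned to the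
edges of `J` such that the assigned endpoints form a coindependent set: then every component has
exactly one vertex that is not assigned, so that a basis avoiding the assigned endpoints has at most
one element in every component, and the components meeting only one of the two bases can be paired
up (`SideOK.merge`, `SideOK.isBase`, `Cmd.number_spec`). Conversely, in a feasible partition the
edges inside the parts can be oriented away from the elements of a basis
(`IsEdgeList.exists_orientation`). The cost of a partition is twice the weight of the edges between
its parts, so the kept edges should have maximum weight.

The two assignments are encoded by five elements for every edge `e`, all of weight `w e`: two of
them assign an endpoint to `e` for the first matroid, two for the second one, and the fifth one does
neither. Every element occupies two slots: on the side of each matroid, either the endpoint that it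
assigns or a slot that is private to `e`. The sets in which the slots of a side are distinct, and in
which the vertices among them are coindependent, are the independent sets of a matroid
(`exists_slotMatroid`). The weight of a common independent set is at most the total weight of the
edges plus the weight of the edges to which both sides assign an endpoint, and equality can be
attained for every feasible partition (`IsEdgeList.sum_cutWeight_le`,
`IsEdgeList.exists_common_of_feasible`).

A common independent set of maximum weight is found by augmenting repeatedly along a shortest walk
in the exchange graph that has the fewest arcs among the shortest ones. The invariant
`IsExtremeCommon` is a splitting `wt = c + (wt - c)` of the weights such that the current set has
maximum weight among the independent sets of its size in each of the two matroids separately. The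
distances from the sources provide the splitting for the augmented set, and a choice of a walk with
the fewest arcs makes the simultaneous exchange valid (`IsExtremeCommon.augment`,
`indep_exchange_of_triangular`). If there is no walk from a source to a sink, the current set has
maximum cardinality (`card_le_of_no_walk`).

The algorithm is written in a language of counting loops `Cmd` that run for a constant multiple of
`n` iterations. For this language the running time is bounded by a polynomial that can be read off
the program (`Cmd.exec_compile`), and correctness is proved for a function on memory contents
(`Cmd.den`). Shortest walks are found by dynamic programming over the number of arcs; since the
splitting is a feasible potential, walks with fewer arcs than there are elements suffice
(`DiWalk.exists_lt_card`).
-/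


/-! ### Exchange lemmas for a single matroid -/

theorem insert_sdiff_indep_iff_notMem_closure {α : Type*} {M : Matroid α} {I : Set α}
    (hI : M.Indep I) {x y : α} (hx : x ∉ I) (hxE : x ∈ M.E) :
    M.Indep (insert x (I \ {y})) ↔ x ∉ M.closure (I \ {y}) := by
  rw [(hI.subset Set.sdiff_subset).insert_indep_iff_of_notMem (fun h => hx h.1)]
  simp [hxE]

/-- Simultaneous exchange: if the pairs `(y i, x i)` can be exchanged one at a time and, for `i`
before `j` in some linear order, `(y i, x j)` can not, then all pairs can be exchanged at once. -/
theorem indep_exchange_of_triangular {α ι κ : Type*} [DecidableEq ι] [LinearOrder κ]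
    {M : Matroid α} (T : Finset ι) (key : ι → κ) (hkey : Set.InjOn key T) (x y : ι → α) (I : Set α)
    (hI : M.Indep I) (hy : ∀ i ∈ T, y i ∈ I) (hx : ∀ i ∈ T, x i ∉ I)
    (hd : ∀ i ∈ T, M.Indep (insert (x i) (I \ {y i})))
    (ho : ∀ i ∈ T, ∀ j ∈ T, key i < key j → ¬ M.Indep (insert (x j) (I \ {y i}))) :
    M.Indep ((I \ y '' T) ∪ x '' T) := by
  induction hn : T.card generalizing T I with
  | zero =>
    rw [Finset.card_eq_zero] at hn
    subst hn
    simpa using hI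
  | succ n ih =>
    have hT : T.Nonempty := Finset.card_pos.1 (by omega)
    obtain ⟨i, hi, hmin⟩ := T.exists_min_image key hT
    have hlt : ∀ j ∈ T, j ≠ i → key i < key j := fun j hj hji =>
      lt_of_le_of_ne (hmin j hj) (fun h => hji (hkey hj hi h.symm))
    have hxE : ∀ j ∈ T, x j ∈ M.E := fun j hj => (hd j hj).subset_ground (Set.mem_insert _ _)
    have hxne : ∀ j ∈ T, j ≠ i → x j ≠ x i := fun j hj hji h =>
      ho i hi j hj (hlt j hj hji) (h ▸ hd i hi)
    have hyne : ∀ j ∈ T, j ≠ i → y j ≠ y i := fun j hj hji h =>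
      ho i hi j hj (hlt j hj hji) (h ▸ hd j hj)
    have hcl : ∀ a ∈ T, ∀ b ∈ T, (M.Indep (insert (x b) (I \ {y a})) ↔
        x b ∉ M.closure (I \ {y a})) := fun a ha b hb =>
      insert_sdiff_indep_iff_notMem_closure hI (hx b hb) (hxE b hb)
    set I1 : Set α := insert (x i) (I \ {y i}) with hI1
    have hmem : ∀ j ∈ T, j ≠ i → x j ∉ I1 := by
      intro j hj hji h
      rcases h with h | h
      · exact hxne j hj hji h
      · exact hx j hj h.1
    have key' := ih (T.erase i) (fun a ha b hb h => hkey (Finset.mem_of_mem_erase ha)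
      (Finset.mem_of_mem_erase hb) h) I1 (hd i hi) ?_ ?_ ?_ ?_ ?_
    · convert key' using 1
      ext z
      simp only [Set.mem_union, Set.mem_sdiff, Set.mem_image, Finset.mem_coe, Finset.mem_erase, hI1,
        Set.mem_insert_iff, Set.mem_singleton_iff]
      constructor
      · rintro (⟨hz, hz'⟩ | ⟨j, hj, rfl⟩)
        · left
          refine ⟨Or.inr ⟨hz, fun h => hz' ⟨i, hi, h.symm⟩⟩, ?_⟩
          rintro ⟨j, hj, rfl⟩
          exact hz' ⟨j, hj.2, rfl⟩
        · by_cases hji : j = i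
          · subst hji
            left
            refine ⟨Or.inl rfl, ?_⟩
            rintro ⟨k, hk, hk'⟩
            exact hx j hj (hk' ▸ hy k hk.2)
          · right
            exact ⟨j, ⟨hji, hj⟩, rfl⟩
      · rintro (⟨rfl | ⟨hz, hzi⟩, hz'⟩ | ⟨j, hj, rfl⟩)
        · right
          exact ⟨i, hi, rfl⟩
        · left
          refine ⟨hz, ?_⟩
          rintro ⟨j, hj, rfl⟩
          by_cases hji : j = i
          · exact hzi (by rw [hji])
          · exact hz' ⟨j, ⟨hji, hj⟩, rfl⟩
        · right
          exact ⟨j, hj.2, rfl⟩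
    · intro j hj
      have hj' := Finset.mem_erase.1 hj
      exact Or.inr ⟨hy j hj'.2, hyne j hj'.2 hj'.1⟩
    · intro j hj
      have hj' := Finset.mem_erase.1 hj
      exact hmem j hj'.2 hj'.1
    · intro j hj
      obtain ⟨hji, hjT⟩ := Finset.mem_erase.1 hj
      rw [insert_sdiff_indep_iff_notMem_closure (hd i hi) (hmem j hjT hji) (hxE j hjT)]
      have hxy : x i ≠ y j := fun h => hx i hi (h ▸ hy j hjT)
      rw [← Set.insert_sdiff_singleton_comm hxy]
      intro hmemcl
      have hnj : x j ∉ M.closure (I \ {y j}) := (hcl j hjT j hjT).1 (hd j hjT)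
      have hni : x j ∈ M.closure (I \ {y i}) := by
        by_contra h
        exact ho i hi j hjT (hlt j hjT hji) ((hcl i hi j hjT).2 h)
      have hn1 : x j ∉ M.closure ((I \ {y i}) \ {y j}) := fun h =>
        hnj (M.closure_subset_closure
          (show ((I \ {y i}) \ {y j}) ⊆ I \ {y j} from fun z hz => ⟨hz.1.1, hz.2⟩) h)
      have h2 := (Matroid.closure_exchange (Set.mem_sdiff_of_mem hmemcl hn1)).1
      have h3 : M.closure (insert (x j) ((I \ {y i}) \ {y j})) ⊆ M.closure (I \ {y i}) := by
        refine M.closure_subset_closure_of_subset_closure (Set.insert_subset hni ?_)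
        exact Set.sdiff_subset.trans (M.subset_closure _ (Set.sdiff_subset.trans hI.subset_ground))
      exact (hcl i hi i hi).1 (hd i hi) (h3 h2)
    · intro a ha b hb hab
      obtain ⟨hai, haT⟩ := Finset.mem_erase.1 ha
      obtain ⟨hbi, hbT⟩ := Finset.mem_erase.1 hb
      rw [insert_sdiff_indep_iff_notMem_closure (hd i hi) (hmem b hbT hbi) (hxE b hbT), not_not]
      have h1 : x b ∈ M.closure (I \ {y i}) := by
        by_contra h
        exact ho i hi b hbT (hlt b hbT hbi) ((hcl i hi b hbT).2 h)
      have h2 : x b ∈ M.closure (I \ {y a}) := by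
        by_contra h
        exact ho a haT b hbT hab ((hcl a haT b hbT).2 h)
      -- both sets are subsets of the independent set `I`, so their closures meet as they do
      have h3 := Matroid.Indep.closure_inter_eq_inter_closure
        (M := M) (I := I \ {y i}) (J := I \ {y a})
        (hI.subset (Set.union_subset Set.sdiff_subset Set.sdiff_subset))
      have h4 : x b ∈ M.closure ((I \ {y i}) ∩ (I \ {y a})) := h3 ▸ ⟨h1, h2⟩
      refine M.closure_subset_closure (fun z hz => ?_) h4
      exact ⟨Or.inr hz.1, hz.2.2⟩
    · rw [Finset.card_erase_of_mem hi, hn]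
      rfl

section SingleMatroid

variable {α : Type*} [DecidableEq α]

/-- `I` is independent in `M` and has maximum `c`-weight among the independent sets of its size. -/
def IsMaxOfCard (M : Matroid α) (c : α → ℝ) (I : Finset α) : Prop :=
  M.Indep I ∧ ∀ K : Finset α, M.Indep K → K.card = I.card → ∑ x ∈ K, c x ≤ ∑ x ∈ I, c x

/-- Symmetric exchange between two independent sets of the same size. -/
theorem exists_common_exchange {M : Matroid α} {I K : Finset α} (hI : M.Indep I)
    (hK : M.Indep K) (hc : K.card = I.card) (hne : ¬ K ⊆ I) :
    ∃ x ∈ K, x ∉ I ∧ ∃ y ∈ I, y ∉ K ∧ M.Indep (insert x ((I : Set α) \ {y})) ∧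
      M.Indep (insert y ((K : Set α) \ {x})) := by
  obtain ⟨x, hxK, hxI⟩ := Finset.not_subset.1 hne
  refine ⟨x, hxK, hxI, ?_⟩
  by_cases hx : M.Indep (insert x (I : Set α))
  · have hKx : M.Indep ((K.erase x : Finset α) : Set α) := by
      simpa using hK.subset Set.sdiff_subset
    obtain ⟨y, hyI, hyK, hy⟩ := hKx.augment_finset hI (by
      rw [Finset.card_erase_of_mem hxK, hc]
      have : 0 < I.card := hc ▸ Finset.card_pos.2 ⟨x, hxK⟩
      omega)
    have hyx : y ≠ x := fun h => hxI (h ▸ hyI)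
    refine ⟨y, hyI, fun h => hyK (by simp [h, hyx]), hx.subset ?_, by simpa using hy⟩
    exact Set.insert_subset_insert Set.sdiff_subset
  · have hxcl : x ∈ M.closure (I : Set α) := by
      by_contra hcl
      exact hx ((hI.insert_indep_iff_of_notMem (by simpa using hxI)).2
        ⟨hK.subset_ground (by simpa using hxK), hcl⟩)
    have hxK' : x ∉ M.closure ((K : Set α) \ {x}) :=
      hK.notMem_closure_sdiff_of_mem (by simpa using hxK)
    have hC := hI.fundCircuit_isCircuit hxcl (by simpa using hxI)
    have hxC := M.mem_fundCircuit x (I : Set α)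
    have hnot : ¬ M.fundCircuit x (I : Set α) \ {x} ⊆ M.closure ((K : Set α) \ {x}) := by
      intro hsub
      have := hC.mem_closure_sdiff_singleton_of_mem hxC
      have h2 := M.closure_subset_closure_of_subset_closure hsub
      exact hxK' (h2 this)
    obtain ⟨y, ⟨hyC, hyx⟩, hycl⟩ := Set.not_subset.1 hnot
    have hyx' : y ≠ x := by simpa using hyx
    have hyI : y ∈ I := by
      have := M.fundCircuit_subset_insert x (I : Set α) hyC
      simpa [hyx'] using this
    have hyK : y ∉ K := fun h =>
      hycl (M.mem_closure_of_mem' (by simp [h, hyx']) (hI.subset_ground (by simpa using hyI)))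
    refine ⟨y, hyI, hyK, ?_, ?_⟩
    · have := (hI.mem_fundCircuit_iff hxcl (by simpa using hxI)).1 hyC
      rwa [← Set.insert_sdiff_singleton_comm hyx'.symm] at this
    · refine ((hK.subset Set.sdiff_subset).insert_indep_iff_of_notMem ?_).2
        ⟨hI.subset_ground (by simpa using hyI), hycl⟩
      simp [hyK]

/-- A set that no single exchange improves has maximum weight among the independent sets of its
size. -/
theorem isMaxOfCard_of_exchange {M : Matroid α} {c : α → ℝ} {I : Finset α} (hI : M.Indep I)
    (h : ∀ y ∈ I, ∀ x ∉ I, M.Indep (insert x ((I : Set α) \ {y})) → c x ≤ c y) :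
    IsMaxOfCard M c I := by
  refine ⟨hI, fun K => ?_⟩
  induction hn : (K \ I).card using Nat.strong_induction_on generalizing K with
  | _ n ih =>
    intro hK hc
    by_cases hsub : K ⊆ I
    · rw [Finset.eq_of_subset_of_card_le hsub hc.ge]
    obtain ⟨x, hxK, hxI, y, hyI, hyK, h1, h2⟩ := exists_common_exchange hI hK hc hsub
    have hle := h y hyI x hxI h1
    have hyK' : y ∉ K.erase x := fun hm => hyK (Finset.mem_of_mem_erase hm)
    have hlt : ((insert y (K.erase x)) \ I).card < n := by
      rw [← hn]
      refine Finset.card_lt_card ⟨fun z hz => ?_, fun hs => ?_⟩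
      · simp only [Finset.mem_sdiff, Finset.mem_insert, Finset.mem_erase] at hz ⊢
        rcases hz with ⟨rfl | hz, hzI⟩
        · exact absurd hyI hzI
        · exact ⟨hz.2, hzI⟩
      · have := hs (Finset.mem_sdiff.2 ⟨hxK, hxI⟩)
        simp only [Finset.mem_sdiff, Finset.mem_insert, Finset.mem_erase] at this
        rcases this with ⟨rfl | hz, -⟩
        · exact hyK hxK
        · exact hz.1 rfl
    have hcard : (insert y (K.erase x)).card = I.card := by
      rw [Finset.card_insert_of_notMem hyK', Finset.card_erase_of_mem hxK, ← hc]
      have : 0 < K.card := Finset.card_pos.2 ⟨x, hxK⟩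
      omega
    have := ih _ hlt _ rfl (by simpa using h2) hcard
    rw [Finset.sum_insert hyK'] at this
    have h3 := Finset.sum_erase_add K c hxK
    linarith

theorem IsMaxOfCard.le_of_exchange {M : Matroid α} {c : α → ℝ} {I : Finset α}
    (h : IsMaxOfCard M c I) {x y : α} (hy : y ∈ I) (hx : x ∉ I)
    (hi : M.Indep (insert x ((I : Set α) \ {y}))) : c x ≤ c y := by
  have hx' : x ∉ I.erase y := fun hm => hx (Finset.mem_of_mem_erase hm)
  have := h.2 (insert x (I.erase y)) (by simpa using hi) (by
    rw [Finset.card_insert_of_notMem hx', Finset.card_erase_of_mem hy]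
    have : 0 < I.card := Finset.card_pos.2 ⟨y, hy⟩
    omega)
  rw [Finset.sum_insert hx'] at this
  have h3 := Finset.sum_erase_add I c hy
  linarith

/-- Adding to a maximum-weight set an element of maximum weight `γ` among those that keep it
independent, and exchanging elements of equal weight, gives a maximum-weight set again, as soon as
the result is independent. -/
theorem IsMaxOfCard.succ {M : Matroid α} {c : α → ℝ} {I I' : Finset α} {γ : ℝ}
    (h : IsMaxOfCard M c I) (hγ : ∀ x ∉ I, M.Indep (insert x (I : Set α)) → c x ≤ γ)
    (hI' : M.Indep I') (hc : I'.card = I.card + 1)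
    (hs : ∑ x ∈ I', c x = ∑ x ∈ I, c x + γ) : IsMaxOfCard M c I' := by
  refine ⟨hI', fun K hK hKc => ?_⟩
  obtain ⟨x, hxK, hxI, hx⟩ := h.1.augment_finset hK (by omega)
  have h1 := h.2 (K.erase x) (by simpa using hK.subset Set.sdiff_subset)
    (by rw [Finset.card_erase_of_mem hxK]; omega)
  have h2 := Finset.sum_erase_add K c hxK
  have h3 := hγ x hxI hx
  linarith

/-- The augmentation step in one of the two matroids. The pairs `(y i, x i)` are exchanged and `x₀`
is added; all of them are tight for the weights `c`, and there are no tight shortcuts. -/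
theorem IsMaxOfCard.augment {ι : Type*} [LinearOrder ι] {M : Matroid α} {c : α → ℝ}
    {I : Finset α} {γ : ℝ} (h : IsMaxOfCard M c I)
    (hγ : ∀ x ∉ I, M.Indep (insert x (I : Set α)) → c x ≤ γ)
    (T : Finset ι) (x y : ι → α) (x₀ : α)
    (hx₀ : x₀ ∉ I) (hx₀' : M.Indep (insert x₀ (I : Set α))) (hcx₀ : c x₀ = γ)
    (hy : ∀ i ∈ T, y i ∈ I) (hx : ∀ i ∈ T, x i ∉ I)
    (hd : ∀ i ∈ T, M.Indep (insert (x i) ((I : Set α) \ {y i})))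
    (ht : ∀ i ∈ T, c (x i) = c (y i))
    (ho : ∀ i ∈ T, ∀ j ∈ T, i < j → M.Indep (insert (x j) ((I : Set α) \ {y i})) →
      c (x j) ≠ c (y i))
    (hs : ∀ i ∈ T, M.Indep (insert (x i) (I : Set α)) → c (x i) ≠ γ) :
    IsMaxOfCard M c (insert x₀ ((I \ T.image y) ∪ T.image x)) ∧
      (insert x₀ ((I \ T.image y) ∪ T.image x)).card = I.card + 1 := by
  have hxE : ∀ j ∈ T, x j ∈ M.E := fun j hj => (hd j hj).subset_ground (Set.mem_insert _ _)
  -- every pair has weight at least `γ`, since `x₀` could replace `y i`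
  have hyγ : ∀ i ∈ T, γ ≤ c (y i) := fun i hi =>
    hcx₀ ▸ h.le_of_exchange (hy i hi) hx₀
      (hx₀'.subset (Set.insert_subset_insert Set.sdiff_subset))
  have hspan : ∀ i ∈ T, x i ∈ M.closure (I : Set α) := by
    intro i hi
    by_contra hcl
    have hind : M.Indep (insert (x i) (I : Set α)) :=
      (h.1.insert_indep_iff_of_notMem (by simpa using hx i hi)).2 ⟨hxE i hi, hcl⟩
    have h1 := hγ (x i) (hx i hi) hind
    have h2 := hyγ i hi
    exact hs i hi hind (le_antisymm h1 (ht i hi ▸ h2))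
  -- order the pairs by weight, ties being broken by the order of the indices
  have hnot : ∀ i ∈ T, ∀ j ∈ T, toLex (c (y i), i) < toLex (c (y j), j) →
      ¬ M.Indep (insert (x j) ((I : Set α) \ {y i})) := by
    intro i hi j hj hlt hind
    have hle := h.le_of_exchange (hy i hi) (hx j hj) hind
    rw [ht j hj] at hle
    rcases Prod.Lex.toLex_lt_toLex.1 hlt with hlt | ⟨heq, hlt⟩
    · exact absurd hle (not_le.2 hlt)
    · exact ho i hi j hj hlt hind ((ht j hj).trans heq.symm)
  have hcases : ∀ i ∈ T, ∀ j ∈ T, i ≠ j → toLex (c (y i), i) < toLex (c (y j), j) ∨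
      toLex (c (y j), j) < toLex (c (y i), i) := fun i _ j _ hij =>
    lt_or_gt_of_ne (fun h => hij (congrArg (fun p => (ofLex p).2) h))
  have hxinj : Set.InjOn x T := by
    intro i hi j hj hij
    by_contra hne
    rcases hcases i hi j hj hne with hlt | hlt
    · exact hnot i hi j hj hlt (hij ▸ hd i hi)
    · exact hnot j hj i hi hlt (hij ▸ hd j hj)
  have hyinj : Set.InjOn y T := by
    intro i hi j hj hij
    by_contra hne
    rcases hcases i hi j hj hne with hlt | hlt
    · exact hnot i hi j hj hlt (hij ▸ hd j hj)
    · exact hnot j hj i hi hlt (hij ▸ hd i hi)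
  have hind := indep_exchange_of_triangular T (fun i => toLex (c (y i), i))
    (fun a _ b _ hab => congrArg (fun p => (ofLex p).2) hab) x y I h.1
    (by simpa using hy) (by simpa using hx) hd hnot
  have hx₀E : x₀ ∈ M.E := hx₀'.subset_ground (Set.mem_insert _ _)
  have hx₀cl : x₀ ∉ M.closure (I : Set α) :=
    ((h.1.insert_indep_iff_of_notMem (by simpa using hx₀)).1 hx₀').2
  have hsubcl : ((I : Set α) \ y '' T) ∪ x '' T ⊆ M.closure (I : Set α) := by
    refine Set.union_subset (Set.sdiff_subset.trans (M.subset_closure _ h.1.subset_ground)) ?_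
    rintro _ ⟨i, hi, rfl⟩
    exact hspan i hi
  have hx₀not : x₀ ∉ (I \ T.image y) ∪ T.image x := by
    intro hm
    refine hx₀cl (hsubcl ?_)
    simpa using hm
  have hind' : M.Indep ((insert x₀ ((I \ T.image y) ∪ T.image x) : Finset α) : Set α) := by
    have : M.Indep (insert x₀ (((I : Set α) \ y '' T) ∪ x '' T)) := by
      rw [hind.insert_indep_iff]
      exact Or.inl ⟨hx₀E, fun hm => hx₀cl (M.closure_subset_closure_of_subset_closure hsubcl hm)⟩
    simpa using this
  have hysub : T.image y ⊆ I := by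
    intro z hz
    obtain ⟨i, hi, rfl⟩ := Finset.mem_image.1 hz
    exact hy i hi
  have hdisj : Disjoint (I \ T.image y) (T.image x) := by
    rw [Finset.disjoint_right]
    intro z hz hz'
    obtain ⟨i, hi, rfl⟩ := Finset.mem_image.1 hz
    exact hx i hi (Finset.mem_sdiff.1 hz').1
  have hcard : (insert x₀ ((I \ T.image y) ∪ T.image x)).card = I.card + 1 := by
    rw [Finset.card_insert_of_notMem hx₀not, Finset.card_union_of_disjoint hdisj,
      Finset.card_sdiff_of_subset hysub, Finset.card_image_of_injOn hxinj,
      Finset.card_image_of_injOn hyinj]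
    have := Finset.card_le_card hysub
    rw [Finset.card_image_of_injOn hyinj] at this
    omega
  refine ⟨h.succ hγ hind' hcard ?_, hcard⟩
  rw [Finset.sum_insert hx₀not, Finset.sum_union hdisj, Finset.sum_image hxinj, hcx₀,
    ← Finset.sum_sdiff hysub, Finset.sum_image hyinj, Finset.sum_congr rfl ht]
  ring

end SingleMatroid

/-! ### Shortest walks in a digraph with vertex lengths -/

section Walks

variable {α : Type*}

/-- `DiWalk Src Arc ℓ j v r`: some walk with exactly `j` arcs leads from a vertex in `Src` to `v`
and has length `r`, the sum of the lengths `ℓ` of its vertices, both ends included. -/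
inductive DiWalk (Src : α → Prop) (Arc : α → α → Prop) (ℓ : α → ℝ) : ℕ → α → ℝ → Prop where
  | start {v : α} : Src v → DiWalk Src Arc ℓ 0 v (ℓ v)
  | step {j : ℕ} {u v : α} {r : ℝ} :
      DiWalk Src Arc ℓ j u r → Arc u v → DiWalk Src Arc ℓ (j + 1) v (r + ℓ v)

/-- The total length of the vertices `f 0, …, f j`. -/
def pathLen (ℓ : α → ℝ) (f : ℕ → α) (j : ℕ) : ℝ := ∑ i ∈ Finset.range (j + 1), ℓ (f i)

/-- `f 0, …, f j` is a shortest walk from `Src` to `Snk` and, among the shortest ones, one with the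
fewest arcs. -/
structure IsShortestPath (Src Snk : α → Prop) (Arc : α → α → Prop) (ℓ : α → ℝ) (f : ℕ → α)
    (j : ℕ) : Prop where
  src : Src (f 0)
  arc : ∀ i < j, Arc (f i) (f (i + 1))
  snk : Snk (f j)
  min : ∀ l v r, DiWalk Src Arc ℓ l v r → Snk v →
    pathLen ℓ f j ≤ r ∧ (r = pathLen ℓ f j → j ≤ l)

variable {Src Snk : α → Prop} {Arc : α → α → Prop} {ℓ : α → ℝ}

theorem pathLen_succ (f : ℕ → α) (j : ℕ) : pathLen ℓ f (j + 1) = pathLen ℓ f j + ℓ (f (j + 1)) :=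
  Finset.sum_range_succ _ _

theorem pathLen_zero (f : ℕ → α) : pathLen ℓ f 0 = ℓ (f 0) := by simp [pathLen]

theorem DiWalk.of_path {f : ℕ → α} {j : ℕ} (h0 : Src (f 0)) (h : ∀ i < j, Arc (f i) (f (i + 1)))
    (i : ℕ) (hi : i ≤ j) : DiWalk Src Arc ℓ i (f i) (pathLen ℓ f i) := by
  induction i with
  | zero => rw [pathLen_zero]; exact .start h0
  | succ i ih => rw [pathLen_succ]; exact .step (ih (by omega)) (h i hi)

theorem DiWalk.exists_path {l : ℕ} {v : α} {r : ℝ} (h : DiWalk Src Arc ℓ l v r) :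
    ∃ f : ℕ → α, Src (f 0) ∧ (∀ i < l, Arc (f i) (f (i + 1))) ∧ f l = v ∧ pathLen ℓ f l = r := by
  induction h with
  | @start v h => exact ⟨fun _ => v, h, by simp, rfl, pathLen_zero _⟩
  | @step j u v r hw ha ih =>
    obtain ⟨f, h0, h1, h2, h3⟩ := ih
    refine ⟨fun i => if i ≤ j then f i else v, by simpa using h0, fun i hi => ?_, by simp, ?_⟩
    · rcases Nat.lt_succ_iff_lt_or_eq.1 hi with hi | rfl
      · simpa [hi, hi.le] using h1 i hi
      · simpa [h2] using ha
    · rw [pathLen_succ, ← h3]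
      congr 1
      · refine Finset.sum_congr rfl fun i hi => ?_
        simp [Nat.lt_succ_iff.1 (Finset.mem_range.1 hi)]
      · simp

theorem DiWalk.append_path {f : ℕ → α} {j : ℕ} (h : ∀ i < j, Arc (f i) (f (i + 1))) {i l : ℕ}
    {r : ℝ} (hi : i ≤ j) (hw : DiWalk Src Arc ℓ l (f i) r) :
    DiWalk Src Arc ℓ (l + (j - i)) (f j) (r + (pathLen ℓ f j - pathLen ℓ f i)) := by
  induction j, hi using Nat.le_induction with
  | base => simpa using hw
  | succ j hij ih =>
    have := (ih fun i hi => h i (by omega)).step (h j (by omega))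
    rw [pathLen_succ]
    convert this using 1
    · omega
    · ring

theorem DiWalk.potential_add_le {φ : α → ℝ} (hφ : ∀ u v, Arc u v → φ v ≤ φ u + ℓ v) {C : ℝ}
    (hC : ∀ v, Src v → φ v + C ≤ ℓ v) {l : ℕ} {v : α} {r : ℝ} (h : DiWalk Src Arc ℓ l v r) :
    φ v + C ≤ r := by
  induction h with
  | start h => exact hC _ h
  | step _ ha ih => linarith [hφ _ _ ha]

theorem DiWalk.mem {E : Finset α} (hS : ∀ v, Src v → v ∈ E) (hA : ∀ u v, Arc u v → v ∈ E)
    {l : ℕ} {v : α} {r : ℝ} (h : DiWalk Src Arc ℓ l v r) : v ∈ E := by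
  cases h with
  | start h => exact hS _ h
  | step _ ha => exact hA _ _ ha

theorem potential_le_of_path {φ : α → ℝ} (hφ : ∀ u v, Arc u v → φ v ≤ φ u + ℓ v) {f : ℕ → α}
    {j : ℕ} (h : ∀ i < j, Arc (f i) (f (i + 1))) {a b : ℕ} (hab : a ≤ b) (hb : b ≤ j) :
    φ (f b) - φ (f a) ≤ pathLen ℓ f b - pathLen ℓ f a := by
  induction b, hab using Nat.le_induction with
  | base => simp
  | succ b hab ih =>
    have := ih (by omega)
    have := hφ _ _ (h b (by omega))
    rw [pathLen_succ]
    linarith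

/-- If there is a feasible potential, then closed walks can be cut out: a walk may be replaced by
one that is no longer and has fewer arcs than there are vertices. -/
theorem DiWalk.exists_lt_card {φ : α → ℝ} (hφ : ∀ u v, Arc u v → φ v ≤ φ u + ℓ v) {E : Finset α}
    (hS : ∀ v, Src v → v ∈ E) (hA : ∀ u v, Arc u v → v ∈ E)
    {l : ℕ} {v : α} {r : ℝ} (h : DiWalk Src Arc ℓ l v r) :
    ∃ l' r', l' < E.card ∧ l' ≤ l ∧ r' ≤ r ∧ DiWalk Src Arc ℓ l' v r' := by
  induction l using Nat.strong_induction_on generalizing r with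
  | _ l ih =>
    by_cases hl : l < E.card
    · exact ⟨l, r, hl, le_rfl, le_rfl, h⟩
    obtain ⟨f, h0, h1, h2, h3⟩ := h.exists_path
    have hmem : ∀ i ∈ Finset.range (l + 1), f i ∈ E := fun i hi =>
      (DiWalk.of_path (ℓ := ℓ) h0 h1 i (Nat.lt_succ_iff.1 (Finset.mem_range.1 hi))).mem hS hA
    obtain ⟨a, ha, b, hb, hne, heq⟩ :=
      Finset.exists_ne_map_eq_of_card_lt_of_maps_to (by rw [Finset.card_range]; omega) hmem
    have key : ∀ a b, a < b → b ≤ l → f a = f b →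
        ∃ l' r', l' < E.card ∧ l' ≤ l ∧ r' ≤ r ∧ DiWalk Src Arc ℓ l' v r' := by
      intro a b hab hb heq
      have hw := (heq ▸ DiWalk.of_path (ℓ := ℓ) h0 h1 a (by omega) :
        DiWalk Src Arc ℓ a (f b) (pathLen ℓ f a)).append_path h1 hb
      have hle := potential_le_of_path hφ h1 hab.le hb
      rw [h2, h3] at hw
      rw [heq] at hle
      obtain ⟨l', r', h4, h5, h6, h7⟩ := ih _ (by omega) hw
      exact ⟨l', r', h4, by omega, by linarith, h7⟩
    have ha' := Finset.mem_range.1 ha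
    have hb' := Finset.mem_range.1 hb
    rcases lt_or_gt_of_ne hne with hlt | hlt
    · exact key a b hlt (by omega) heq
    · exact key b a hlt (by omega) heq.symm

namespace IsShortestPath

variable {f : ℕ → α} {j : ℕ}

/-- Every vertex of a shortest path is reached by the path in the best possible way. -/
theorem prefix_min (h : IsShortestPath Src Snk Arc ℓ f j) {i l : ℕ} {r : ℝ} (hi : i ≤ j)
    (hw : DiWalk Src Arc ℓ l (f i) r) : pathLen ℓ f i ≤ r ∧ (r = pathLen ℓ f i → i ≤ l) := by
  have := h.min _ _ _ (hw.append_path h.arc hi) h.snk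
  constructor
  · linarith [this.1]
  · intro hr
    have := this.2 (by rw [hr]; ring)
    omega

/-- The distances from the sources are a feasible potential. At vertices that cannot be reached, a
large constant is added to a given feasible potential. -/
theorem exists_potential (h : IsShortestPath Src Snk Arc ℓ f j) {φ : α → ℝ}
    (hφ : ∀ u v, Arc u v → φ v ≤ φ u + ℓ v) {E : Finset α} (hS : ∀ v, Src v → v ∈ E)
    (hA : ∀ u v, Arc u v → u ∈ E ∧ v ∈ E) (hT : ∀ v, Snk v → v ∈ E) :
    ∃ φ' : α → ℝ, (∀ u v, Arc u v → φ' v ≤ φ' u + ℓ v) ∧ (∀ v, Src v → φ' v ≤ ℓ v) ∧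
      (∀ v, Snk v → pathLen ℓ f j ≤ φ' v) ∧ ∀ i ≤ j, φ' (f i) = pathLen ℓ f i := by
  classical
  obtain ⟨C, hC⟩ : ∃ C, ∀ v, Src v → φ v + C ≤ ℓ v := by
    obtain ⟨C, hC⟩ := (E.image fun v => φ v - ℓ v).exists_le
    exact ⟨-C, fun v hv => by linarith [hC _ (Finset.mem_image_of_mem _ (hS v hv))]⟩
  set D : α → Set ℝ := fun v => {r | ∃ l, DiWalk Src Arc ℓ l v r} with hD
  have hbdd : ∀ v, BddBelow (D v) := fun v =>
    ⟨φ v + C, fun r ⟨l, hw⟩ => hw.potential_add_le hφ hC⟩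
  -- with the constant `B`, unreachable vertices get larger values than the other end of each arc
  -- from them requires, and unreachable sinks get at least the length of the path
  obtain ⟨B, hB⟩ :=
    (E.image (fun v => sInf (D v) - φ v) ∪ E.image fun v => pathLen ℓ f j - φ v).exists_le
  have hB1 : ∀ v ∈ E, sInf (D v) ≤ φ v + B := fun v hv => by
    linarith [hB _ (Finset.mem_union_left _ (Finset.mem_image_of_mem _ hv))]
  have hB2 : ∀ v ∈ E, pathLen ℓ f j ≤ φ v + B := fun v hv => by
    linarith [hB _ (Finset.mem_union_right _ (Finset.mem_image_of_mem _ hv))]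
  refine ⟨fun v => if (D v).Nonempty then sInf (D v) else φ v + B, ?_, ?_, ?_, ?_⟩
  · intro u v huv
    by_cases hu : (D u).Nonempty
    · have hv : (D v).Nonempty := by
        obtain ⟨r, l, hw⟩ := hu
        exact ⟨_, _, hw.step huv⟩
      simp only [hu, hv, if_true]
      rw [← sub_le_iff_le_add]
      refine le_csInf hu ?_
      rintro r ⟨l, hw⟩
      rw [sub_le_iff_le_add]
      exact csInf_le (hbdd v) ⟨_, hw.step huv⟩
    · simp only [hu, if_false]
      have h1 := hφ u v huv
      have h2 := hB1 v (hA u v huv).2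
      split_ifs <;> linarith
  · intro v hv
    have hw : DiWalk Src Arc ℓ 0 v (ℓ v) := .start hv
    have hne : (D v).Nonempty := ⟨_, _, hw⟩
    simp only [hne, if_true]
    exact csInf_le (hbdd v) ⟨_, hw⟩
  · intro v hv
    by_cases hne : (D v).Nonempty
    · simp only [hne, if_true]
      refine le_csInf hne ?_
      rintro r ⟨l, hw⟩
      exact (h.min _ _ _ hw hv).1
    · simp only [hne, if_false]
      exact hB2 v (hT v hv)
  · intro i hi
    have hw : DiWalk Src Arc ℓ i (f i) (pathLen ℓ f i) := DiWalk.of_path h.src h.arc i hi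
    have hne : (D (f i)).Nonempty := ⟨_, _, hw⟩
    simp only [hne, if_true]
    refine le_antisymm (csInf_le (hbdd _) ⟨_, hw⟩) (le_csInf hne ?_)
    rintro r ⟨l, hw⟩
    exact (h.prefix_min hi hw).1

end IsShortestPath

end Walks

/-! ### Augmenting paths for weighted matroid intersection -/

section Augmentation

variable {α : Type*}

/-- The sources of the exchange graph of `I`; its sinks are `AugSource R I`. -/
def AugSource (L : Matroid α) (I : Finset α) (v : α) : Prop :=
  v ∉ I ∧ L.Indep (insert v (I : Set α))

/-- The arcs of the exchange graph of `I` for the matroids `L` and `R`. -/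
def ExchangeArc (L R : Matroid α) (I : Finset α) (u v : α) : Prop :=
  (u ∉ I ∧ v ∈ I ∧ R.Indep (insert u ((I : Set α) \ {v}))) ∨
    (u ∈ I ∧ v ∉ I ∧ L.Indep (insert v ((I : Set α) \ {u})))

/-- The length of a vertex of the exchange graph: minus the gain of toggling it. -/
def exchangeLen [DecidableEq α] (wt : α → ℝ) (I : Finset α) (v : α) : ℝ :=
  if v ∈ I then wt v else -wt v

/-- `I` is a common independent set with a weight splitting `wt = c + (wt - c)` that certifies that
its weight is maximum among the common independent sets of its size. -/
def IsExtremeCommon (L R : Matroid α) (wt : α → ℝ) (I : Finset α) : Prop :=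
  ∃ c : α → ℝ, IsMaxOfCard L c I ∧ IsMaxOfCard R (fun x => wt x - c x) I

variable {L R : Matroid α} {wt : α → ℝ} {I : Finset α}

theorem IsExtremeCommon.sum_le (h : IsExtremeCommon L R wt I) {K : Finset α} (hL : L.Indep K)
    (hR : R.Indep K) (hc : K.card = I.card) : ∑ x ∈ K, wt x ≤ ∑ x ∈ I, wt x := by
  obtain ⟨c, h1, h2⟩ := h
  have h3 := h1.2 K hL hc
  have h4 := h2.2 K hR hc
  rw [Finset.sum_sub_distrib, Finset.sum_sub_distrib] at h4
  linarith

theorem isExtremeCommon_empty : IsExtremeCommon L R wt ∅ :=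
  ⟨0, ⟨by simp, fun K _ h => by simp [Finset.card_eq_zero.1 h]⟩,
    ⟨by simp, fun K _ h => by simp [Finset.card_eq_zero.1 h]⟩⟩

/-- By the weight splitting there are no negative closed walks in the exchange graph. -/
theorem IsExtremeCommon.exists_potential [DecidableEq α] (h : IsExtremeCommon L R wt I) :
    ∃ φ : α → ℝ, ∀ u v, ExchangeArc L R I u v → φ v ≤ φ u + exchangeLen wt I v := by
  obtain ⟨c, h1, h2⟩ := h
  refine ⟨fun v => if v ∈ I then c v else c v - wt v, ?_⟩
  rintro u v (⟨hu, hv, hi⟩ | ⟨hu, hv, hi⟩)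
  · have := h2.le_of_exchange hv hu hi
    simp only [hu, hv, exchangeLen, if_true, if_false]
    linarith
  · have := h1.le_of_exchange hu hv hi
    simp only [hu, hv, exchangeLen, if_true, if_false]
    linarith

/-- If no walk of the exchange graph leads from a source to a sink, then `I` is a common independent
set of maximum size. -/
theorem card_le_of_no_walk {ℓ : α → ℝ} (hIL : L.Indep I) (hIR : R.Indep I)
    (hno : ∀ l v r, DiWalk (AugSource L I) (ExchangeArc L R I) ℓ l v r → ¬ AugSource R I v)
    {K : Finset α} (hL : L.Indep K) (hR : R.Indep K) : K.card ≤ I.card := by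
  classical
  set U : Set α := {v | ∃ l r, DiWalk (AugSource L I) (ExchangeArc L R I) ℓ l v r} with hU
  -- inside `U` the set `I` is as large as possible for `R`, and outside `U` for `L`
  have key : ∀ (M : Matroid α) (A : Set α), M.Indep I → M.Indep K →
      (∀ x ∈ K, x ∈ A → x ∉ I → ¬ M.Indep (insert x (I : Set α)) ∧
        ∀ y ∈ I, y ∉ A → ¬ M.Indep (insert x ((I : Set α) \ {y}))) →
      (K.filter (· ∈ A)).card ≤ (I.filter (· ∈ A)).card := by
    intro M A hI hK h
    by_contra hlt
    obtain ⟨x, hxK, hxI, hx⟩ := Matroid.Indep.augment_finset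
      (hI.subset (Finset.coe_subset.2 (Finset.filter_subset (· ∈ A) I)))
      (hK.subset (Finset.coe_subset.2 (Finset.filter_subset (· ∈ A) K))) (not_le.1 hlt)
    obtain ⟨hxK, hxA⟩ := Finset.mem_filter.1 hxK
    have hxI : x ∉ I := fun hm => hxI (Finset.mem_filter.2 ⟨hm, hxA⟩)
    have hxE : x ∈ M.E := hK.subset_ground (by simpa using hxK)
    obtain ⟨h1, h2⟩ := h x hxK hxA hxI
    have hcl : x ∈ M.closure (I : Set α) := by
      by_contra hcl
      exact h1 ((hI.insert_indep_iff_of_notMem (by simpa using hxI)).2 ⟨hxE, hcl⟩)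
    have hC := hI.fundCircuit_isCircuit hcl (by simpa using hxI)
    refine hC.dep.not_indep (hx.subset fun z hz => ?_)
    rcases eq_or_ne z x with rfl | hzx
    · exact Set.mem_insert _ _
    have hzI : z ∈ I := by simpa [hzx] using M.fundCircuit_subset_insert x (I : Set α) hz
    have hzi := (hI.mem_fundCircuit_iff hcl (by simpa using hxI)).1 hz
    rw [← Set.insert_sdiff_singleton_comm hzx.symm] at hzi
    refine Set.mem_insert_of_mem _ ?_
    rw [Finset.mem_coe, Finset.mem_filter]
    exact ⟨hzI, by_contra fun hzA => h2 z hzI hzA hzi⟩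
  have h1 := key R U hIR hR (by
    rintro x - ⟨l, r, hw⟩ hxI
    refine ⟨fun hi => hno l x r hw ⟨hxI, hi⟩, fun y hy hyU hi => hyU ?_⟩
    exact ⟨_, _, hw.step (Or.inl ⟨hxI, hy, hi⟩)⟩)
  have h2 := key L Uᶜ hIL hL (by
    rintro x - hxU hxI
    refine ⟨fun hi => hxU ⟨_, _, .start ⟨hxI, hi⟩⟩, fun y hy hyU hi => hxU ?_⟩
    obtain ⟨l, r, hw⟩ := not_not.1 hyU
    exact ⟨_, _, hw.step (Or.inr ⟨hy, hxI, hi⟩)⟩)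
  have h3 := Finset.card_filter_add_card_filter_not (s := K) (· ∈ U)
  have h4 := Finset.card_filter_add_card_filter_not (s := I) (· ∈ U)
  simp only [Set.mem_compl_iff] at h2
  omega

theorem exchangeArc_mem_iff {u v : α} (h : ExchangeArc L R I u v) : v ∈ I ↔ u ∉ I := by
  rcases h with ⟨hu, hv, -⟩ | ⟨hu, hv, -⟩ <;> simp [hu, hv]

/-- Augmenting along a shortest path with the fewest arcs gives an extreme set with one more
element. -/
theorem IsExtremeCommon.augment [DecidableEq α] (h : IsExtremeCommon L R wt I) {E : Finset α}
    (hLE : L.E ⊆ E) (hRE : R.E ⊆ E) {f : ℕ → α} {j : ℕ}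
    (hf : IsShortestPath (AugSource L I) (AugSource R I) (ExchangeArc L R I) (exchangeLen wt I)
      f j) :
    Set.InjOn f (Set.Iic j) ∧
      IsExtremeCommon L R wt (symmDiff I ((Finset.range (j + 1)).image f)) ∧
      (symmDiff I ((Finset.range (j + 1)).image f)).card = I.card + 1 := by
  have hIL : L.Indep I := let ⟨_, h, _⟩ := h; h.1
  have hIR : R.Indep I := let ⟨_, _, h⟩ := h; h.1
  obtain ⟨φ₀, hφ₀⟩ := h.exists_potential
  have hIE : ∀ v ∈ I, v ∈ E := fun v hv => hLE (hIL.subset_ground hv)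
  obtain ⟨φ, hφ, hsrc, hsnk, hpath⟩ := hf.exists_potential hφ₀ (E := E)
    (fun v hv => hLE (hv.2.subset_ground (Set.mem_insert _ _)))
    (by
      rintro u v (⟨hu, hv, hi⟩ | ⟨hu, hv, hi⟩)
      · exact ⟨hRE (hi.subset_ground (Set.mem_insert _ _)), hIE v hv⟩
      · exact ⟨hIE u hu, hLE (hi.subset_ground (Set.mem_insert _ _))⟩)
    (fun v hv => hRE (hv.2.subset_ground (Set.mem_insert _ _)))
  -- a walk that reaches a vertex of the path at the right length has not fewer arcs than the path
  have hmin : ∀ i ≤ j, ∀ l r,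
      DiWalk (AugSource L I) (ExchangeArc L R I) (exchangeLen wt I) l (f i) r →
        r = φ (f i) → i ≤ l := fun i hi l r hw hr =>
    (hf.prefix_min hi hw).2 (hr.trans (hpath i hi))
  have hwalk : ∀ i ≤ j,
      DiWalk (AugSource L I) (ExchangeArc L R I) (exchangeLen wt I) i (f i) (φ (f i)) :=
    fun i hi => hpath i hi ▸ DiWalk.of_path hf.src hf.arc i hi
  have hinj : Set.InjOn f (Set.Iic j) := by
    intro a ha b hb hab
    refine le_antisymm (hmin a ha b _ (hab ▸ hwalk b hb) rfl) (hmin b hb a _ (hab ▸ hwalk a ha) rfl)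
  have hpar : ∀ i ≤ j, (f i ∈ I ↔ i % 2 = 1) := by
    intro i
    induction i with
    | zero => simpa using hf.src.1
    | succ i ih =>
      intro hi
      rw [exchangeArc_mem_iff (hf.arc i hi), ih (by omega)]
      omega
  obtain ⟨t, rfl⟩ : ∃ t, j = 2 * t := by
    refine ⟨j / 2, ?_⟩
    have := mt (hpar j le_rfl).2 hf.snk.1
    omega
  have hstep : ∀ i < 2 * t, φ (f (i + 1)) = φ (f i) + exchangeLen wt I (f (i + 1)) := by
    intro i hi
    rw [hpath _ hi.le, hpath _ hi, pathLen_succ]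
  have hφ0 : φ (f 0) = exchangeLen wt I (f 0) := by rw [hpath 0 (by omega), pathLen_zero]
  have hnI : ∀ i ≤ t, f (2 * i) ∉ I := fun i hi hm => by
    have := (hpar (2 * i) (by omega)).1 hm
    omega
  have hI : ∀ i < t, f (2 * i + 1) ∈ I := fun i hi => (hpar _ (by omega)).2 (by omega)
  have harcL : ∀ i < t, L.Indep (insert (f (2 * i + 2)) ((I : Set α) \ {f (2 * i + 1)})) := by
    intro i hi
    rcases hf.arc (2 * i + 1) (by omega) with ⟨hu, -, -⟩ | ⟨-, -, hi⟩
    · exact absurd (hI i hi) hu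
    · exact hi
  have harcR : ∀ i < t, R.Indep (insert (f (2 * i)) ((I : Set α) \ {f (2 * i + 1)})) := by
    intro i hi
    rcases hf.arc (2 * i) (by omega) with ⟨-, -, hi⟩ | ⟨hu, -, -⟩
    · exact hi
    · exact absurd hu (hnI i hi.le)
  -- the splitting defined by the distances certifies `I`, and the steps of the path are tight for it
  set c : α → ℝ := fun v => if v ∈ I then φ v else wt v + φ v with hc
  have hcI : ∀ v ∈ I, c v = φ v := fun v hv => by simp [hc, hv]
  have hcnI : ∀ v ∉ I, c v = wt v + φ v := fun v hv => by simp [hc, hv]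
  have hlI : ∀ v ∈ I, exchangeLen wt I v = wt v := fun v hv => by simp [exchangeLen, hv]
  have hlnI : ∀ v ∉ I, exchangeLen wt I v = -wt v := fun v hv => by simp [exchangeLen, hv]
  have hmaxL : IsMaxOfCard L c I := by
    refine isMaxOfCard_of_exchange hIL fun y hy x hx hi => ?_
    have := hφ y x (Or.inr ⟨hy, hx, hi⟩)
    rw [hlnI x hx] at this
    rw [hcI y hy, hcnI x hx]
    linarith
  have hmaxR : IsMaxOfCard R (fun v => wt v - c v) I := by
    refine isMaxOfCard_of_exchange hIR fun y hy x hx hi => ?_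
    have := hφ x y (Or.inl ⟨hx, hy, hi⟩)
    rw [hlI y hy] at this
    rw [hcI y hy, hcnI x hx]
    linarith
  have hL := hmaxL.augment (γ := 0)
    (fun x hx hi => by
      have := hsrc x ⟨hx, hi⟩
      rw [hlnI x hx] at this
      rw [hcnI x hx]
      linarith)
    (Finset.range t) (fun i => f (2 * i + 2)) (fun i => f (2 * i + 1)) (f 0)
    hf.src.1 hf.src.2
    (by rw [hcnI _ hf.src.1, hφ0, hlnI _ hf.src.1]; ring)
    (fun i hi => hI i (Finset.mem_range.1 hi))
    (fun i hi => hnI (i + 1) (Finset.mem_range.1 hi))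
    (fun i hi => harcL i (Finset.mem_range.1 hi))
    (fun i hi => by
      have hi := Finset.mem_range.1 hi
      have h1 := hstep (2 * i + 1) (by omega)
      have h2 := hnI (i + 1) hi
      rw [show 2 * (i + 1) = 2 * i + 2 by ring] at h2
      rw [show 2 * i + 1 + 1 = 2 * i + 2 by ring, hlnI _ h2] at h1
      rw [hcI _ (hI i hi), hcnI _ h2, h1]
      ring)
    (fun i hi k hk hik hind heq => by
      have hi := Finset.mem_range.1 hi
      have hk := Finset.mem_range.1 hk
      have h2 : f (2 * k + 2) ∉ I := hnI (k + 1) hk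
      rw [hcI _ (hI i hi), hcnI _ h2] at heq
      have := hmin (2 * k + 2) (by omega) _ _
        ((hwalk (2 * i + 1) (by omega)).step (Or.inr ⟨hI i hi, h2, hind⟩))
        (by rw [hlnI _ h2]; linarith)
      omega)
    (fun i hi hind heq => by
      have hi := Finset.mem_range.1 hi
      have h2 : f (2 * i + 2) ∉ I := hnI (i + 1) hi
      rw [hcnI _ h2] at heq
      have := hmin (2 * i + 2) (by omega) _ _ (.start ⟨h2, hind⟩)
        (by rw [hlnI _ h2]; linarith)
      omega)
  -- in the second matroid the path is traversed backward, hence the order is reversed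
  have hR := hmaxR.augment (γ := -pathLen (exchangeLen wt I) f (2 * t))
    (fun x hx hi => by
      have := hsnk x ⟨hx, hi⟩
      rw [hcnI x hx]
      linarith)
    ((Finset.range t).map OrderDual.toDual.toEmbedding)
    (fun i => f (2 * OrderDual.ofDual i)) (fun i => f (2 * OrderDual.ofDual i + 1)) (f (2 * t))
    hf.snk.1 hf.snk.2
    (by rw [hcnI _ hf.snk.1, hpath _ le_rfl]; ring)
    (fun i hi => hI _ (by simpa using hi))
    (fun i hi => hnI _ (by simpa using (Finset.mem_range.1 (by simpa using hi)).le))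
    (fun i hi => harcR _ (by simpa using hi))
    (fun i hi => by
      have hi : OrderDual.ofDual i < t := by simpa using hi
      have h1 := hstep (2 * OrderDual.ofDual i) (by omega)
      have h2 := hnI _ hi.le
      rw [hlI _ (hI _ hi)] at h1
      rw [hcI _ (hI _ hi), hcnI _ h2, h1]
      ring)
    (fun i hi k hk hik hind heq => by
      have hi : OrderDual.ofDual i < t := by simpa using hi
      have hk : OrderDual.ofDual k < t := by simpa using hk
      have hik : OrderDual.ofDual k < OrderDual.ofDual i := hik
      have h2 := hnI _ hk.le
      rw [hcI _ (hI _ hi), hcnI _ h2] at heq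
      have := hmin (2 * OrderDual.ofDual i + 1) (by omega) _ _
        ((hwalk (2 * OrderDual.ofDual k) (by omega)).step (Or.inl ⟨h2, hI _ hi, hind⟩))
        (by rw [hlI _ (hI _ hi)]; linarith)
      omega)
    (fun i hi hind heq => by
      have hi : OrderDual.ofDual i < t := by simpa using hi
      have h2 := hnI _ hi.le
      rw [hcnI _ h2] at heq
      have := (hf.min _ _ _ (hwalk (2 * OrderDual.ofDual i) (by omega)) ⟨h2, hind⟩).2 (by linarith)
      omega)
  have hsd : ∀ v, v ∈ symmDiff I ((Finset.range (2 * t + 1)).image f) ↔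
      ((v ∈ I ∧ ∀ i < t, f (2 * i + 1) ≠ v) ∨ ∃ i ≤ t, f (2 * i) = v) := by
    intro v
    simp only [Finset.mem_symmDiff, Finset.mem_image, Finset.mem_range]
    constructor
    · rintro (⟨hv, hn⟩ | ⟨⟨i, hi, rfl⟩, hv⟩)
      · exact Or.inl ⟨hv, fun i hi he => hn ⟨_, by omega, he⟩⟩
      · have := mt (hpar i (by omega)).2 hv
        exact Or.inr ⟨i / 2, by omega, by congr 1; omega⟩
    · rintro (⟨hv, hn⟩ | ⟨i, hi, rfl⟩)
      · refine Or.inl ⟨hv, ?_⟩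
        rintro ⟨i, hi, rfl⟩
        have := (hpar i (by omega)).1 hv
        exact hn (i / 2) (by omega) (by congr 1; omega)
      · exact Or.inr ⟨⟨_, by omega, rfl⟩, hnI i hi⟩
  have hsL : insert (f 0) ((I \ (Finset.range t).image fun i => f (2 * i + 1)) ∪
      (Finset.range t).image fun i => f (2 * i + 2)) =
      symmDiff I ((Finset.range (2 * t + 1)).image f) := by
    ext v
    rw [hsd]
    simp only [Finset.mem_insert, Finset.mem_union, Finset.mem_sdiff, Finset.mem_image,
      Finset.mem_range, not_exists, not_and]
    constructor
    · rintro (rfl | h | ⟨i, hi, rfl⟩)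
      · exact Or.inr ⟨0, by omega, rfl⟩
      · exact Or.inl h
      · exact Or.inr ⟨i + 1, by omega, rfl⟩
    · rintro (h | ⟨i, hi, rfl⟩)
      · exact Or.inr (Or.inl h)
      · cases i with
        | zero => exact Or.inl rfl
        | succ i => exact Or.inr (Or.inr ⟨i, by omega, rfl⟩)
  have hsR : insert (f (2 * t)) ((I \ ((Finset.range t).map OrderDual.toDual.toEmbedding).image
      fun i => f (2 * OrderDual.ofDual i + 1)) ∪
      ((Finset.range t).map OrderDual.toDual.toEmbedding).image
        fun i => f (2 * OrderDual.ofDual i)) =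
      symmDiff I ((Finset.range (2 * t + 1)).image f) := by
    ext v
    rw [hsd]
    simp only [Finset.mem_insert, Finset.mem_union, Finset.mem_sdiff, Finset.mem_image,
      Finset.mem_map_equiv, OrderDual.exists, OrderDual.ofDual_toDual, OrderDual.toDual_symm_eq,
      Finset.mem_range, not_exists, not_and]
    constructor
    · rintro (rfl | h | ⟨i, hi, rfl⟩)
      · exact Or.inr ⟨t, le_rfl, rfl⟩
      · exact Or.inl ⟨h.1, fun i hi => h.2 (OrderDual.toDual i) hi⟩
      · exact Or.inr ⟨i, by omega, rfl⟩
    · rintro (h | ⟨i, hi, rfl⟩)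
      · exact Or.inr (Or.inl ⟨h.1, fun i hi => h.2 _ hi⟩)
      · rcases hi.lt_or_eq with hi | rfl
        · exact Or.inr (Or.inr ⟨i, hi, rfl⟩)
        · exact Or.inl rfl
  rw [hsL] at hL
  rw [hsR] at hR
  exact ⟨hinj, ⟨c, hL.1, hR.1⟩, hL.2⟩

end Augmentation

/-! ### A language of loop programs with polynomial running time -/

namespace OracleRAM

/-- Programs in which the only loops are counting loops: `loop d K p` runs `p` for `K * n` times,
where `n` is the input size, with the number of the current iteration in the entry `[0][d]` of
array `3` of natural numbers. -/
inductive Cmd where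
  | skip
  | setNat (A : ℕ) (i j a : NatExpr)
  | setReal (A : ℕ) (i j : NatExpr) (a : RealExpr)
  | seq (p q : Cmd)
  | ite (b : Test) (p q : Cmd)
  | loop (d K : ℕ) (p : Cmd)

/-- An entry of row `0` of an array, with a constant index. -/
abbrev cell (A j : ℕ) : NatExpr := .read A (.const 0) (.const j)

/-- The counter of the loop `d`. -/
abbrev ctr (d : ℕ) : NatExpr := cell 3 d

/-- The expression `K * n`. -/
def sizeExpr : ℕ → NatExpr
  | 0 => .const 0
  | K + 1 => .add (sizeExpr K) (cell 0 0)

theorem sizeExpr_eval (s : Store) (K : ℕ) : (sizeExpr K).eval s = K * s.nat 0 0 0 := by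
  induction K with
  | zero => simp [sizeExpr, NatExpr.eval]
  | succ K ih => simp [sizeExpr, NatExpr.eval, ih]; ring

namespace Cmd

/-- The test of the while-loop implementing `loop d K`. -/
def loopTest (d K : ℕ) : Test := .not (.natLe (sizeExpr K) (ctr d))

/-- The assignment that increments the counter of the loop `d`. -/
def incr (d : ℕ) : Program := .setNat 3 (.const 0) (.const d) (.add (ctr d) (.const 1))

/-- The machine program of a loop program. -/
def compile : Cmd → Program
  | skip => .skip
  | setNat A i j a => .setNat A i j a
  | setReal A i j a => .setReal A i j a
  | seq p q => .seq p.compile q.compile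
  | ite b p q => .ite b p.compile q.compile
  | loop d K p => .seq (.setNat 3 (.const 0) (.const d) (.const 0))
      (.while (loopTest d K) (.seq p.compile (incr d)))

open Classical in
/-- The effect of a loop program on the memory. -/
noncomputable def den {n : ℕ} (O : Oracles n) : Cmd → Store → Store
  | skip, s => s
  | setNat A i j a, s => s.writeNat A (i.eval s) (j.eval s) (a.eval s)
  | setReal A i j a, s => s.writeReal A (i.eval s) (j.eval s) (a.eval s)
  | seq p q, s => q.den O (p.den O s)
  | ite b p q, s => if b.holds O s then p.den O s else q.den O s
  | loop d K p, s =>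
      Nat.rec (s.writeNat 3 0 d 0)
        (fun i s' => (p.den O s').writeNat 3 0 d (i + 1)) (K * s.nat 0 0 0)

/-- The array `A` of natural numbers may be changed. -/
def writesNat (A : ℕ) : Cmd → Bool
  | skip => false
  | setNat A' _ _ _ => A' == A
  | setReal _ _ _ _ => false
  | seq p q => p.writesNat A || q.writesNat A
  | ite _ p q => p.writesNat A || q.writesNat A
  | loop _ _ p => A == 3 || p.writesNat A

/-- The array `A` of real numbers may be changed. -/
def writesReal (A : ℕ) : Cmd → Bool
  | skip => false
  | setNat _ _ _ _ => false
  | setReal A' _ _ _ => A' == A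
  | seq p q => p.writesReal A || q.writesReal A
  | ite _ p q => p.writesReal A || q.writesReal A
  | loop _ _ p => p.writesReal A

/-- The counter of the loop `d` may be changed. -/
def usesCtr (d : ℕ) : Cmd → Bool
  | skip => false
  | setNat A _ _ _ => A == 3
  | setReal _ _ _ _ => false
  | seq p q => p.usesCtr d || q.usesCtr d
  | ite _ p q => p.usesCtr d || q.usesCtr d
  | loop d' _ p => d == d' || p.usesCtr d

/-- Loop bodies change neither the counter of their loop nor the array with the input size. -/
def wf : Cmd → Bool
  | skip => true
  | setNat _ _ _ _ => true
  | setReal _ _ _ _ => true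
  | seq p q => p.wf && q.wf
  | ite _ p q => p.wf && q.wf
  | loop d _ p => !p.usesCtr d && !p.writesNat 0 && p.wf

/-- A bound for the running time, as a polynomial in the input size. -/
noncomputable def timeBound : Cmd → Polynomial ℕ
  | skip => 1
  | setNat _ i j a => Polynomial.C (i.cost + j.cost + a.cost + 1)
  | setReal _ i j a => Polynomial.C (i.cost + j.cost + a.cost + 1)
  | seq p q => p.timeBound + q.timeBound
  | ite b p q => Polynomial.C (b.cost + 1) + p.timeBound + q.timeBound
  | loop d K p => Polynomial.C (4 + (loopTest d K).cost + 1) + Polynomial.C K * Polynomial.X *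
      (Polynomial.C ((loopTest d K).cost + 9) + p.timeBound)

variable {n : ℕ} (O : Oracles n)

theorem den_nat_of_not_writesNat {A : ℕ} (p : Cmd) (h : p.writesNat A = false) (s : Store) :
    (p.den O s).nat A = s.nat A := by
  induction p generalizing s with
  | skip => rfl
  | setNat A' i j a =>
    have : A ≠ A' := by
      rintro rfl
      simp [writesNat] at h
    funext i' j'
    simp [den, Store.writeNat, this]
  | setReal => rfl
  | seq p q ihp ihq =>
    simp only [writesNat, Bool.or_eq_false_iff] at h
    rw [den, ihq h.2, ihp h.1]
  | ite b p q ihp ihq =>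
    simp only [writesNat, Bool.or_eq_false_iff] at h
    rw [den]
    split_ifs
    · exact ihp h.1 s
    · exact ihq h.2 s
  | loop d K p ih =>
    simp only [writesNat, Bool.or_eq_false_iff, beq_eq_false_iff_ne] at h
    have hw : ∀ (s : Store) (x : ℕ), (s.writeNat 3 0 d x).nat A = s.nat A := by
      intro s x
      funext i j
      simp [Store.writeNat, h.1]
    rw [den]
    generalize K * s.nat 0 0 0 = m
    induction m with
    | zero => exact hw _ _
    | succ m ihm => simp only [hw, ih h.2, ihm]

theorem den_real_of_not_writesReal {A : ℕ} (p : Cmd) (h : p.writesReal A = false) (s : Store) :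
    (p.den O s).real A = s.real A := by
  induction p generalizing s with
  | skip => rfl
  | setReal A' i j a =>
    have : A ≠ A' := by
      rintro rfl
      simp [writesReal] at h
    funext i' j'
    simp [den, Store.writeReal, this]
  | setNat => rfl
  | seq p q ihp ihq =>
    simp only [writesReal, Bool.or_eq_false_iff] at h
    rw [den, ihq h.2, ihp h.1]
  | ite b p q ihp ihq =>
    simp only [writesReal, Bool.or_eq_false_iff] at h
    rw [den]
    split_ifs
    · exact ihp h.1 s
    · exact ihq h.2 s
  | loop d K p ih =>
    rw [den]
    generalize K * s.nat 0 0 0 = m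
    induction m with
    | zero => rfl
    | succ m ihm =>
      refine Eq.trans ?_ ihm
      exact ih h _

theorem den_ctr_of_not_usesCtr {d : ℕ} (p : Cmd) (h : p.usesCtr d = false) (s : Store) :
    (p.den O s).nat 3 0 d = s.nat 3 0 d := by
  induction p generalizing s with
  | skip => rfl
  | setReal => rfl
  | setNat A' i j a =>
    have : 3 ≠ A' := by
      rintro rfl
      simp [usesCtr] at h
    simp [den, Store.writeNat, this]
  | seq p q ihp ihq =>
    simp only [usesCtr, Bool.or_eq_false_iff] at h
    rw [den, ihq h.2, ihp h.1]
  | ite b p q ihp ihq =>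
    simp only [usesCtr, Bool.or_eq_false_iff] at h
    rw [den]
    split_ifs
    · exact ihp h.1 s
    · exact ihq h.2 s
  | loop d' K p ih =>
    simp only [usesCtr, Bool.or_eq_false_iff, beq_eq_false_iff_ne] at h
    have hw : ∀ (s : Store) (x : ℕ), (s.writeNat 3 0 d' x).nat 3 0 d = s.nat 3 0 d := by
      intro s x
      simp [Store.writeNat, h.1]
    rw [den]
    generalize K * s.nat 0 0 0 = m
    induction m with
    | zero => exact hw _ _
    | succ m ihm =>
      refine (hw _ _).trans ((ih h.2 _).trans ?_)
      exact ihm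

/-- Induction along a counting loop. -/
theorem den_loop {d K : ℕ} {p : Cmd} (h0 : p.writesNat 0 = false) {s : Store}
    (P : ℕ → Store → Prop) (hinit : P 0 (s.writeNat 3 0 d 0))
    (hstep : ∀ i s', i < K * s.nat 0 0 0 → P i s' → s'.nat 3 0 d = i →
      s'.nat 0 0 0 = s.nat 0 0 0 → P (i + 1) ((p.den O s').writeNat 3 0 d (i + 1))) :
    P (K * s.nat 0 0 0) ((loop d K p).den O s) := by
  have h0' : ∀ (s : Store) (x : ℕ), (s.writeNat 3 0 d x).nat 0 = s.nat 0 := by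
    intro s x
    funext i j
    simp [Store.writeNat]
  rw [den]
  have key : ∀ m ≤ K * s.nat 0 0 0, ∀ s', s' = (Nat.rec (s.writeNat 3 0 d 0)
      (fun i s' => (p.den O s').writeNat 3 0 d (i + 1)) m : Store) →
      P m s' ∧ s'.nat 3 0 d = m ∧ s'.nat 0 0 0 = s.nat 0 0 0 := by
    intro m
    induction m with
    | zero =>
      rintro - s' rfl
      exact ⟨hinit, by simp [Store.writeNat], congrFun (congrFun (h0' _ _) 0) 0⟩
    | succ m ih =>
      rintro hm s' rfl
      obtain ⟨h1, h2, h3⟩ := ih (by omega) _ rfl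
      refine ⟨hstep m _ (by omega) h1 h2 h3, by simp [Store.writeNat], ?_⟩
      simp only [h0', den_nat_of_not_writesNat O p h0, h3]
  exact (key _ le_rfl _ rfl).1

/-- Loop programs are executed by their machine programs in polynomial time. -/
theorem exec_compile (p : Cmd) (hwf : p.wf = true) (h0 : p.writesNat 0 = false) (s : Store) :
    ∃ t ≤ p.timeBound.eval (s.nat 0 0 0), Exec O p.compile s (p.den O s) t := by
  induction p generalizing s with
  | skip => exact ⟨1, by simp [timeBound], .skip s⟩
  | setNat A i j a => exact ⟨_, by simp [timeBound], .setNat A i j a s⟩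
  | setReal A i j a => exact ⟨_, by simp [timeBound], .setReal A i j a s⟩
  | seq p q ihp ihq =>
    simp only [writesNat, Bool.or_eq_false_iff] at h0
    simp only [wf, Bool.and_eq_true] at hwf
    obtain ⟨t1, h1, e1⟩ := ihp hwf.1 h0.1 s
    obtain ⟨t2, h2, e2⟩ := ihq hwf.2 h0.2 (p.den O s)
    rw [den_nat_of_not_writesNat O p h0.1] at h2
    exact ⟨t1 + t2, by simp only [timeBound, Polynomial.eval_add]; omega, .seq e1 e2⟩
  | ite b p q ihp ihq =>
    simp only [writesNat, Bool.or_eq_false_iff] at h0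
    simp only [wf, Bool.and_eq_true] at hwf
    by_cases hb : b.holds O s
    · obtain ⟨t, h, e⟩ := ihp hwf.1 h0.1 s
      refine ⟨_, ?_, by rw [den, if_pos hb]; exact .iteTrue hb e⟩
      simp only [timeBound, Polynomial.eval_add, Polynomial.eval_C]
      omega
    · obtain ⟨t, h, e⟩ := ihq hwf.2 h0.2 s
      refine ⟨_, ?_, by rw [den, if_neg hb]; exact .iteFalse hb e⟩
      simp only [timeBound, Polynomial.eval_add, Polynomial.eval_C]
      omega
  | loop d K p ih =>
    simp only [writesNat, Bool.or_eq_false_iff] at h0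
    simp only [wf, Bool.and_eq_true, Bool.not_eq_true'] at hwf
    obtain ⟨⟨hd, -⟩, hwf⟩ := hwf
    set N := K * s.nat 0 0 0 with hN
    set c := (loopTest d K).cost with hc
    set τ := p.timeBound.eval (s.nat 0 0 0) with hτ
    set F : ℕ → Store := fun m => (Nat.rec (s.writeNat 3 0 d 0)
      (fun i s' => (p.den O s').writeNat 3 0 d (i + 1)) m : Store) with hF
    have hn : ∀ m, (F m).nat 0 0 0 = s.nat 0 0 0 := by
      intro m
      induction m with
      | zero => simp [hF, Store.writeNat]
      | succ m ihm =>
        rw [← ihm, ← den_nat_of_not_writesNat O p h0.2 (F m)]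
        simp [hF, Store.writeNat]
    have hctr : ∀ m, (F m).nat 3 0 d = m := by
      intro m
      cases m <;> simp [hF, Store.writeNat]
    have htest : ∀ m, (loopTest d K).holds O (F m) ↔ m < N := by
      intro m
      simp [loopTest, Test.holds, sizeExpr_eval, hn, NatExpr.eval, hctr, ← hN]
    have hwhile : ∀ k ≤ N, ∃ t ≤ k * (c + 9 + τ) + c + 1,
        Exec O (.while (loopTest d K) (.seq p.compile (incr d))) (F (N - k)) (F N) t := by
      intro k
      induction k with
      | zero =>
        intro _
        exact ⟨c + 1, by omega, .whileFalse (by rw [htest]; omega)⟩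
      | succ k ihk =>
        intro hk
        obtain ⟨t, ht, e⟩ := ihk (by omega)
        obtain ⟨t', ht', e'⟩ := ih hwf h0.2 (F (N - (k + 1)))
        rw [hn] at ht'
        have hinc : Exec O (incr d) (p.den O (F (N - (k + 1)))) (F (N - k)) 8 := by
          have h1 := Exec.setNat (O := O) 3 (.const 0) (.const d) (.add (ctr d) (.const 1))
            (p.den O (F (N - (k + 1))))
          have h2 : N - k = N - (k + 1) + 1 := by omega
          have h3 : F (N - k) = (p.den O (F (N - (k + 1)))).writeNat 3 0 d (N - (k + 1) + 1) := by
            rw [h2]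
          rw [h3]
          have h4 : (p.den O (F (N - (k + 1)))).nat 3 0 d = N - (k + 1) := by
            rw [den_ctr_of_not_usesCtr O p hd, hctr]
          simp only [NatExpr.eval, h4] at h1
          exact h1
        refine ⟨_, ?_, .whileTrue (by rw [htest]; omega) (.seq e' hinc) e⟩
        rw [← hc, add_mul, one_mul]
        omega
    obtain ⟨t, ht, e⟩ := hwhile N le_rfl
    rw [Nat.sub_self] at e
    refine ⟨4 + t, ?_, .seq (.setNat 3 (.const 0) (.const d) (.const 0) s) e⟩
    simp only [timeBound, Polynomial.eval_add, Polynomial.eval_C, Polynomial.eval_mul,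
      Polynomial.eval_X]
    rw [← hN, ← hτ, ← hc]
    have : N * (c + 9 + τ) = N * (c + 9) + N * τ := by ring
    omega

end Cmd

end OracleRAM

/-! ### Orienting the edges of a forest -/

section EdgeList

variable {V : Type*}

/-- `s(a e, b e)` for `e < m` lists every edge of `G` exactly once. -/
structure IsEdgeList (G : SimpleGraph V) (m : ℕ) (a b : ℕ → V) : Prop where
  adj : ∀ e < m, G.Adj (a e) (b e)
  inj : ∀ e < m, ∀ e' < m, s(a e, b e) = s(a e', b e') → e = e'
  surj : ∀ u v, G.Adj u v → ∃ e < m, s(u, v) = s(a e, b e)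

variable {G : SimpleGraph V} {m : ℕ} {a b : ℕ → V}

/-- If every component of a forest contains at most one vertex of `B`, then distinct endpoints
outside `B` can be assigned to its edges: orient every component away from its vertex in `B`. -/
theorem IsEdgeList.exists_orientation (h : IsEdgeList G m a b) (hG : G.IsAcyclic) (A : Finset ℕ)
    (hA : ∀ e ∈ A, e < m) (B : Set V)
    (hB : ∀ u ∈ B, ∀ v ∈ B,
      (SimpleGraph.fromEdgeSet ((fun e => s(a e, b e)) '' (A : Set ℕ))).Reachable u v → u = v) :
    ∃ g : ℕ → V, Set.InjOn g A ∧ ∀ e ∈ A, (g e = a e ∨ g e = b e) ∧ g e ∉ B := by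
  classical
  induction A using Finset.induction_on generalizing B with
  | empty => exact ⟨a, by simp, by simp⟩
  | insert e A he ih =>
    set H := SimpleGraph.fromEdgeSet ((fun e => s(a e, b e)) '' (A : Set ℕ)) with hH
    set H' := SimpleGraph.fromEdgeSet ((fun e => s(a e, b e)) '' (↑(insert e A) : Set ℕ)) with hH'
    have hem : e < m := hA e (Finset.mem_insert_self _ _)
    have hHH' : H ≤ H' := SimpleGraph.fromEdgeSet_mono (Set.image_mono (by simp))
    have hab : H'.Adj (a e) (b e) := by
      rw [hH', SimpleGraph.fromEdgeSet_adj]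
      exact ⟨⟨e, by simp, rfl⟩, (h.adj e hem).ne⟩
    have hnot : ¬ H.Reachable (a e) (b e) := by
      have hbr := SimpleGraph.isAcyclic_iff_forall_adj_isBridge.1 hG (h.adj e hem)
      intro hr
      refine hbr (hr.mono fun u v huv => ?_)
      rw [hH, SimpleGraph.fromEdgeSet_adj] at huv
      obtain ⟨⟨e', he', heq⟩, -⟩ := huv
      have he'm : e' < m := hA e' (Finset.mem_insert_of_mem he')
      rw [SimpleGraph.deleteEdges_adj]
      refine ⟨?_, fun hm => ?_⟩
      · rw [← SimpleGraph.mem_edgeSet, ← heq]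
        exact h.adj e' he'm
      · rw [Set.mem_singleton_iff, ← heq] at hm
        exact he (h.inj e' he'm e hem hm ▸ he')
    -- one of the two components joined by the edge `e` avoids `B`
    have key : ∀ t, (t = a e ∨ t = b e) → (∀ v ∈ B, ¬ H.Reachable t v) →
        ∃ g : ℕ → V, Set.InjOn g ↑(insert e A) ∧
          ∀ e' ∈ insert e A, (g e' = a e' ∨ g e' = b e') ∧ g e' ∉ B := by
      intro t ht htB
      obtain ⟨g, hg1, hg2⟩ := ih (fun e' he' => hA e' (Finset.mem_insert_of_mem he'))
        (insert t B) (by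
          rintro u (rfl | hu) v (rfl | hv) huv
          · rfl
          · exact absurd huv (htB v hv)
          · exact absurd huv.symm (htB u hu)
          · exact hB u hu v hv (huv.mono hHH'))
      have hne : ∀ e' ∈ A, e' ≠ e := fun e' he' heq => he (heq ▸ he')
      refine ⟨fun e' => if e' = e then t else g e', ?_, ?_⟩
      · rintro x hx y hy hxy
        rcases Finset.mem_insert.1 hx with hx | hx <;>
          rcases Finset.mem_insert.1 hy with hy | hy
        · rw [hx, hy]
        · simp only [hx, if_true, hne y hy, if_false] at hxy
          exact absurd (Or.inl hxy.symm) (hg2 y hy).2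
        · simp only [hy, if_true, hne x hx, if_false] at hxy
          exact absurd (Or.inl hxy) (hg2 x hx).2
        · simp only [hne x hx, hne y hy, if_false] at hxy
          exact hg1 hx hy hxy
      · intro e' he'
        rcases Finset.mem_insert.1 he' with rfl | he'
        · simp only [if_true]
          exact ⟨ht, fun hm => htB t hm (SimpleGraph.Reachable.refl t)⟩
        · simp only [hne e' he', if_false]
          exact ⟨(hg2 e' he').1, fun hm => (hg2 e' he').2 (Or.inr hm)⟩
    by_cases hu : ∀ v ∈ B, ¬ H.Reachable (a e) v
    · exact key _ (Or.inl rfl) hu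
    by_cases hv : ∀ v ∈ B, ¬ H.Reachable (b e) v
    · exact key _ (Or.inr rfl) hv
    push Not at hu hv
    obtain ⟨u, huB, hu⟩ := hu
    obtain ⟨v, hvB, hv⟩ := hv
    have := hB u huB v hvB ((hu.symm.mono hHH').trans (hab.reachable.trans (hv.mono hHH')))
    exact absurd (hu.trans (this ▸ hv.symm)) hnot

/-- The converse of `IsEdgeList.exists_orientation`, one edge at a time: if every class of the
labelling `lab` contains at most one vertex outside `X`, this remains true when the classes of `u`
and `v` are merged and one of `u`, `v` is added to `X`. -/
theorem eq_of_merge_label {lab lab' : V → ℕ} {X : Set V} {u v t : V}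
    (h : ∀ p q, p ∉ X → q ∉ X → lab p = lab q → p = q) (ht : t ∉ X) (htuv : t = u ∨ t = v)
    (hlab : ∀ p, lab' p = if lab p = lab v then lab u else lab p) (p q : V)
    (hp : p ∉ insert t X) (hq : q ∉ insert t X) (hpq : lab' p = lab' q) : p = q := by
  simp only [Set.mem_insert_iff, not_or] at hp hq
  have hp1 : lab p ≠ lab t := fun he => hp.1 (h p t hp.2 ht he)
  have hq1 : lab q ≠ lab t := fun he => hq.1 (h q t hq.2 ht he)
  apply h p q hp.2 hq.2
  rw [hlab, hlab] at hpq
  rcases htuv with rfl | rfl <;> split_ifs at hpq <;> grind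

/-- The number of edges of a tree is smaller than the number of its vertices. -/
theorem IsEdgeList.lt_card [Fintype V] (h : IsEdgeList G m a b) (hG : G.IsTree) :
    m < Fintype.card V := by
  classical
  have h1 := hG.card_edgeFinset
  have h2 : m ≤ G.edgeFinset.card := by
    have := Finset.card_le_card_of_injOn (s := Finset.range m) (t := G.edgeFinset)
      (fun e => s(a e, b e))
      (fun e he => by simpa using h.adj e (by simpa using he))
      (fun e he e' he' heq => h.inj e (by simpa using he) e' (by simpa using he') heq)
    simpa using this
  omega

/-! ### The cost of a partition -/

/-- Every edge between two parts is counted twice, every other edge is not counted. -/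
theorem IsEdgeList.sum_cutWeight [Fintype V] (h : IsEdgeList G m a b) (w : Sym2 V → ℝ) {k : ℕ}
    (P : Fin k → Set V) (π : V → Fin k) (hπ : ∀ v i, v ∈ P i ↔ π v = i) :
    ∑ i, cutWeight G w (P i) =
      ∑ e ∈ Finset.range m, if π (a e) = π (b e) then 0 else 2 * w s(a e, b e) := by
  classical
  have h1 : ∀ i, cutWeight G w (P i) = ∑ e ∈ Finset.range m,
      if (π (a e) = i ↔ π (b e) = i) then 0 else w s(a e, b e) := by
    intro i
    rw [cutWeight, ← Finset.sum_filter_ne_zero, ← Finset.sum_filter_ne_zero (s := Finset.range m)]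
    have hmem : ∀ e, G.Adj (a e) (b e) →
        (s(a e, b e) ∈ cutEdges G (P i) ↔ ¬ (π (a e) = i ↔ π (b e) = i)) := by
      intro e hadj
      simp only [cutEdges, Set.mem_ofPred_eq, SimpleGraph.mem_edgeSet, hadj, true_and]
      constructor
      · rintro ⟨u, v, hu, hv, heq⟩
        rw [hπ] at hu hv
        rcases Sym2.eq_iff.1 heq with ⟨h1, h2⟩ | ⟨h1, h2⟩
        · rw [h1, h2]; tauto
        · rw [h1, h2]; tauto
      · intro hn
        by_cases ha : π (a e) = i
        · exact ⟨a e, b e, (hπ _ _).2 ha, fun hb => hn (iff_of_true ha ((hπ _ _).1 hb)), rfl⟩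
        · refine ⟨b e, a e, (hπ _ _).2 ?_, fun hb => ha ((hπ _ _).1 hb), Sym2.eq_swap⟩
          by_contra hb
          exact hn (iff_of_false ha hb)
    symm
    refine Finset.sum_bij (fun e _ => s(a e, b e)) ?_ ?_ ?_ ?_
    · intro e he
      simp only [Finset.mem_filter, Finset.mem_range, ne_eq, ite_eq_left_iff, not_forall,
        Finset.mem_univ, true_and] at he ⊢
      obtain ⟨hem, hn, hw⟩ := he
      exact ⟨(hmem e (h.adj e hem)).2 hn, hw⟩
    · intro e he e' he' heq
      simp only [Finset.mem_filter, Finset.mem_range] at he he'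
      exact h.inj e he.1 e' he'.1 heq
    · intro z hz
      simp only [Finset.mem_filter, Finset.mem_univ, true_and] at hz
      induction z with
      | _ u v =>
        obtain ⟨e, he, heq⟩ := h.surj u v hz.1.1
        have h2 : ¬ (π (a e) = i ↔ π (b e) = i) := (hmem e (h.adj e he)).1 (heq ▸ hz.1)
        refine ⟨e, ?_, heq.symm⟩
        simp only [Finset.mem_filter, Finset.mem_range, h2, if_false]
        exact ⟨he, heq ▸ hz.2⟩
    · intro e he
      simp only [Finset.mem_filter, Finset.mem_range, ne_eq, ite_eq_left_iff, not_forall] at he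
      rw [if_neg he.2.1]
  rw [Finset.sum_congr rfl fun i _ => h1 i, Finset.sum_comm]
  refine Finset.sum_congr rfl fun e _ => ?_
  split_ifs with heq
  · exact Finset.sum_eq_zero fun i _ => by simp [heq]
  · have h2 : ∀ i, (if (π (a e) = i ↔ π (b e) = i) then 0 else w s(a e, b e)) =
        (if π (a e) = i then w s(a e, b e) else 0) + if π (b e) = i then w s(a e, b e) else 0 := by
      intro i
      by_cases h3 : π (a e) = i <;> by_cases h4 : π (b e) = i <;> simp [h3, h4]
      exact absurd (h3.trans h4.symm) heq
    rw [Finset.sum_congr rfl fun i _ => h2 i, Finset.sum_add_distrib]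
    simp [two_mul]

end EdgeList

/-! ### The matroid intersection instance -/

section Instance

variable {n : ℕ}

/-- The elements `x ∈ I` take pairwise different slots `f x`, and the vertices `v < n` among these
slots form a coindependent set of `M`. -/
def SlotIndep (M : Matroid (Fin n)) (N : ℕ) (f : ℕ → ℕ) (I : Set ℕ) : Prop :=
  (∀ x ∈ I, x < N) ∧ Set.InjOn f I ∧ M.Coindep {v | (v : ℕ) ∈ f '' I}

/-- The sets satisfying `SlotIndep` are the independent sets of a matroid: the direct sum of the
dual of `M` and a free matroid, pulled back along `f`. -/
theorem exists_slotMatroid (M : Matroid (Fin n)) (N : ℕ) (f : ℕ → ℕ) :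
    ∃ L : Matroid ℕ, L.E = Set.Iio N ∧ ∀ I, L.Indep I ↔ SlotIndep M N f I := by
  classical
  set φ : ℕ → Fin n ⊕ ℕ := fun x => if h : f x < n then .inl ⟨f x, h⟩ else .inr (f x) with hφ
  have hφinl : ∀ x v, φ x = .inl v ↔ f x = v := by
    intro x v
    simp only [hφ]
    split_ifs with h
    · simp [Fin.ext_iff]
    · simp only [false_iff]
      have := v.2
      omega
  have hφinj : ∀ x y, φ x = φ y ↔ f x = f y := by
    intro x y
    simp only [hφ]
    split_ifs with h1 h2 h2
    · simp
    · simp only [false_iff]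
      omega
    · simp only [false_iff]
      omega
    · simp
  refine ⟨(M✶.sum (Matroid.freeOn Set.univ)).comapOn (Set.Iio N) φ, rfl, fun I => ?_⟩
  rw [Matroid.comapOn_indep_iff, Matroid.sum_indep_iff, SlotIndep]
  have h1 : Sum.inl ⁻¹' (φ '' I) = {v : Fin n | (v : ℕ) ∈ f '' I} := by
    ext v
    simp [hφinl]
  have h2 : Set.InjOn φ I ↔ Set.InjOn f I := by simp [Set.InjOn, hφinj]
  rw [h1, h2, Matroid.coindep_def]
  simp only [Matroid.freeOn_indep_iff, Set.subset_univ, and_true]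
  constructor
  · rintro ⟨h3, h4, h5⟩
    exact ⟨fun x hx => h5 hx, h4, h3⟩
  · rintro ⟨h3, h4, h5⟩
    exact ⟨h5, h4, fun x hx => h3 x hx⟩

/-- The slot of the element `x = 5 e + r`: an endpoint of the edge `e` if `r = p` or `r = p + 1`,
and the slot `n + e` of the edge itself otherwise. -/
def elemSlot (a b : ℕ → Fin n) (p x : ℕ) : ℕ :=
  if x % 5 = p then a (x / 5) else if x % 5 = p + 1 then b (x / 5) else n + x / 5

/-- The edge `e` is kept: in both matroids an endpoint is assigned to it. -/
def IsKept (I : Set ℕ) (e : ℕ) : Prop :=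
  (5 * e ∈ I ∨ 5 * e + 1 ∈ I) ∧ (5 * e + 2 ∈ I ∨ 5 * e + 3 ∈ I)

variable {G : SimpleGraph (Fin n)} {m : ℕ} {a b : ℕ → Fin n}

theorem sum_eq_sum_range_five (I : Finset ℕ) (hI : ∀ x ∈ I, x < 5 * m) (F : ℕ → ℝ) :
    ∑ x ∈ I, F (x / 5) = ∑ e ∈ Finset.range m, ∑ r ∈ Finset.range 5,
      if 5 * e + r ∈ I then F e else 0 := by
  have h1 : ∑ x ∈ I, F (x / 5) = ∑ x ∈ Finset.range (5 * m), if x ∈ I then F (x / 5) else 0 := by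
    rw [← Finset.sum_filter]
    congr 1
    ext x
    simpa using hI x
  rw [h1]
  clear h1 hI
  induction m with
  | zero => simp
  | succ m ih =>
    rw [Finset.sum_range_succ, ← ih, show 5 * (m + 1) = 5 * m + 5 by ring, Finset.sum_range_add]
    congr 1
    refine Finset.sum_congr rfl fun r hr => ?_
    have := Finset.mem_range.1 hr
    rw [show (5 * m + r) / 5 = m by omega]

/-- If distinct endpoints outside a basis are assigned to the edges in `J`, a set of elements that
contains at most the elements of these assignments, and at most one other element per edge,
satisfies `SlotIndep`. -/
theorem slotIndep_of_orientation {M : Matroid (Fin n)} {p : ℕ} (hME : M.E = Set.univ)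
    {B : Set (Fin n)} (hB : M.IsBase B) {J : Set ℕ}
    {g : ℕ → Fin n} (hg : Set.InjOn g J) (hgB : ∀ e ∈ J, (g e = a e ∨ g e = b e) ∧ g e ∉ B)
    {K : Set ℕ} (hKm : ∀ x ∈ K, x < 5 * m)
    (hK : ∀ x ∈ K, (x / 5 ∈ J ∧ (x % 5 = p ∧ g (x / 5) = a (x / 5) ∨
      x % 5 = p + 1 ∧ g (x / 5) ≠ a (x / 5))) ∨ (x % 5 ≠ p ∧ x % 5 ≠ p + 1))
    (hu : ∀ x ∈ K, ∀ y ∈ K, x % 5 ≠ p → x % 5 ≠ p + 1 → y % 5 ≠ p → y % 5 ≠ p + 1 →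
      x / 5 = y / 5 → x = y) : SlotIndep M (5 * m) (elemSlot a b p) K := by
  have hslot : ∀ x ∈ K, (x / 5 ∈ J ∧ elemSlot a b p x = g (x / 5) ∧
      (x % 5 = p ∧ g (x / 5) = a (x / 5) ∨ x % 5 = p + 1 ∧ g (x / 5) ≠ a (x / 5))) ∨
      (elemSlot a b p x = n + x / 5 ∧ x % 5 ≠ p ∧ x % 5 ≠ p + 1) := by
    intro x hx
    rcases hK x hx with ⟨hJ, ⟨h1, h2⟩ | ⟨h1, h2⟩⟩ | ⟨h1, h2⟩
    · exact Or.inl ⟨hJ, by simp [elemSlot, h1, h2], Or.inl ⟨h1, h2⟩⟩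
    · have := ((hgB _ hJ).1).resolve_left h2
      exact Or.inl ⟨hJ, by simp [elemSlot, h1, this], Or.inr ⟨h1, h2⟩⟩
    · exact Or.inr ⟨by simp [elemSlot, h1, h2], h1, h2⟩
  refine ⟨hKm, ?_, ?_⟩
  · intro x hx y hy hxy
    rcases hslot x hx with ⟨hJ, h1, h2⟩ | ⟨h1, h2, h2'⟩ <;>
      rcases hslot y hy with ⟨hJ', h3, h4⟩ | ⟨h3, h4, h4'⟩
    · have heq := hg hJ hJ' (Fin.ext (by rw [← h1, ← h3, hxy]))
      rw [heq] at h2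
      have : x % 5 = y % 5 := by
        rcases h2 with ⟨h5, h6⟩ | ⟨h5, h6⟩ <;> rcases h4 with ⟨h7, h8⟩ | ⟨h7, h8⟩
        · omega
        · exact absurd h6 h8
        · exact absurd h8 h6
        · omega
      omega
    · have := (g (x / 5)).2
      omega
    · have := (g (y / 5)).2
      omega
    · exact hu x hx y hy h2 h2' h4 h4' (by omega)
  · rw [Matroid.coindep_iff_exists (by rw [hME]; exact Set.subset_univ _)]
    refine ⟨B, hB, fun v hvB => ⟨hME ▸ Set.mem_univ v, ?_⟩⟩
    rintro ⟨x, hx, hxv⟩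
    rcases hslot x hx with ⟨hJ, h1, -⟩ | ⟨h1, -, -⟩
    · have : g (x / 5) = v := Fin.ext (by rw [← h1, hxv])
      exact (hgB _ hJ).2 (this ▸ hvB)
    · have := v.2
      omega

/-- Every feasible partition gives a common independent set whose weight determines the cost of the
partition. -/
theorem IsEdgeList.exists_common_of_feasible (h : IsEdgeList G m a b) (hG : G.IsAcyclic)
    (w : Sym2 (Fin n) → ℝ) {M : Fin 2 → Matroid (Fin n)} (hM : ∀ j, (M j).E = Set.univ) {k : ℕ}
    {Q : Fin k → Set (Fin n)} (hQ : IsFeasiblePartition M Q) :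
    ∃ K : Finset ℕ, SlotIndep (M 0) (5 * m) (elemSlot a b 0) K ∧
      SlotIndep (M 1) (5 * m) (elemSlot a b 2) K ∧
      ∑ i, cutWeight G w (Q i) + 2 * ∑ x ∈ K, w s(a (x / 5), b (x / 5)) =
        4 * ∑ e ∈ Finset.range m, w s(a e, b e) := by
  classical
  obtain ⟨hpart, hbase⟩ := hQ
  choose π hπ hπ' using hpart
  have hπiff : ∀ v i, v ∈ Q i ↔ π v = i := fun v i =>
    ⟨fun hv => (hπ' v i hv).symm, fun hv => hv ▸ hπ v⟩
  set J := (Finset.range m).filter fun e => π (a e) = π (b e) with hJ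
  have hJm : ∀ e ∈ J, e < m := fun e he => by simpa using (Finset.mem_filter.1 he).1
  have hreach : ∀ u v, (SimpleGraph.fromEdgeSet
      ((fun e => s(a e, b e)) '' (J : Set ℕ))).Reachable u v → π u = π v := by
    rintro u v ⟨p⟩
    induction p with
    | nil => rfl
    | cons hadj _ ih =>
      rw [← ih]
      rw [SimpleGraph.fromEdgeSet_adj] at hadj
      obtain ⟨⟨e, he, heq⟩, -⟩ := hadj
      have he' := (Finset.mem_filter.1 he).2
      rcases Sym2.eq_iff.1 heq with ⟨h1, h2⟩ | ⟨h1, h2⟩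
      · rw [← h1, ← h2, he']
      · rw [← h1, ← h2, he']
  have hor : ∀ j, ∃ B, (M j).IsBase B ∧ ∃ g : ℕ → Fin n, Set.InjOn g J ∧
      ∀ e ∈ J, (g e = a e ∨ g e = b e) ∧ g e ∉ B := by
    intro j
    obtain ⟨B, hB, hB1⟩ := hbase j
    refine ⟨B, hB, h.exists_orientation hG J hJm B fun u hu v hv huv => ?_⟩
    obtain ⟨z, hz⟩ := Set.ncard_eq_one.1 (hB1 (π u))
    have h1 : u ∈ B ∩ Q (π u) := ⟨hu, (hπiff _ _).2 rfl⟩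
    have h2 : v ∈ B ∩ Q (π u) := ⟨hv, (hπiff _ _).2 (hreach u v huv).symm⟩
    rw [hz] at h1 h2
    exact h1.trans h2.symm
  obtain ⟨B0, hB0, g0, hg0, hg0'⟩ := hor 0
  obtain ⟨B1, hB1, g1, hg1, hg1'⟩ := hor 1
  -- an edge inside a part is represented by its two assignments, any other edge by its fifth element
  set K := (Finset.range (5 * m)).filter fun x =>
    if x / 5 ∈ J then (x % 5 = 0 ∧ g0 (x / 5) = a (x / 5)) ∨ (x % 5 = 1 ∧ g0 (x / 5) ≠ a (x / 5)) ∨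
      (x % 5 = 2 ∧ g1 (x / 5) = a (x / 5)) ∨ (x % 5 = 3 ∧ g1 (x / 5) ≠ a (x / 5)) else x % 5 = 4
    with hK
  have hKm : ∀ x ∈ K, x < 5 * m := fun x hx => by simpa using (Finset.mem_filter.1 hx).1
  have hmem : ∀ x ∈ K, (x / 5 ∈ J ∧
      ((x % 5 = 0 ∧ g0 (x / 5) = a (x / 5)) ∨ (x % 5 = 1 ∧ g0 (x / 5) ≠ a (x / 5)) ∨
      (x % 5 = 2 ∧ g1 (x / 5) = a (x / 5)) ∨ (x % 5 = 3 ∧ g1 (x / 5) ≠ a (x / 5)))) ∨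
      (x / 5 ∉ J ∧ x % 5 = 4) := by
    intro x hx
    have := (Finset.mem_filter.1 hx).2
    split_ifs at this with hxJ
    · exact Or.inl ⟨hxJ, this⟩
    · exact Or.inr ⟨hxJ, this⟩
  refine ⟨K, ?_, ?_, ?_⟩
  · refine slotIndep_of_orientation (hM 0) hB0 hg0 hg0' hKm ?_ ?_
    · intro x hx
      rcases hmem x hx with ⟨hxJ, h1 | h1 | h1 | h1⟩ | ⟨hxJ, h1⟩
      · exact Or.inl ⟨hxJ, Or.inl h1⟩
      · exact Or.inl ⟨hxJ, Or.inr h1⟩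
      all_goals exact Or.inr (by omega)
    · intro x hx y hy hx0 hx1 hy0 hy1 hxy
      have hx := hmem x hx
      have hy := hmem y hy
      rw [hxy] at hx
      have : x % 5 = y % 5 := by grind
      omega
  · refine slotIndep_of_orientation (hM 1) hB1 hg1 hg1' hKm ?_ ?_
    · intro x hx
      rcases hmem x hx with ⟨hxJ, h1 | h1 | h1 | h1⟩ | ⟨hxJ, h1⟩
      · exact Or.inr (by omega)
      · exact Or.inr (by omega)
      · exact Or.inl ⟨hxJ, Or.inl h1⟩
      · exact Or.inl ⟨hxJ, Or.inr h1⟩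
      · exact Or.inr (by omega)
    · intro x hx y hy hx0 hx1 hy0 hy1 hxy
      have hx := hmem x hx
      have hy := hmem y hy
      rw [hxy] at hx
      have : x % 5 = y % 5 := by grind
      omega
  · rw [h.sum_cutWeight w Q π hπiff, sum_eq_sum_range_five K hKm fun e => w s(a e, b e),
      Finset.mul_sum, Finset.mul_sum, ← Finset.sum_add_distrib]
    refine Finset.sum_congr rfl fun e he => ?_
    have hem := Finset.mem_range.1 he
    have hd : ∀ r < 5, (5 * e + r) / 5 = e ∧ (5 * e + r) % 5 = r := fun r hr => by omega
    have hKr : ∀ r < 5, (5 * e + r ∈ K ↔ if e ∈ J then (r = 0 ∧ g0 e = a e) ∨ (r = 1 ∧ g0 e ≠ a e) ∨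
        (r = 2 ∧ g1 e = a e) ∨ (r = 3 ∧ g1 e ≠ a e) else r = 4) := by
      intro r hr
      rw [hK, Finset.mem_filter, (hd r hr).1, (hd r hr).2, Finset.mem_range]
      exact and_iff_right (by omega)
    have hJe : e ∈ J ↔ π (a e) = π (b e) := by simp [hJ, hem]
    simp only [← hJe]
    simp only [Finset.sum_range_succ, Finset.range_zero, Finset.sum_empty,
      hKr 0 (by norm_num), hKr 1 (by norm_num), hKr 2 (by norm_num), hKr 3 (by norm_num),
      hKr 4 (by norm_num)]
    by_cases heJ : e ∈ J
    · by_cases h0 : g0 e = a e <;> by_cases h1 : g1 e = a e <;> simp [heJ, h0, h1] <;> ring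
    · simp [heJ]
      ring

/-- The contribution of one edge of weight `W` to `IsEdgeList.sum_cutWeight_le`: the five conditions
say which of its elements are chosen. At most two are, and two only if the fifth one is not, one for
each matroid. -/
theorem slot_count_le {W : ℝ} (hW : 0 ≤ W) {c0 c1 c2 c3 c4 s : Prop} [Decidable c0] [Decidable c1]
    [Decidable c2] [Decidable c3] [Decidable c4] [Decidable s] (n01 : c0 → ¬c1) (n04 : c0 → ¬c4)
    (n14 : c1 → ¬c4) (n23 : c2 → ¬c3) (n24 : c2 → ¬c4) (n34 : c3 → ¬c4)
    (hs : (c0 ∨ c1) ∧ (c2 ∨ c3) → s) :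
    (if s then 0 else 2 * W) + 2 * (0 + (if c0 then W else 0) + (if c1 then W else 0) +
      (if c2 then W else 0) + (if c3 then W else 0) + (if c4 then W else 0)) ≤ 4 * W := by
  have three : ∀ {x y z : Prop} [Decidable x] [Decidable y] [Decidable z], (x → ¬y) → (x → ¬z) →
      (y → ¬z) → (if x then W else 0) + (if y then W else 0) + (if z then W else 0) ≤ W := by
    intro x y z _ _ _ h1 h2 h3
    by_cases hx : x
    · simp [hx, h1 hx, h2 hx]
    · by_cases hy : y
      · simp [hx, hy, h3 hy]
      · by_cases hz : z <;> simp [hx, hy, hz, hW]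
  have h014 := three n01 n04 n14
  have h234 := three n23 n24 n34
  have h4 : 0 ≤ if c4 then W else 0 := by split_ifs <;> linarith
  by_cases h : s
  · rw [if_pos h]
    linarith
  · rw [if_neg h]
    rcases not_and_or.1 (mt hs h) with h' | h'
    · rw [not_or] at h'
      rw [if_neg h'.1, if_neg h'.2]
      linarith
    · rw [not_or] at h'
      rw [if_neg h'.1, if_neg h'.2]
      linarith

/-- A partition that respects the edges kept by a common independent set costs at most as much as
the weight of this set suggests. -/
theorem IsEdgeList.sum_cutWeight_le (h : IsEdgeList G m a b) (w : Sym2 (Fin n) → ℝ)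
    (hw : ∀ e ∈ G.edgeSet, 0 ≤ w e) {M : Fin 2 → Matroid (Fin n)} {I : Finset ℕ}
    (h0 : SlotIndep (M 0) (5 * m) (elemSlot a b 0) I)
    (h1 : SlotIndep (M 1) (5 * m) (elemSlot a b 2) I) {k : ℕ} (P : Fin k → Set (Fin n))
    (π : Fin n → Fin k) (hπ : ∀ v i, v ∈ P i ↔ π v = i)
    (hkept : ∀ e < m, IsKept I e → π (a e) = π (b e)) :
    ∑ i, cutWeight G w (P i) + 2 * ∑ x ∈ I, w s(a (x / 5), b (x / 5)) ≤
        4 * ∑ e ∈ Finset.range m, w s(a e, b e) := by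
  classical
  rw [h.sum_cutWeight w P π hπ, sum_eq_sum_range_five I h0.1 fun e => w s(a e, b e),
    Finset.mul_sum, Finset.mul_sum, ← Finset.sum_add_distrib]
  refine Finset.sum_le_sum fun e he => ?_
  have hem := Finset.mem_range.1 he
  have hwe : 0 ≤ w s(a e, b e) := hw _ (h.adj e hem)
  have hs0 : ∀ r < 5, r ≠ 0 → r ≠ 1 → elemSlot a b 0 (5 * e + r) = n + e := by
    intro r hr h2 h3
    have h4 : (5 * e + r) / 5 = e := by omega
    have h5 : (5 * e + r) % 5 = r := by omega
    simp [elemSlot, h4, h5, h2, h3]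
  have hs1 : ∀ r < 5, r ≠ 2 → r ≠ 3 → elemSlot a b 2 (5 * e + r) = n + e := by
    intro r hr h2 h3
    have h4 : (5 * e + r) / 5 = e := by omega
    have h5 : (5 * e + r) % 5 = r := by omega
    simp [elemSlot, h4, h5, h2, h3]
  have hne0 : ∀ r < 5, ∀ r' < 5, r ≠ 0 → r ≠ 1 → r' ≠ 0 → r' ≠ 1 → r ≠ r' → 5 * e + r ∈ I →
      5 * e + r' ∉ I := by
    intro r hr r' hr' h2 h3 h4 h5 hne hm hm'
    have := h0.2.1 hm hm' ((hs0 r hr h2 h3).trans (hs0 r' hr' h4 h5).symm)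
    omega
  have hne1 : ∀ r < 5, ∀ r' < 5, r ≠ 2 → r ≠ 3 → r' ≠ 2 → r' ≠ 3 → r ≠ r' → 5 * e + r ∈ I →
      5 * e + r' ∉ I := by
    intro r hr r' hr' h2 h3 h4 h5 hne hm hm'
    have := h1.2.1 hm hm' ((hs1 r hr h2 h3).trans (hs1 r' hr' h4 h5).symm)
    omega
  have n23 := hne0 2 (by norm_num) 3 (by norm_num) (by norm_num) (by norm_num) (by norm_num)
    (by norm_num) (by norm_num)
  have n24 := hne0 2 (by norm_num) 4 (by norm_num) (by norm_num) (by norm_num) (by norm_num)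
    (by norm_num) (by norm_num)
  have n34 := hne0 3 (by norm_num) 4 (by norm_num) (by norm_num) (by norm_num) (by norm_num)
    (by norm_num) (by norm_num)
  have n01 := hne1 0 (by norm_num) 1 (by norm_num) (by norm_num) (by norm_num) (by norm_num)
    (by norm_num) (by norm_num)
  have n04 := hne1 0 (by norm_num) 4 (by norm_num) (by norm_num) (by norm_num) (by norm_num)
    (by norm_num) (by norm_num)
  have n14 := hne1 1 (by norm_num) 4 (by norm_num) (by norm_num) (by norm_num) (by norm_num)
    (by norm_num) (by norm_num)
  have hk := hkept e hem
  simp only [IsKept, Finset.mem_coe] at hk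
  simp only [add_zero] at n01 n04
  simp only [Finset.sum_range_succ, Finset.range_zero, Finset.sum_empty, add_zero]
  exact slot_count_le hwe n01 n04 n14 n23 n24 n34 hk

theorem Matroid.IsBase.ncard_eq_of_eRank {M : Matroid (Fin n)} {B : Set (Fin n)}
    (hB : M.IsBase B) {k : ℕ} (hk : M.eRank = k) : B.ncard = k := by
  rw [Set.ncard_def, hB.encard_eq_eRank, hk]
  rfl

/-- If the `k` elements of `B` get different numbers between `1` and `k`, then every part of the
partition by these numbers contains exactly one element of `B`. -/
theorem ncard_inter_eq_one {V : Type*} [Finite V] {B : Set V} {k : ℕ} (hB : B.ncard = k) {β : V → ℕ}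
    (hβ : ∀ v ∈ B, 1 ≤ β v ∧ β v ≤ k) (hinj : Set.InjOn β B) (i : Fin k) :
    (B ∩ {v | β v - 1 = i}).ncard = 1 := by
  have himg : β '' B = Set.Icc 1 k := by
    refine Set.eq_of_subset_of_ncard_le ?_ ?_ (Set.finite_Icc 1 k)
    · rintro _ ⟨v, hv, rfl⟩
      exact hβ v hv
    · rw [hinj.ncard_image, hB, ← Finset.coe_Icc, Set.ncard_coe_finset]
      simp
  have hi : (i : ℕ) + 1 ∈ β '' B := by
    rw [himg]
    exact ⟨by omega, by omega⟩
  obtain ⟨v, hv, hvi⟩ := hi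
  rw [Set.ncard_eq_one]
  refine ⟨v, Set.ext fun u => ⟨fun hu => ?_, ?_⟩⟩
  · have h1 := hβ u hu.1
    have h2 : β u - 1 = i := hu.2
    exact hinj hu.1 hv (by omega)
  · rintro rfl
    exact ⟨hv, by simp [hvi]⟩

end Instance

/-! ### Building blocks of the machine program -/

/-!
Usage of the arrays of natural numbers: `0`, `1`, `2` input and output, `3` loop counters, `4` and
`5` numbers of elements and of edges, `6` and `7` slots of the elements for the two matroids, `8`
current common independent set, `9` to `12` independence test, `13` to `15` arcs, sources and sinks of
the exchange graph, `16` and `17` existence and predecessors of walks, `18` to `20` chosen walk, `21`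
best common independent set, `22` vertex labels, `25` and `26` assigned endpoints, `23` and `24`
bases, `34` numbers of the labels, `35` numbers in use. Arrays of real numbers: `0` input, `1` weights
of the elements, `2` lengths of walks, `3` length of the chosen walk, `4` and `5` weights of the best
and of the current set, `6` lengths of the vertices of the exchange graph.
-/

namespace OracleRAM

section WriteLemmas

variable (s : Store) (A A' i j i' j' x : ℕ) (r : ℝ)

@[simp] theorem writeNat_nat_of_ne (h : A' ≠ A) : (s.writeNat A i j x).nat A' = s.nat A' := by
  funext i' j'
  simp [Store.writeNat, h]

@[simp] theorem writeNat_nat_self :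
    (s.writeNat A i j x).nat A i' j' = if i' = i ∧ j' = j then x else s.nat A i' j' := by
  simp [Store.writeNat]

@[simp] theorem writeNat_real : (s.writeNat A i j x).real = s.real := rfl

@[simp] theorem writeReal_nat : (s.writeReal A i j r).nat = s.nat := rfl

@[simp] theorem writeReal_real_of_ne (h : A' ≠ A) : (s.writeReal A i j r).real A' = s.real A' := by
  funext i' j'
  simp [Store.writeReal, h]

open Classical in
@[simp] theorem writeReal_real_self :
    (s.writeReal A i j r).real A i' j' = if i' = i ∧ j' = j then r else s.real A i' j' := by
  simp [Store.writeReal]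

end WriteLemmas

/-- The entry `[0][j]` of an array of natural numbers. -/
abbrev at0 (A : ℕ) (j : NatExpr) : NatExpr := .read A (.const 0) j

/-- A scalar variable: the entry `[0][0]` of its own array. -/
abbrev var (A : ℕ) : NatExpr := cell A 0

/-- The test `a = 0`. -/
abbrev isZero (a : NatExpr) : Test := .natLe a (.const 0)

/-- The test `a ≠ 0`. -/
abbrev nonZero (a : NatExpr) : Test := .not (.natLe a (.const 0))

/-- The test `a < b`. -/
abbrev ltTest (a b : NatExpr) : Test := .not (.natLe b a)

namespace Cmd

/-- The assignment `A[0][j] := a`. -/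
abbrev set0 (A : ℕ) (j a : NatExpr) : Cmd := .setNat A (.const 0) j a

/-- The assignment to a scalar variable. -/
abbrev setVar (A : ℕ) (a : NatExpr) : Cmd := .setNat A (.const 0) (.const 0) a

/-- A branch without alternative. -/
abbrev when (b : Test) (p : Cmd) : Cmd := .ite b p .skip

scoped infixr:60 ";;" => Cmd.seq

variable {n : ℕ} (O : Oracles n)

@[simp] theorem den_skip (s : Store) : skip.den O s = s := rfl

@[simp] theorem den_seq (p q : Cmd) (s : Store) : (p ;; q).den O s = q.den O (p.den O s) := rfl

@[simp] theorem den_setNat (A : ℕ) (i j a : NatExpr) (s : Store) :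
    (setNat A i j a).den O s = s.writeNat A (i.eval s) (j.eval s) (a.eval s) := rfl

@[simp] theorem den_setReal (A : ℕ) (i j : NatExpr) (a : RealExpr) (s : Store) :
    (setReal A i j a).den O s = s.writeReal A (i.eval s) (j.eval s) (a.eval s) := rfl

theorem den_ite_pos {b : Test} {p q : Cmd} {s : Store} (h : b.holds O s) :
    (ite b p q).den O s = p.den O s := by rw [den, if_pos h]

theorem den_ite_neg {b : Test} {p q : Cmd} {s : Store} (h : ¬ b.holds O s) :
    (ite b p q).den O s = q.den O s := by rw [den, if_neg h]

end Cmd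

attribute [simp] NatExpr.eval RealExpr.eval Test.holds

namespace Cmd

variable {n : ℕ} {O : Oracles n}

/-- A loop whose `i`-th iteration sets the entry `[r][i]` of the array `A` to `val i`, and keeps
`Inv` and all other entries of the row. -/
theorem den_loop_fill {A d K r : ℕ} {p : Cmd} {s : Store} (h0 : p.writesNat 0 = false)
    (Inv : Store → Prop) (val : ℕ → ℕ) (hA : A ≠ 3)
    (hinit : Inv (s.writeNat 3 0 d 0))
    (hstep : ∀ i s', i < K * s.nat 0 0 0 → Inv s' → s'.nat 3 0 d = i →
      (∀ j, s'.nat A r j = if j < i then val j else s.nat A r j) →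
      Inv ((p.den O s').writeNat 3 0 d (i + 1)) ∧
      ∀ j, (p.den O s').nat A r j = if j = i then val i else s'.nat A r j) :
    Inv ((loop d K p).den O s) ∧ ∀ j, ((loop d K p).den O s).nat A r j =
      if j < K * s.nat 0 0 0 then val j else s.nat A r j := by
  refine den_loop O h0 (P := fun i s' => Inv s' ∧
    ∀ j, s'.nat A r j = if j < i then val j else s.nat A r j) ⟨hinit, by simp [hA]⟩ ?_
  rintro i s' hi ⟨h1, h2⟩ h3 -
  obtain ⟨h4, h5⟩ := hstep i s' hi h1 h3 h2
  refine ⟨h4, fun j => ?_⟩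
  rw [writeNat_nat_of_ne _ _ _ _ _ _ hA, h5, h2]
  rcases lt_trichotomy j i with h | rfl | h
  · simp [h, h.ne, show j < i + 1 by omega]
  · simp
  · simp [h.ne', show ¬ j < i by omega, show ¬ j < i + 1 by omega]

/-- `A[0][i] := 0` for all `i < K * n`. -/
def clearRow (d K A : ℕ) : Cmd := loop d K (set0 A (ctr d) (.const 0))

theorem clearRow_spec {d K A : ℕ} (hA : A ≠ 3) (hA0 : A ≠ 0) (s : Store) (j : ℕ) :
    ((clearRow d K A).den O s).nat A 0 j = if j < K * s.nat 0 0 0 then 0 else s.nat A 0 j := by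
  refine (den_loop_fill (by simpa [writesNat] using hA0) (fun _ => True) (fun _ => 0) hA trivial
    ?_).2 j
  intro i s' _ _ hi _
  refine ⟨trivial, fun j => ?_⟩
  simp [hi]

/-- `A[0][i] := B[0][i]` for all `i < K * n`. -/
def copyRow (d K A B : ℕ) : Cmd := loop d K (set0 A (ctr d) (at0 B (ctr d)))

theorem copyRow_spec {d K A B : ℕ} (hA : A ≠ 3) (hA0 : A ≠ 0) (hAB : B ≠ A) (hB : B ≠ 3) (s : Store)
    (j : ℕ) : ((copyRow d K A B).den O s).nat A 0 j =
      if j < K * s.nat 0 0 0 then s.nat B 0 j else s.nat A 0 j := by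
  refine (den_loop_fill (by simpa [writesNat] using hA0) (fun s' => s'.nat B = s.nat B)
    (fun i => s.nat B 0 i) hA (by simp [hB]) ?_).2 j
  intro i s' _ h hi _
  simp [hi, h, hB, hAB]

/-- Greedily collect in the row `12[0]` a basis of the complement of the set in the row `11[0]`. -/
def greedy (j : Fin 2) : Cmd :=
  clearRow 5 1 12 ;;
  loop 5 1 (when (isZero (at0 11 (ctr 5)))
    (set0 12 (ctr 5) (.const 1) ;;
      ite (.indep j 12 (.const 0)) skip (set0 12 (ctr 5) (.const 0))))

/-- The set of vertices described by the row `A[0]`. -/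
def vertexSet (n : ℕ) (s : Store) (A : ℕ) : Set (Fin n) := {v | s.nat A 0 v ≠ 0}

theorem greedy_spec (M : Fin 2 → Matroid (Fin n)) (hM : ∀ j, (M j).E = Set.univ) (j : Fin 2)
    (s : Store) (hn : s.nat 0 0 0 = n) :
    (M j).IsBasis (vertexSet n ((greedy j).den (fun j => (M j).Indep) s) 12)
      (vertexSet n s 11)ᶜ := by
  set O : Oracles n := fun j => (M j).Indep with hO
  set s1 := (clearRow 5 1 12).den O s with hs1
  have hn1 : s1.nat 0 0 0 = n := by
    rw [hs1, den_nat_of_not_writesNat O _ rfl, hn]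
  have h11 : s1.nat 11 = s.nat 11 := den_nat_of_not_writesNat O _ rfl s
  have h12 : ∀ v : Fin n, s1.nat 12 0 v = 0 := by
    intro v
    rw [hs1, clearRow_spec (by decide) (by decide), hn]
    simp
  have key := den_loop O (d := 5) (K := 1) (p := when (isZero (at0 11 (ctr 5)))
    (set0 12 (ctr 5) (.const 1) ;;
      ite (.indep j 12 (.const 0)) skip (set0 12 (ctr 5) (.const 0)))) rfl (s := s1)
    (fun i s' => s'.nat 11 = s.nat 11 ∧ (M j).Indep (vertexSet n s' 12) ∧
      vertexSet n s' 12 ⊆ (vertexSet n s 11)ᶜ ∧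
      (∀ v : Fin n, (v : ℕ) < i → v ∉ vertexSet n s 11 → v ∈ (M j).closure (vertexSet n s' 12)) ∧
      ∀ v : Fin n, i ≤ v → s'.nat 12 0 v = 0) ?_ ?_
  · rw [hn1, one_mul] at key
    obtain ⟨-, h1, h2, h3, -⟩ := key
    exact h1.isBasis_of_subset_of_subset_closure h2 fun v hv => h3 v v.2 hv
  · have : vertexSet n (s1.writeNat 3 0 5 0) 12 = ∅ := by
      ext v
      simp [vertexSet, h12]
    rw [this]
    simp [h11, h12]
  · rintro i s' hi ⟨h1, h2, h3, h4, h5⟩ hc hn'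
    rw [hn1, one_mul] at hi
    set v : Fin n := ⟨i, hi⟩ with hv
    have hmem : ∀ s' : Store, vertexSet n (s'.writeNat 3 0 5 (i + 1)) 12 = vertexSet n s' 12 := by
      intro s'
      simp [vertexSet]
    have hvn : v ∉ vertexSet n s' 12 := by simp [vertexSet, h5 v le_rfl]
    have hins : vertexSet n (s'.writeNat 12 0 i 1) 12 = insert v (vertexSet n s' 12) := by
      ext u
      by_cases hu : u = v
      · simp [vertexSet, hu, hv]
      · have : (u : ℕ) ≠ i := fun h => hu (Fin.ext h)
        simp [vertexSet, hu, this]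
    rw [hmem]
    by_cases hU : s.nat 11 0 i = 0
    · rw [den_ite_pos O (by simp [hc, h1, hU])]
      by_cases hind : (M j).Indep (insert v (vertexSet n s' 12))
      · rw [den_seq, den_ite_pos O]
        · simp only [den_setNat, den_skip, NatExpr.eval, hc]
          refine ⟨by simp [h1], by rwa [hins], ?_, ?_, ?_⟩
          · rw [hins]
            refine Set.insert_subset ?_ h3
            simp [vertexSet, hv, hU]
          · intro u hu huU
            rw [hins]
            rcases Nat.lt_succ_iff_lt_or_eq.1 hu with hu | hu
            · exact (M j).closure_subset_closure (Set.subset_insert _ _) (h4 u hu huU)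
            · have : u = v := Fin.ext hu
              rw [this]
              exact (M j).mem_closure_of_mem' (Set.mem_insert _ _) (by simp [hM])
          · intro u hu
            have : (u : ℕ) ≠ i := by omega
            simp [this, h5 u (by omega)]
        · simp only [den_setNat, NatExpr.eval, hc, Test.holds]
          have := hins
          rw [vertexSet] at this
          rw [this]
          exact hind
      · rw [den_seq, den_ite_neg O]
        · have h12' : ∀ u : Fin n, ((s'.writeNat 12 0 i 1).writeNat 12 0 i 0).nat 12 0 u =
              s'.nat 12 0 u := by
            intro u
            by_cases hu : (u : ℕ) = i
            · simp [hu, show s'.nat 12 0 i = 0 from h5 v le_rfl]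
            · simp [hu]
          have hsame : vertexSet n ((s'.writeNat 12 0 i 1).writeNat 12 0 i 0) 12 =
              vertexSet n s' 12 := by
            ext u
            simp only [vertexSet, Set.mem_ofPred_eq, h12']
          simp only [den_setNat, NatExpr.eval, hc, writeNat_nat_of_ne, ne_eq, Nat.reduceEqDiff,
            not_false_eq_true]
          rw [hsame]
          refine ⟨h1, h2, h3, ?_, fun u hu => ?_⟩
          · intro u hu huU
            rcases Nat.lt_succ_iff_lt_or_eq.1 hu with hu | hu
            · exact h4 u hu huU
            · have : u = v := Fin.ext hu
              rw [this]
              by_contra hcl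
              exact hind ((h2.insert_indep_iff_of_notMem hvn).2 ⟨by simp [hM], hcl⟩)
          · rw [h12']
            exact h5 u (by omega)
        · simp only [den_setNat, NatExpr.eval, hc, Test.holds]
          have := hins
          rw [vertexSet] at this
          rw [this]
          exact hind
    · rw [den_ite_neg O (by simp [hc, h1, hU])]
      refine ⟨by simp [h1], h2, h3, ?_, fun u hu => ?_⟩
      · intro u hu huU
        rcases Nat.lt_succ_iff_lt_or_eq.1 hu with hu | hu
        · exact h4 u hu huU
        · exact absurd huU (by simp [vertexSet, hu, hU])
      · simpa using h5 u (by omega)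

end Cmd

end OracleRAM

/-! ### Testing independence in the two matroids -/

namespace OracleRAM

namespace Cmd

variable {n : ℕ}

theorem coindep_iff_of_isBasis_compl {V : Type*} {M : Matroid V} (hM : M.E = Set.univ) {B T : Set V}
    (hB : M.IsBasis B Tᶜ) : M.Coindep T ↔ ∀ v ∈ T, ¬ M.Indep (insert v B) := by
  have hBT : ∀ v ∈ T, v ∉ B := fun v hv hvB => hB.subset hvB hv
  rw [Matroid.coindep_iff_compl_spanning (by simp [hM]), hM, ← Set.compl_eq_univ_sdiff,
    ← hB.spanning_iff_spanning, Matroid.spanning_iff_ground_subset_closure (by simp [hM]), hM]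
  constructor
  · intro h v hv hi
    exact ((hB.indep.insert_indep_iff_of_notMem (hBT v hv)).1 hi).2 (h (Set.mem_univ v))
  · intro h v _
    by_cases hv : v ∈ T
    · by_contra hcl
      exact h v hv ((hB.indep.insert_indep_iff_of_notMem (hBT v hv)).2 ⟨by simp [hM], hcl⟩)
    · exact hB.subset_closure hv

/-- Mark in the row `11[0]` the slots `F[0][x]` of the elements `x` of the row `9[0]`; the flag `10`
is cleared if some slot is taken twice or some entry `x` is not the number of an element. -/
def markSlots (F : ℕ) : Cmd :=
  loop 4 5 (when (nonZero (at0 9 (ctr 4)))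
    (ite (ltTest (ctr 4) (var 4))
      (when (nonZero (at0 11 (at0 F (ctr 4)))) (setVar 10 (.const 0)) ;;
        set0 11 (at0 F (ctr 4)) (.const 1))
      (setVar 10 (.const 0))))

theorem markSlots_spec (O : Oracles n) {F : ℕ} (hF : F = 6 ∨ F = 7) (s : Store)
    (hn : s.nat 0 0 0 = n) (hF2 : ∀ x < s.nat 4 0 0, s.nat F 0 x < 2 * n)
    (h10 : s.nat 10 0 0 ≠ 0) (h11 : ∀ c < 2 * n, s.nat 11 0 c = 0) (C : Set ℕ)
    (hC : C = {x | x < 5 * n ∧ s.nat 9 0 x ≠ 0}) :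
    (((markSlots F).den O s).nat 10 0 0 ≠ 0 ↔
      (∀ x ∈ C, x < s.nat 4 0 0) ∧ Set.InjOn (s.nat F 0) C) ∧
    (((markSlots F).den O s).nat 10 0 0 ≠ 0 →
      ∀ c < 2 * n, ((markSlots F).den O s).nat 11 0 c ≠ 0 ↔ c ∈ s.nat F 0 '' C) := by
  have hF3 : F ≠ 3 ∧ F ≠ 10 ∧ F ≠ 11 := by omega
  set N := s.nat 4 0 0 with hN
  set f := s.nat F 0 with hf
  set Ci : ℕ → Set ℕ := fun i => {x | x < i ∧ s.nat 9 0 x ≠ 0} with hCi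
  have hCn : C = Ci (5 * n) := hC
  rw [hCn]
  have hsucc1 : ∀ i, s.nat 9 0 i = 0 → Ci (i + 1) = Ci i := by
    intro i hi
    ext x
    simp only [hCi, Set.mem_ofPred_eq]
    constructor
    · rintro ⟨h1, h2⟩
      rcases Nat.lt_succ_iff_lt_or_eq.1 h1 with h1 | rfl
      · exact ⟨h1, h2⟩
      · exact absurd hi h2
    · rintro ⟨h1, h2⟩
      exact ⟨by omega, h2⟩
  have hsucc2 : ∀ i, s.nat 9 0 i ≠ 0 → Ci (i + 1) = insert i (Ci i) := by
    intro i hi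
    ext x
    simp only [hCi, Set.mem_ofPred_eq, Set.mem_insert_iff]
    constructor
    · rintro ⟨h1, h2⟩
      rcases Nat.lt_succ_iff_lt_or_eq.1 h1 with h1 | rfl
      · exact Or.inr ⟨h1, h2⟩
      · exact Or.inl rfl
    · rintro (rfl | ⟨h1, h2⟩)
      · exact ⟨by omega, hi⟩
      · exact ⟨by omega, h2⟩
  have hnot : ∀ i, i ∉ Ci i := fun i h => lt_irrefl _ h.1
  have key := den_loop O (d := 4) (K := 5) (p := when (nonZero (at0 9 (ctr 4)))
    (ite (ltTest (ctr 4) (var 4))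
      (when (nonZero (at0 11 (at0 F (ctr 4)))) (setVar 10 (.const 0)) ;;
        set0 11 (at0 F (ctr 4)) (.const 1))
      (setVar 10 (.const 0)))) (by simp [writesNat]) (s := s)
    (fun i s' => s'.nat 9 = s.nat 9 ∧ s'.nat 4 = s.nat 4 ∧ s'.nat F = s.nat F ∧
      (s'.nat 10 0 0 ≠ 0 ↔ (∀ x ∈ Ci i, x < N) ∧ Set.InjOn f (Ci i)) ∧
      (s'.nat 10 0 0 ≠ 0 → ∀ c < 2 * n, s'.nat 11 0 c ≠ 0 ↔ c ∈ f '' Ci i)) ?_ ?_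
  · rw [hn] at key
    exact ⟨key.2.2.2.1, key.2.2.2.2⟩
  · have : Ci 0 = ∅ := by
      ext x
      simp [hCi]
    simp [hF3.1, h10, this]
    exact h11
  · rintro i s' - ⟨h1, h2, h3, h4, h5⟩ hc -
    by_cases hi : s.nat 9 0 i = 0
    · rw [den_ite_neg O (by simp [hc, h1, hi]), hsucc1 i hi]
      simp only [den_skip]
      refine ⟨by simp [h1], by simp [h2], by simp [h3, hF3.1], by simpa using h4, by simpa using h5⟩
    rw [den_ite_pos O (by simp [hc, h1, hi]), hsucc2 i hi]
    by_cases hiN : i < N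
    · rw [den_ite_pos O (by simpa [hc, h2, ← hN] using hiN)]
      have hfi : f i < 2 * n := hF2 i hiN
      have hall : (∀ x ∈ insert i (Ci i), x < N) ↔ ∀ x ∈ Ci i, x < N := by simp [hiN]
      rw [hall]
      have hFi : s'.nat F 0 i = f i := by rw [h3]
      by_cases hu : s'.nat 11 0 (f i) = 0
      · rw [den_seq, den_ite_neg O (by simp [hc, hFi, hu])]
        simp only [den_skip, den_setNat, NatExpr.eval, hc, hFi]
        have hiff : (∀ x ∈ Ci i, x < N) ∧ Set.InjOn f (Ci i) ↔
            (∀ x ∈ Ci i, x < N) ∧ Set.InjOn f (insert i (Ci i)) := by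
          constructor
          · intro h
            refine ⟨h.1, (Set.injOn_insert (hnot i)).2 ⟨h.2, fun hm => ?_⟩⟩
            exact (h5 (h4.2 h) _ hfi).2 hm hu
          · intro h
            exact ⟨h.1, h.2.mono (Set.subset_insert _ _)⟩
        refine ⟨by simp [h1], by simp [h2], by simp [h3, hF3], ?_, ?_⟩
        · rw [← hiff, ← h4]
          simp
        · intro h10' c hc2
          have h10'' : s'.nat 10 0 0 ≠ 0 := by simpa using h10'
          rw [Set.image_insert_eq, Set.mem_insert_iff, ← h5 h10'' c hc2]
          by_cases hcf : c = f i <;> simp [hcf]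
      · rw [den_seq, den_ite_pos O (by simp [hc, hFi, hu])]
        simp only [den_setNat, NatExpr.eval]
        have hno : ¬ ((∀ x ∈ Ci i, x < N) ∧ Set.InjOn f (insert i (Ci i))) := by
          rintro ⟨h6, h7⟩
          rw [Set.injOn_insert (hnot i)] at h7
          exact h7.2 ((h5 (h4.2 ⟨h6, h7.1⟩) _ hfi).1 hu)
        refine ⟨by simp [h1], by simp [h2], by simp [h3, hF3], ?_, ?_⟩
        · simp only [hno, iff_false, not_not]
          simp
        · intro h
          simp at h
    · rw [den_ite_neg O (by simpa [hc, h2, ← hN] using hiN)]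
      simp only [den_setNat, NatExpr.eval]
      refine ⟨by simp [h1], by simp [h2], by simp [h3, hF3], ?_, ?_⟩
      · have hno : ¬ ((∀ x ∈ insert i (Ci i), x < N) ∧ Set.InjOn f (insert i (Ci i))) :=
          fun h => hiN (h.1 i (Set.mem_insert _ _))
        simp only [hno, iff_false, not_not]
        simp
      · intro h
        simp at h

/-- Clear the flag `10` if some vertex in the row `11[0]` can be added to the set in the row
`12[0]`, which is disjoint from the former. -/
def checkSpanning (j : Fin 2) : Cmd :=
  loop 4 1 (when (nonZero (at0 11 (ctr 4)))
    (set0 12 (ctr 4) (.const 1) ;; when (.indep j 12 (.const 0)) (setVar 10 (.const 0)) ;;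
      set0 12 (ctr 4) (.const 0)))

theorem checkSpanning_spec (O : Oracles n) (j : Fin 2) (s : Store) (hn : s.nat 0 0 0 = n)
    (hd : ∀ v ∈ vertexSet n s 11, v ∉ vertexSet n s 12) :
    ((checkSpanning j).den O s).nat 10 0 0 ≠ 0 ↔ s.nat 10 0 0 ≠ 0 ∧
      ∀ v ∈ vertexSet n s 11, ¬ O j (insert v (vertexSet n s 12)) := by
  have key := den_loop O (d := 4) (K := 1) (p := when (nonZero (at0 11 (ctr 4)))
    (set0 12 (ctr 4) (.const 1) ;; when (.indep j 12 (.const 0)) (setVar 10 (.const 0)) ;;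
      set0 12 (ctr 4) (.const 0))) rfl (s := s)
    (fun i s' => s'.nat 11 = s.nat 11 ∧ (∀ v : Fin n, s'.nat 12 0 v = s.nat 12 0 v) ∧
      (s'.nat 10 0 0 ≠ 0 ↔ s.nat 10 0 0 ≠ 0 ∧
        ∀ v : Fin n, (v : ℕ) < i → v ∈ vertexSet n s 11 → ¬ O j (insert v (vertexSet n s 12)))) ?_ ?_
  · rw [hn, one_mul] at key
    rw [checkSpanning, key.2.2]
    simp
  · simp
  · rintro i s' hi ⟨h1, h2, h3⟩ hc -
    rw [hn, one_mul] at hi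
    set v : Fin n := ⟨i, hi⟩ with hv
    have hsucc : ∀ p : Fin n → Prop, (∀ u : Fin n, (u : ℕ) < i + 1 → p u) ↔
        (∀ u : Fin n, (u : ℕ) < i → p u) ∧ p v := by
      intro p
      constructor
      · intro h
        exact ⟨fun u hu => h u (by omega), h v (by simp [hv])⟩
      · rintro ⟨h, h'⟩ u hu
        rcases Nat.lt_succ_iff_lt_or_eq.1 hu with hu | hu
        · exact h u hu
        · have : u = v := Fin.ext hu
          exact this ▸ h'
    by_cases hU : s.nat 11 0 i = 0
    · rw [den_ite_neg O (by simp [hc, h1, hU]), hsucc]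
      have : v ∉ vertexSet n s 11 := by simp [vertexSet, hv, hU]
      simpa [h1, h2, this] using h3
    · rw [den_ite_pos O (by simp [hc, h1, hU]), hsucc]
      have hvU : v ∈ vertexSet n s 11 := by simpa [vertexSet, hv] using hU
      have hv12 : s.nat 12 0 i = 0 := by simpa [vertexSet, hv] using hd v hvU
      have hins : {u : Fin n | (s'.writeNat 12 0 i 1).nat 12 0 u ≠ 0} =
          insert v (vertexSet n s 12) := by
        ext u
        by_cases hu : u = v
        · simp [vertexSet, hu, hv]
        · have : (u : ℕ) ≠ i := fun h => hu (Fin.ext h)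
          simp [vertexSet, hu, this, h2]
      by_cases hO : O j (insert v (vertexSet n s 12))
      · rw [den_seq, den_seq, den_ite_pos O]
        · simp only [den_setNat, NatExpr.eval, hc]
          refine ⟨by simp [h1], ?_, ?_⟩
          · intro u
            by_cases hu : (u : ℕ) = i
            · simp [hc, hu, hv12]
            · simp [hc, hu, h2]
          · simp [hvU, hO]
        · simp only [den_setNat, NatExpr.eval, hc, Test.holds]
          rw [hins]
          exact hO
      · rw [den_seq, den_seq, den_ite_neg O]
        · simp only [den_setNat, NatExpr.eval, hc, den_skip]
          refine ⟨by simp [h1], ?_, ?_⟩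
          · intro u
            by_cases hu : (u : ℕ) = i
            · simp [hc, hu, hv12]
            · simp [hc, hu, h2]
          · simpa [hvU, hO] using h3
        · simp only [den_setNat, NatExpr.eval, hc, Test.holds]
          rw [hins]
          exact hO

/-- Set the flag `10` if the set of elements in the row `9[0]` is independent for the matroid
number `j`, whose slots are in the row `F[0]`, and clear it otherwise. -/
def testSlots (j : Fin 2) (F : ℕ) : Cmd :=
  setVar 10 (.const 1) ;; clearRow 4 2 11 ;; markSlots F ;; greedy j ;; checkSpanning j

theorem testSlots_spec (M : Fin 2 → Matroid (Fin n)) (hM : ∀ j, (M j).E = Set.univ) (j : Fin 2)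
    {F : ℕ} (hF : F = 6 ∨ F = 7) (s : Store)
    (hn : s.nat 0 0 0 = n) (hF2 : ∀ x < s.nat 4 0 0, s.nat F 0 x < 2 * n) :
    ((testSlots j F).den (fun j => (M j).Indep) s).nat 10 0 0 ≠ 0 ↔
      SlotIndep (M j) (s.nat 4 0 0) (s.nat F 0) {x | x < 5 * n ∧ s.nat 9 0 x ≠ 0} := by
  set O : Oracles n := fun j => (M j).Indep with hO
  have hF3 : F ≠ 3 ∧ F ≠ 10 ∧ F ≠ 11 := by omega
  set s1 := s.writeNat 10 0 0 1 with hs1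
  set s2 := (clearRow 4 2 11).den O s1 with hs2
  set s3 := (markSlots F).den O s2 with hs3
  set s4 := (greedy j).den O s3 with hs4
  have hden : (testSlots j F).den O s = (checkSpanning j).den O s4 := rfl
  have e2 : ∀ A, A ≠ 3 → A ≠ 10 → A ≠ 11 → s2.nat A = s.nat A := by
    intro A h1 h2 h3
    rw [hs2, den_nat_of_not_writesNat O _ (by simp [clearRow, writesNat, h1, h3.symm]), hs1,
      writeNat_nat_of_ne _ _ _ _ _ _ h2]
  have hn3 : s3.nat 0 0 0 = n := by
    rw [hs3, den_nat_of_not_writesNat O _ (by simp [markSlots, writesNat]),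
      e2 0 (by decide) (by decide) (by decide), hn]
  have hm := markSlots_spec O hF s2 (by rw [e2 0 (by decide) (by decide) (by decide), hn])
    (by rwa [e2 4 (by decide) (by decide) (by decide), e2 F hF3.1 hF3.2.1 hF3.2.2])
    (by rw [hs2, den_nat_of_not_writesNat O _ rfl, hs1]; simp)
    (fun c hc => by
      rw [hs2, clearRow_spec (by decide) (by decide), hs1, writeNat_nat_of_ne _ _ _ _ _ _ (by decide),
        hn, if_pos hc])
    {x | x < 5 * n ∧ s.nat 9 0 x ≠ 0} (by rw [e2 9 (by decide) (by decide) (by decide)])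
  rw [e2 4 (by decide) (by decide) (by decide), e2 F hF3.1 hF3.2.1 hF3.2.2, ← hs3] at hm
  set C : Set ℕ := {x | x < 5 * n ∧ s.nat 9 0 x ≠ 0} with hC
  have hg := greedy_spec M hM j s3 hn3
  have e4 : ∀ A, A ≠ 3 → A ≠ 12 → s4.nat A = s3.nat A := by
    intro A h1 h2
    rw [hs4, den_nat_of_not_writesNat O _ (by simp [greedy, clearRow, writesNat, h1, h2.symm])]
  have h411 : vertexSet n s4 11 = vertexSet n s3 11 := by
    rw [vertexSet, vertexSet, e4 11 (by decide) (by decide)]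
  rw [← hs4, ← h411] at hg
  rw [hden, checkSpanning_spec O j s4 (by rw [e4 0 (by decide) (by decide), hn3])
    (fun v hv hv' => hg.subset hv' hv), ← coindep_iff_of_isBasis_compl (hM j) hg,
    e4 10 (by decide) (by decide), SlotIndep, h411, ← and_assoc, ← hm.1]
  refine and_congr_right fun h10 => ?_
  have : vertexSet n s3 11 = {v : Fin n | (v : ℕ) ∈ s.nat F 0 '' C} := by
    ext v
    exact hm.2 h10 v (by omega)
  rw [this]

end Cmd

end OracleRAM

/-! ### Tabulating the exchange graph -/

namespace OracleRAM

namespace Cmd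

variable {n : ℕ}

/-- During a loop, the state `s'` agrees with the initial state `s` wherever the body `p` does not
write. -/
structure LoopFrame (d : ℕ) (p : Cmd) (s s' : Store) : Prop where
  nat : ∀ A, p.writesNat A = false → A ≠ 3 → s'.nat A = s.nat A
  real : ∀ A, p.writesReal A = false → s'.real A = s.real A
  ctr : ∀ d', p.usesCtr d' = false → d' ≠ d → s'.nat 3 0 d' = s.nat 3 0 d'

/-- Induction along a counting loop, where everything that the body does not write is known to be
unchanged. -/
theorem den_loop_frame (O : Oracles n) {d K : ℕ} {p : Cmd} (h0 : p.writesNat 0 = false) {s : Store}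
    (P : ℕ → Store → Prop) (hinit : P 0 (s.writeNat 3 0 d 0))
    (hstep : ∀ i s', i < K * s.nat 0 0 0 → LoopFrame d p s s' → s'.nat 3 0 d = i → P i s' →
      P (i + 1) ((p.den O s').writeNat 3 0 d (i + 1))) :
    P (K * s.nat 0 0 0) ((loop d K p).den O s) := by
  refine (den_loop O h0 (P := fun i s' => LoopFrame d p s s' ∧ P i s') ⟨⟨?_, ?_, ?_⟩, hinit⟩ ?_).2
  · intro A _ hA
    exact writeNat_nat_of_ne _ _ _ _ _ _ hA
  · intro A _
    rfl
  · intro d' _ hd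
    simp [hd]
  · rintro i s' hi ⟨hf, hP⟩ hc -
    refine ⟨⟨?_, ?_, ?_⟩, hstep i s' hi hf hc hP⟩
    · intro A h1 h2
      rw [writeNat_nat_of_ne _ _ _ _ _ _ h2, den_nat_of_not_writesNat O p h1, hf.nat A h1 h2]
    · intro A h1
      rw [writeNat_real, den_real_of_not_writesReal O p h1, hf.real A h1]
    · intro d' h1 h2
      rw [writeNat_nat_self, if_neg (by simp [h2]), den_ctr_of_not_usesCtr O p h1, hf.ctr d' h1 h2]

/-- The input size, the number of elements and the slots of the elements are stored as expected. -/
structure Ready (n : ℕ) (s : Store) : Prop where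
  size : s.nat 0 0 0 = n
  slotL : ∀ x < s.nat 4 0 0, s.nat 6 0 x < 2 * n
  slotR : ∀ x < s.nat 4 0 0, s.nat 7 0 x < 2 * n

theorem Ready.congr {s s' : Store} (h : Ready n s) (h0 : s'.nat 0 = s.nat 0)
    (h4 : s'.nat 4 = s.nat 4) (h6 : s'.nat 6 = s.nat 6) (h7 : s'.nat 7 = s.nat 7) : Ready n s' :=
  ⟨by rw [h0, h.size], by rw [h4, h6]; exact h.slotL, by rw [h4, h7]; exact h.slotR⟩

theorem Ready.frame {d : ℕ} {p : Cmd} {s s' : Store} (h : Ready n s) (hf : LoopFrame d p s s')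
    (hp : ∀ A ∈ [0, 4, 6, 7], p.writesNat A = false) : Ready n s' :=
  h.congr (hf.nat 0 (hp 0 (by simp)) (by decide)) (hf.nat 4 (hp 4 (by simp)) (by decide))
    (hf.nat 6 (hp 6 (by simp)) (by decide)) (hf.nat 7 (hp 7 (by simp)) (by decide))

/-- The set of elements described by the row `A[0]`. -/
def members (n : ℕ) (s : Store) (A : ℕ) : Finset ℕ :=
  (Finset.range (5 * n)).filter (s.nat A 0 · ≠ 0)

theorem mem_members {s : Store} {A x : ℕ} :
    x ∈ members n s A ↔ x < 5 * n ∧ s.nat A 0 x ≠ 0 := by simp [members]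

theorem members_congr {s s' : Store} {A : ℕ} (h : s'.nat A = s.nat A) :
    members n s' A = members n s A := by rw [members, members, h]

/-- Set the flag `10` if the current set remains independent in the matroid number `j` after the
element number `ctr dy` has been removed and the element number `ctr dx` has been added. -/
def probe (j : Fin 2) (F dy dx : ℕ) : Cmd :=
  copyRow 3 5 9 8 ;; set0 9 (ctr dy) (.const 0) ;; set0 9 (ctr dx) (.const 1) ;; testSlots j F

theorem probe_spec (M : Fin 2 → Matroid (Fin n)) (hM : ∀ j, (M j).E = Set.univ) (j : Fin 2)
    {F dy dx : ℕ} (hF : F = 6 ∨ F = 7) (hdy : dy ≠ 3) (hdx : dx ≠ 3) (s : Store) (hs : Ready n s)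
    (hx : s.nat 3 0 dx < 5 * n) :
    ((probe j F dy dx).den (fun j => (M j).Indep) s).nat 10 0 0 ≠ 0 ↔
      SlotIndep (M j) (s.nat 4 0 0) (s.nat F 0)
        (insert (s.nat 3 0 dx) ((members n s 8 : Set ℕ) \ {s.nat 3 0 dy})) := by
  set O : Oracles n := fun j => (M j).Indep with hO
  set s1 := (copyRow 3 5 9 8).den O s with hs1
  have e1 : ∀ A, A ≠ 3 → A ≠ 9 → s1.nat A = s.nat A := by
    intro A h1 h2
    rw [hs1, den_nat_of_not_writesNat O _ (by simp [copyRow, writesNat, h1, h2.symm])]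
  have c1 : ∀ d, d ≠ 3 → s1.nat 3 0 d = s.nat 3 0 d := by
    intro d hd
    rw [hs1, den_ctr_of_not_usesCtr O _ (by simp [copyRow, usesCtr, hd])]
  have hden : (probe j F dy dx).den O s = (testSlots j F).den O
      ((s1.writeNat 9 0 (s.nat 3 0 dy) 0).writeNat 9 0 (s.nat 3 0 dx) 1) := by
    simp [probe, ← hs1, c1 dy hdy, c1 dx hdx]
  set s2 := (s1.writeNat 9 0 (s.nat 3 0 dy) 0).writeNat 9 0 (s.nat 3 0 dx) 1 with hs2
  have e2 : ∀ A, A ≠ 3 → A ≠ 9 → s2.nat A = s.nat A := by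
    intro A h1 h2
    rw [hs2, writeNat_nat_of_ne _ _ _ _ _ _ h2, writeNat_nat_of_ne _ _ _ _ _ _ h2, e1 A h1 h2]
  have hF3 : F ≠ 3 ∧ F ≠ 9 := by omega
  rw [hden, testSlots_spec M hM j hF s2 (by rw [e2 0 (by decide) (by decide), hs.size])
    (by
      rw [e2 4 (by decide) (by decide), e2 F hF3.1 hF3.2]
      rcases hF with rfl | rfl
      · exact hs.slotL
      · exact hs.slotR), e2 4 (by decide) (by decide), e2 F hF3.1 hF3.2]
  have hset : {x | x < 5 * n ∧ s2.nat 9 0 x ≠ 0} =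
      insert (s.nat 3 0 dx) ((members n s 8 : Set ℕ) \ {s.nat 3 0 dy}) := by
    ext x
    simp only [hs2, writeNat_nat_self, true_and, hs1,
      copyRow_spec (A := 9) (B := 8) (by decide) (by decide) (by decide) (by decide), hs.size,
      Set.mem_ofPred_eq, Set.mem_insert_iff, Set.mem_sdiff, Finset.mem_coe, mem_members,
      Set.mem_singleton_iff]
    by_cases h1 : x = s.nat 3 0 dx
    · simp [h1, hx]
    · by_cases h2 : x = s.nat 3 0 dy
      · rw [h2] at h1
        simp [h2, h1]
      · by_cases h3 : x < 5 * n <;> simp [h1, h2, h3]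
  rw [hset]

theorem probe_writesNat {j : Fin 2} {F dy dx A : ℕ} (h3 : A ≠ 3) (h9 : A ≠ 9) (h10 : A ≠ 10)
    (h11 : A ≠ 11) (h12 : A ≠ 12) : (probe j F dy dx).writesNat A = false := by
  simp [probe, testSlots, copyRow, clearRow, markSlots, greedy, checkSpanning, writesNat, h3,
    h9.symm, h10.symm, h11.symm, h12.symm]

theorem probe_usesCtr {j : Fin 2} {F dy dx d : ℕ} (h3 : d ≠ 3) (h4 : d ≠ 4) (h5 : d ≠ 5) :
    (probe j F dy dx).usesCtr d = false := by
  simp [probe, testSlots, copyRow, clearRow, markSlots, greedy, checkSpanning, usesCtr, h3, h4, h5]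

attribute [irreducible] probe

/-- Test whether the exchange graph has an arc from `ctr 1` to `ctr 2`, and store the answer. -/
def arcBody : Cmd :=
  setNat 13 (ctr 1) (ctr 2) (.const 0) ;;
  ite (.and (isZero (at0 8 (ctr 1))) (nonZero (at0 8 (ctr 2))))
    (probe 1 7 2 1 ;; setNat 13 (ctr 1) (ctr 2) (var 10))
    (when (.and (nonZero (at0 8 (ctr 1))) (isZero (at0 8 (ctr 2))))
      (probe 0 6 1 2 ;; setNat 13 (ctr 1) (ctr 2) (var 10)))

variable {M : Fin 2 → Matroid (Fin n)} {L R : Matroid ℕ}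

/-- The matroids `L` and `R` on the elements are given by the slots stored in the memory. -/
structure Represents (M : Fin 2 → Matroid (Fin n)) (L R : Matroid ℕ) (s : Store) : Prop where
  left : ∀ I, L.Indep I ↔ SlotIndep (M 0) (s.nat 4 0 0) (s.nat 6 0) I
  right : ∀ I, R.Indep I ↔ SlotIndep (M 1) (s.nat 4 0 0) (s.nat 7 0) I

theorem Represents.congr {s s' : Store} (h : Represents M L R s)
    (h4 : s'.nat 4 = s.nat 4) (h6 : s'.nat 6 = s.nat 6) (h7 : s'.nat 7 = s.nat 7) :
    Represents M L R s' :=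
  ⟨by rw [h4, h6]; exact h.left, by rw [h4, h7]; exact h.right⟩

theorem Represents.frame {d : ℕ} {p : Cmd} {s s' : Store} (h : Represents M L R s)
    (hf : LoopFrame d p s s') (hp : ∀ A ∈ [0, 4, 6, 7], p.writesNat A = false) :
    Represents M L R s' :=
  h.congr (hf.nat 4 (hp 4 (by simp)) (by decide))
    (hf.nat 6 (hp 6 (by simp)) (by decide)) (hf.nat 7 (hp 7 (by simp)) (by decide))

theorem arcBody_spec (hM : ∀ j, (M j).E = Set.univ) (s : Store) (hs : Ready n s)
    (hr : Represents M L R s) (h1 : s.nat 3 0 1 < 5 * n) (h2 : s.nat 3 0 2 < 5 * n) :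
    (∀ u v, ¬ (u = s.nat 3 0 1 ∧ v = s.nat 3 0 2) →
      (arcBody.den (fun j => (M j).Indep) s).nat 13 u v = s.nat 13 u v) ∧
    ((arcBody.den (fun j => (M j).Indep) s).nat 13 (s.nat 3 0 1) (s.nat 3 0 2) ≠ 0 ↔
      ExchangeArc L R (members n s 8) (s.nat 3 0 1) (s.nat 3 0 2)) := by
  set O : Oracles n := fun j => (M j).Indep with hO
  set u := s.nat 3 0 1 with hu
  set v := s.nat 3 0 2 with hv
  set s1 := s.writeNat 13 u v 0 with hs1
  have e1 : ∀ A, A ≠ 13 → s1.nat A = s.nat A := fun A hA => writeNat_nat_of_ne _ _ _ _ _ _ hA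
  have hready : Ready n s1 := hs.congr (e1 0 (by decide)) (e1 4 (by decide)) (e1 6 (by decide))
    (e1 7 (by decide))
  have hrep : Represents M L R s1 := hr.congr (e1 4 (by decide)) (e1 6 (by decide))
    (e1 7 (by decide))
  have hu1 : s1.nat 3 0 1 = u := by rw [e1 3 (by decide)]
  have hv1 : s1.nat 3 0 2 = v := by rw [e1 3 (by decide)]
  have h8 : s1.nat 8 = s.nat 8 := e1 8 (by decide)
  have hmem : members n s1 8 = members n s 8 := members_congr h8
  have hmu : u ∈ members n s 8 ↔ s.nat 8 0 u ≠ 0 := by rw [mem_members]; exact and_iff_right h1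
  have hmv : v ∈ members n s 8 ↔ s.nat 8 0 v ≠ 0 := by rw [mem_members]; exact and_iff_right h2
  have hwrite : ∀ (j : Fin 2) (F dy dx : ℕ) (X : Prop),
      (((probe j F dy dx).den O s1).nat 10 0 0 ≠ 0 ↔ X) →
      (∀ u' v', ¬ (u' = u ∧ v' = v) →
        ((probe j F dy dx ;; setNat 13 (ctr 1) (ctr 2) (var 10)).den O s1).nat 13 u' v' =
          s.nat 13 u' v') ∧
      (((probe j F dy dx ;; setNat 13 (ctr 1) (ctr 2) (var 10)).den O s1).nat 13 u v ≠ 0 ↔ X) := by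
    intro j F dy dx X hX
    have e3 : ((probe j F dy dx).den O s1).nat 13 = s1.nat 13 :=
      den_nat_of_not_writesNat O _
        (probe_writesNat (by decide) (by decide) (by decide) (by decide) (by decide)) _
    have c3 : ∀ d, d ≠ 3 → d ≠ 4 → d ≠ 5 →
        ((probe j F dy dx).den O s1).nat 3 0 d = s1.nat 3 0 d := fun d h3 h4 h5 =>
      den_ctr_of_not_usesCtr O _ (probe_usesCtr h3 h4 h5) _
    simp only [den_seq, den_setNat, NatExpr.eval, c3 1 (by decide) (by decide) (by decide),
      c3 2 (by decide) (by decide) (by decide), hu1, hv1]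
    constructor
    · intro u' v' hne
      rw [writeNat_nat_self, if_neg hne, e3, hs1, writeNat_nat_self, if_neg hne]
    · simpa using hX
  have hden : arcBody.den O s = (ite (.and (isZero (at0 8 (ctr 1))) (nonZero (at0 8 (ctr 2))))
    (probe 1 7 2 1 ;; setNat 13 (ctr 1) (ctr 2) (var 10))
    (when (.and (nonZero (at0 8 (ctr 1))) (isZero (at0 8 (ctr 2))))
      (probe 0 6 1 2 ;; setNat 13 (ctr 1) (ctr 2) (var 10)))).den O s1 := rfl
  rw [hden]
  by_cases hcu : s.nat 8 0 u = 0 <;> by_cases hcv : s.nat 8 0 v = 0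
  · rw [den_ite_neg O (by simp [hu1, hv1, h8, hcv]), den_ite_neg O (by simp [hu1, hv1, h8, hcu])]
    constructor
    · intro u' v' hne
      simp only [den_skip, hs1, writeNat_nat_self, if_neg hne]
    · simp [hs1, ExchangeArc, hmu, hmv, hcu, hcv]
  · rw [den_ite_pos O (by simp [hu1, hv1, h8, hcu, hcv])]
    refine hwrite 1 7 2 1 _ ?_
    rw [probe_spec M hM 1 (Or.inr rfl) (by decide) (by decide) s1 hready (by rwa [hu1]),
      ← hrep.right, hmem, hu1, hv1]
    simp [ExchangeArc, hmu, hmv, hcu, hcv]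
  · rw [den_ite_neg O (by simp [hu1, hv1, h8, hcv]),
      den_ite_pos O (by simp [hu1, hv1, h8, hcu, hcv])]
    refine hwrite 0 6 1 2 _ ?_
    rw [probe_spec M hM 0 (Or.inl rfl) (by decide) (by decide) s1 hready (by rwa [hv1]),
      ← hrep.left, hmem, hu1, hv1]
    simp [ExchangeArc, hmu, hmv, hcu, hcv]
  · rw [den_ite_neg O (by simp [hu1, hv1, h8, hcu]), den_ite_neg O (by simp [hu1, hv1, h8, hcv])]
    constructor
    · intro u' v' hne
      simp only [den_skip, hs1, writeNat_nat_self, if_neg hne]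
    · simp [hs1, ExchangeArc, hmu, hmv, hcu, hcv]

/-- Store the arcs of the exchange graph in the array `13`. -/
def buildArcs : Cmd := loop 1 5 (loop 2 5 arcBody)

theorem arcBody_writesNat {A : ℕ} (h3 : A ≠ 3) (h9 : A ≠ 9) (h10 : A ≠ 10)
    (h11 : A ≠ 11) (h12 : A ≠ 12) (h13 : A ≠ 13) : arcBody.writesNat A = false := by
  simp [arcBody, writesNat, probe_writesNat h3 h9 h10 h11 h12, h13.symm]

theorem arcBody_loop_writesNat {A : ℕ} (h3 : A ≠ 3) (h9 : A ≠ 9) (h10 : A ≠ 10)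
    (h11 : A ≠ 11) (h12 : A ≠ 12) (h13 : A ≠ 13) : (loop 2 5 arcBody).writesNat A = false := by
  simp [writesNat, arcBody_writesNat h3 h9 h10 h11 h12 h13, h3]

theorem buildArcs_spec (hM : ∀ j, (M j).E = Set.univ) (s : Store) (hs : Ready n s)
    (hr : Represents M L R s) (u v : ℕ) (hu : u < 5 * n) (hv : v < 5 * n) :
    (buildArcs.den (fun j => (M j).Indep) s).nat 13 u v ≠ 0 ↔
      ExchangeArc L R (members n s 8) u v := by
  have hw : ∀ A ∈ [0, 4, 6, 7], (loop 2 5 arcBody).writesNat A = false := by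
    intro A hA
    simp only [List.mem_cons, List.not_mem_nil, or_false] at hA
    exact arcBody_loop_writesNat (by omega) (by omega) (by omega) (by omega) (by omega) (by omega)
  have hw' : ∀ A ∈ [0, 4, 6, 7], arcBody.writesNat A = false := by
    intro A hA
    have := hw A hA
    simp only [writesNat, Bool.or_eq_false_iff] at this
    exact this.2
  have key := den_loop_frame (fun j => (M j).Indep) (d := 1) (K := 5) (p := loop 2 5 arcBody)
    (hw 0 (by simp)) (s := s)
    (fun i s' => ∀ u < i, ∀ v < 5 * n, s'.nat 13 u v ≠ 0 ↔ ExchangeArc L R (members n s 8) u v)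
    (by simp) ?_
  · rw [hs.size] at key
    exact key u hu v hv
  intro i s1 hi hf1 hc1 hP1
  rw [hs.size] at hi
  have hready1 := hs.frame hf1 hw
  have hrep1 := hr.frame hf1 hw
  have h81 : s1.nat 8 = s.nat 8 :=
    hf1.nat 8 (arcBody_loop_writesNat (by decide) (by decide) (by decide) (by decide) (by decide)
      (by decide)) (by decide)
  have key2 := den_loop_frame (fun j => (M j).Indep) (d := 2) (K := 5) (p := arcBody)
    (hw' 0 (by simp)) (s := s1)
    (fun k s' => (∀ u < i, ∀ v < 5 * n, s'.nat 13 u v ≠ 0 ↔ ExchangeArc L R (members n s 8) u v) ∧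
      ∀ v < k, s'.nat 13 i v ≠ 0 ↔ ExchangeArc L R (members n s 8) i v)
    ⟨by simpa using hP1, by simp⟩ ?_
  · rw [hready1.size] at key2
    intro u hu v hv
    rw [writeNat_nat_of_ne _ _ _ _ _ _ (by decide)]
    rcases Nat.lt_succ_iff_lt_or_eq.1 hu with hu | rfl
    · exact key2.1 u hu v hv
    · exact key2.2 v hv
  intro k s2 hk hf2 hc2 hP2
  rw [hready1.size] at hk
  have hready2 := hready1.frame hf2 hw'
  have hrep2 := hrep1.frame hf2 hw'
  have h82 : s2.nat 8 = s.nat 8 := by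
    rw [hf2.nat 8 (arcBody_writesNat (by decide) (by decide) (by decide) (by decide) (by decide)
      (by decide)) (by decide), h81]
  have hc12 : s2.nat 3 0 1 = i := by
    rw [hf2.ctr 1 (by simp [arcBody, usesCtr, probe_usesCtr]) (by decide), hc1]
  have hb := arcBody_spec hM s2 hready2 hrep2 (by omega) (by omega)
  rw [hc12, hc2, members_congr h82] at hb
  refine ⟨?_, ?_⟩
  · intro u hu v hv
    rw [writeNat_nat_of_ne _ _ _ _ _ _ (by decide), hb.1 u v (by omega)]
    exact hP2.1 u hu v hv
  · intro v hv
    rw [writeNat_nat_of_ne _ _ _ _ _ _ (by decide)]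
    rcases Nat.lt_succ_iff_lt_or_eq.1 hv with hv | rfl
    · rw [hb.1 i v (by omega)]
      exact hP2.2 v hv
    · exact hb.2

/-- Decide for the vertex `ctr 1` whether it is a source or a sink of the exchange graph. -/
def endBody : Cmd :=
  set0 14 (ctr 1) (.const 0) ;; set0 15 (ctr 1) (.const 0) ;;
  when (isZero (at0 8 (ctr 1)))
    (probe 0 6 1 1 ;; set0 14 (ctr 1) (var 10) ;; probe 1 7 1 1 ;; set0 15 (ctr 1) (var 10))

theorem endBody_spec (hM : ∀ j, (M j).E = Set.univ) (s : Store) (hs : Ready n s)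
    (hr : Represents M L R s) (h1 : s.nat 3 0 1 < 5 * n) :
    (∀ v, v ≠ s.nat 3 0 1 → (endBody.den (fun j => (M j).Indep) s).nat 14 0 v = s.nat 14 0 v ∧
      (endBody.den (fun j => (M j).Indep) s).nat 15 0 v = s.nat 15 0 v) ∧
    ((endBody.den (fun j => (M j).Indep) s).nat 14 0 (s.nat 3 0 1) ≠ 0 ↔
      AugSource L (members n s 8) (s.nat 3 0 1)) ∧
    ((endBody.den (fun j => (M j).Indep) s).nat 15 0 (s.nat 3 0 1) ≠ 0 ↔
      AugSource R (members n s 8) (s.nat 3 0 1)) := by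
  set O : Oracles n := fun j => (M j).Indep with hO
  set u := s.nat 3 0 1 with hu
  set s1 := (s.writeNat 14 0 u 0).writeNat 15 0 u 0 with hs1
  have e1 : ∀ A, A ≠ 14 → A ≠ 15 → s1.nat A = s.nat A := fun A hA hA' => by
    rw [hs1, writeNat_nat_of_ne _ _ _ _ _ _ hA', writeNat_nat_of_ne _ _ _ _ _ _ hA]
  have hu1 : s1.nat 3 0 1 = u := by rw [e1 3 (by decide) (by decide)]
  have h8 : s1.nat 8 = s.nat 8 := e1 8 (by decide) (by decide)
  have hmu : u ∈ members n s 8 ↔ s.nat 8 0 u ≠ 0 := by rw [mem_members]; exact and_iff_right h1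
  have hden : endBody.den O s = (when (isZero (at0 8 (ctr 1)))
    (probe 0 6 1 1 ;; set0 14 (ctr 1) (var 10) ;; probe 1 7 1 1 ;;
      set0 15 (ctr 1) (var 10))).den O s1 := by
    simp [endBody, hs1, hu]
  rw [hden]
  by_cases hcu : s.nat 8 0 u = 0
  · rw [den_ite_pos O (by simp [hu1, h8, hcu])]
    have fr : ∀ (j : Fin 2) (F : ℕ) (s : Store) (A : ℕ), A ≠ 3 → A ≠ 9 → A ≠ 10 → A ≠ 11 → A ≠ 12 →
        ((probe j F 1 1).den O s).nat A = s.nat A := fun j F s A h1 h2 h3 h4 h5 =>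
      den_nat_of_not_writesNat O _ (probe_writesNat h1 h2 h3 h4 h5) _
    have frc : ∀ (j : Fin 2) (F : ℕ) (s : Store),
        ((probe j F 1 1).den O s).nat 3 0 1 = s.nat 3 0 1 := fun j F s =>
      den_ctr_of_not_usesCtr O _ (probe_usesCtr (by decide) (by decide) (by decide)) _
    have hset : (insert u ((members n s 8 : Set ℕ) \ {u})) = insert u (members n s 8 : Set ℕ) := by
      rw [Set.insert_sdiff_singleton]
    set s2 := (probe 0 6 1 1).den O s1 with hs2
    set s3 := s2.writeNat 14 0 u (s2.nat 10 0 0) with hs3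
    have e3 : ∀ A, A ≠ 3 → A ≠ 9 → A ≠ 10 → A ≠ 11 → A ≠ 12 → A ≠ 14 → A ≠ 15 →
        s3.nat A = s.nat A := by
      intro A h3 h9 h10 h11 h12 h14 h15
      rw [hs3, writeNat_nat_of_ne _ _ _ _ _ _ h14, hs2, fr _ _ _ _ h3 h9 h10 h11 h12,
        e1 A h14 h15]
    have hu3 : s3.nat 3 0 1 = u := by
      rw [hs3, writeNat_nat_of_ne _ _ _ _ _ _ (by decide), hs2, frc, hu1]
    have hp0 := probe_spec (dy := 1) (dx := 1) M hM 0 (Or.inl rfl) (by decide) (by decide) s1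
      (hs.congr (e1 0 (by decide) (by decide)) (e1 4 (by decide) (by decide))
        (e1 6 (by decide) (by decide)) (e1 7 (by decide) (by decide))) (by rwa [hu1])
    rw [e1 4 (by decide) (by decide), e1 6 (by decide) (by decide), ← hr.left, members_congr h8,
      hu1, hset, ← hs2] at hp0
    have hp1 := probe_spec (dy := 1) (dx := 1) M hM 1 (Or.inr rfl) (by decide) (by decide) s3
      (hs.congr
        (e3 0 (by decide) (by decide) (by decide) (by decide) (by decide) (by decide) (by decide))
        (e3 4 (by decide) (by decide) (by decide) (by decide) (by decide) (by decide) (by decide))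
        (e3 6 (by decide) (by decide) (by decide) (by decide) (by decide) (by decide) (by decide))
        (e3 7 (by decide) (by decide) (by decide) (by decide) (by decide) (by decide) (by decide)))
      (by rwa [hu3])
    rw [e3 4 (by decide) (by decide) (by decide) (by decide) (by decide) (by decide) (by decide),
      e3 7 (by decide) (by decide) (by decide) (by decide) (by decide) (by decide) (by decide),
      ← hr.right, members_congr (e3 8 (by decide) (by decide) (by decide) (by decide) (by decide)
        (by decide) (by decide)), hu3, hset] at hp1
    set s4 := (probe 1 7 1 1).den O s3 with hs4
    have h_fin : (probe 0 6 1 1 ;; set0 14 (ctr 1) (var 10) ;; probe 1 7 1 1 ;;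
        set0 15 (ctr 1) (var 10)).den O s1 = s4.writeNat 15 0 u (s4.nat 10 0 0) := by
      have h2 : s2.nat 3 0 1 = u := by rw [hs2, frc, hu1]
      have h4 : s4.nat 3 0 1 = u := by rw [hs4, frc, hu3]
      simp only [den_seq, den_setNat, NatExpr.eval, ← hs2, h2, ← hs3, ← hs4, h4]
    rw [h_fin]
    have e414 : s4.nat 14 = s3.nat 14 := fr _ _ _ _ (by decide) (by decide) (by decide) (by decide)
      (by decide)
    have e415 : s4.nat 15 = s1.nat 15 := by
      rw [hs4, fr _ _ _ _ (by decide) (by decide) (by decide) (by decide) (by decide), hs3,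
        writeNat_nat_of_ne _ _ _ _ _ _ (by decide), hs2,
        fr _ _ _ _ (by decide) (by decide) (by decide) (by decide) (by decide)]
    have e214 : s2.nat 14 = s1.nat 14 := fr _ _ _ _ (by decide) (by decide) (by decide) (by decide)
      (by decide)
    refine ⟨fun v hv => ⟨?_, ?_⟩, ?_, ?_⟩
    · simp [e414, hs3, hv, e214, hs1]
    · simp [hv, e415, hs1]
    · simpa [e414, hs3, AugSource, hmu, hcu] using hp0
    · simpa [AugSource, hmu, hcu] using hp1
  · rw [den_ite_neg O (by simp [hu1, h8, hcu])]
    refine ⟨fun v hv => ⟨?_, ?_⟩, ?_, ?_⟩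
    · simp [hs1, hv]
    · simp [hs1, hv]
    · simp [hs1, AugSource, hmu, hcu]
    · simp [hs1, AugSource, hmu, hcu]

/-- Store the sources and the sinks of the exchange graph in the rows `14[0]` and `15[0]`. -/
def buildEnds : Cmd := loop 1 5 endBody

theorem endBody_writesNat {A : ℕ} (h3 : A ≠ 3) (h9 : A ≠ 9) (h10 : A ≠ 10)
    (h11 : A ≠ 11) (h12 : A ≠ 12) (h14 : A ≠ 14) (h15 : A ≠ 15) : endBody.writesNat A = false := by
  simp [endBody, writesNat, probe_writesNat h3 h9 h10 h11 h12, h14.symm, h15.symm]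

theorem buildEnds_spec (hM : ∀ j, (M j).E = Set.univ) (s : Store) (hs : Ready n s)
    (hr : Represents M L R s) (v : ℕ) (hv : v < 5 * n) :
    ((buildEnds.den (fun j => (M j).Indep) s).nat 14 0 v ≠ 0 ↔ AugSource L (members n s 8) v) ∧
    ((buildEnds.den (fun j => (M j).Indep) s).nat 15 0 v ≠ 0 ↔ AugSource R (members n s 8) v) := by
  have hw : ∀ A ∈ [0, 4, 6, 7], endBody.writesNat A = false := by
    intro A hA
    simp only [List.mem_cons, List.not_mem_nil, or_false] at hA
    exact endBody_writesNat (by omega) (by omega) (by omega) (by omega) (by omega) (by omega)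
      (by omega)
  have key := den_loop_frame (fun j => (M j).Indep) (d := 1) (K := 5) (p := endBody)
    (hw 0 (by simp)) (s := s)
    (fun i s' => ∀ v < i, (s'.nat 14 0 v ≠ 0 ↔ AugSource L (members n s 8) v) ∧
      (s'.nat 15 0 v ≠ 0 ↔ AugSource R (members n s 8) v))
    (by simp) ?_
  · rw [hs.size] at key
    exact key v hv
  intro i s1 hi hf1 hc1 hP1 v hv
  rw [hs.size] at hi
  have h81 : s1.nat 8 = s.nat 8 :=
    hf1.nat 8 (endBody_writesNat (by decide) (by decide) (by decide) (by decide) (by decide)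
      (by decide) (by decide)) (by decide)
  have hb := endBody_spec hM s1 (hs.frame hf1 hw) (hr.frame hf1 hw) (by omega)
  rw [hc1, members_congr h81] at hb
  rw [writeNat_nat_of_ne _ _ _ _ _ _ (by decide), writeNat_nat_of_ne _ _ _ _ _ _ (by decide)]
  rcases Nat.lt_succ_iff_lt_or_eq.1 hv with hv | rfl
  · rw [(hb.1 v hv.ne).1, (hb.1 v hv.ne).2]
    exact hP1 v hv
  · exact hb.2

end Cmd

end OracleRAM

/-! ### The table of shortest walks -/

namespace OracleRAM

namespace Cmd

variable {n : ℕ} (O : Oracles n)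

/-- Store the lengths of the vertices of the exchange graph in the row `6[0]` of real numbers. -/
def buildLen : Cmd :=
  loop 1 5 (ite (isZero (at0 8 (ctr 1)))
    (setReal 6 (.const 0) (ctr 1) (.sub .zero (.read 1 (.const 0) (ctr 1))))
    (setReal 6 (.const 0) (ctr 1) (.read 1 (.const 0) (ctr 1))))

theorem buildLen_spec (s : Store) (hn : s.nat 0 0 0 = n) (v : ℕ) (hv : v < 5 * n) :
    (buildLen.den O s).real 6 0 v = exchangeLen (s.real 1 0) (members n s 8) v := by
  have key := den_loop_frame O (d := 1) (K := 5) (p := ite (isZero (at0 8 (ctr 1)))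
    (setReal 6 (.const 0) (ctr 1) (.sub .zero (.read 1 (.const 0) (ctr 1))))
    (setReal 6 (.const 0) (ctr 1) (.read 1 (.const 0) (ctr 1)))) rfl (s := s)
    (fun i s' => ∀ v < i, s'.real 6 0 v = exchangeLen (s.real 1 0) (members n s 8) v) (by simp) ?_
  · rw [hn] at key
    exact key v hv
  intro i s1 hi hf hc hP v hv
  rw [hn] at hi
  have h8 : s1.nat 8 = s.nat 8 := hf.nat 8 rfl (by decide)
  have h1 : s1.real 1 = s.real 1 := hf.real 1 rfl
  have hmem : i ∈ members n s 8 ↔ s.nat 8 0 i ≠ 0 := by rw [mem_members]; exact and_iff_right hi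
  rw [writeNat_real]
  rcases Nat.lt_succ_iff_lt_or_eq.1 hv with hv | rfl
  · have hne : v ≠ i := hv.ne
    by_cases h : s.nat 8 0 i = 0
    · rw [den_ite_pos O (by simp [hc, h8, h])]
      simp [hc, hne, hP v hv]
    · rw [den_ite_neg O (by simp [hc, h8, h])]
      simp [hc, hne, hP v hv]
  · by_cases h : s.nat 8 0 v = 0
    · rw [den_ite_pos O (by simp [hc, h8, h])]
      simp [hc, h1, exchangeLen, hmem, h]
    · rw [den_ite_neg O (by simp [hc, h8, h])]
      simp [hc, h1, exchangeLen, hmem, h]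

/-- The first row of the table: walks without arcs. -/
def initTable : Cmd :=
  loop 1 5 (setNat 16 (.const 0) (ctr 1) (at0 14 (ctr 1)) ;;
    setReal 2 (.const 0) (ctr 1) (.read 6 (.const 0) (ctr 1)))

theorem initTable_spec (s : Store) (hn : s.nat 0 0 0 = n) (v : ℕ) (hv : v < 5 * n) :
    (initTable.den O s).nat 16 0 v = s.nat 14 0 v ∧
      (initTable.den O s).real 2 0 v = s.real 6 0 v := by
  have key := den_loop_frame O (d := 1) (K := 5)
    (p := setNat 16 (.const 0) (ctr 1) (at0 14 (ctr 1)) ;;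
    setReal 2 (.const 0) (ctr 1) (.read 6 (.const 0) (ctr 1))) rfl (s := s)
    (fun i s' => ∀ v < i, s'.nat 16 0 v = s.nat 14 0 v ∧ s'.real 2 0 v = s.real 6 0 v) (by simp) ?_
  · rw [hn] at key
    exact key v hv
  intro i s1 hi hf hc hP v hv
  have h14 : s1.nat 14 = s.nat 14 := hf.nat 14 rfl (by decide)
  have h6 : s1.real 6 = s.real 6 := hf.real 6 rfl
  rcases Nat.lt_succ_iff_lt_or_eq.1 hv with hv | rfl
  · simp [hc, hv.ne, hP v hv]
  · simp [hc, h14, h6]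

/-- The table entry for walks to `ctr 2` with `ctr 1 + 1` arcs is improved by the walks whose last
arc comes from `ctr 3`. -/
def relax : Cmd :=
  when (.and (.and (nonZero (.read 16 (ctr 1) (ctr 3))) (nonZero (.read 13 (ctr 3) (ctr 2))))
      (.not (.and (nonZero (.read 16 (.add (ctr 1) (.const 1)) (ctr 2)))
        (.realLe (.read 2 (.add (ctr 1) (.const 1)) (ctr 2))
          (.add (.read 2 (ctr 1) (ctr 3)) (.read 6 (.const 0) (ctr 2)))))))
    (setNat 16 (.add (ctr 1) (.const 1)) (ctr 2) (.const 1) ;;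
      setReal 2 (.add (ctr 1) (.const 1)) (ctr 2)
        (.add (.read 2 (ctr 1) (ctr 3)) (.read 6 (.const 0) (ctr 2))) ;;
      setNat 17 (.add (ctr 1) (.const 1)) (ctr 2) (ctr 3))

/-- The loop program that fills the table: the entry `[j][v]` of the array `16` tells whether there
is a walk with `j` arcs from a source to `v`, the entry of the real array `2` is the minimum length
of such walks, and the entry of the array `17` is the last vertex but one of a shortest one. -/
def fillTable : Cmd :=
  loop 1 5 (loop 2 5 (setNat 16 (.add (ctr 1) (.const 1)) (ctr 2) (.const 0) ;; loop 3 5 relax))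

/-- The table entry for walks to `v` with `j + 1` arcs takes into account all walks whose last arc
comes from a vertex smaller than `U`. -/
def EntryOK (n : ℕ) (Arc : ℕ → ℕ → Prop) (ℓ : ℕ → ℝ) (s : Store) (j v U : ℕ) : Prop :=
  (s.nat 16 (j + 1) v ≠ 0 ↔ ∃ u < U, s.nat 16 j u ≠ 0 ∧ Arc u v) ∧
  (s.nat 16 (j + 1) v ≠ 0 →
    (s.nat 17 (j + 1) v < 5 * n ∧ s.nat 16 j (s.nat 17 (j + 1) v) ≠ 0 ∧
      Arc (s.nat 17 (j + 1) v) v ∧ s.real 2 (j + 1) v = s.real 2 j (s.nat 17 (j + 1) v) + ℓ v) ∧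
    ∀ u < U, s.nat 16 j u ≠ 0 → Arc u v → s.real 2 (j + 1) v ≤ s.real 2 j u + ℓ v)

theorem EntryOK.congr {Arc : ℕ → ℕ → Prop} {ℓ : ℕ → ℝ} {s s' : Store} {j v U : ℕ}
    (h : EntryOK n Arc ℓ s j v U) (h1 : s'.nat 16 j = s.nat 16 j) (h2 : s'.real 2 j = s.real 2 j)
    (h3 : s'.nat 16 (j + 1) v = s.nat 16 (j + 1) v)
    (h4 : s'.nat 17 (j + 1) v = s.nat 17 (j + 1) v)
    (h5 : s'.real 2 (j + 1) v = s.real 2 (j + 1) v) : EntryOK n Arc ℓ s' j v U := by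
  rw [EntryOK, h1, h2, h3, h4, h5]
  exact h

/-- The two states have the same table entries, except possibly for the entry `[j + 1][v]`. -/
structure SameBut (j v : ℕ) (s s' : Store) : Prop where
  valid : ∀ j' v', ¬ (j' = j + 1 ∧ v' = v) → s'.nat 16 j' v' = s.nat 16 j' v'
  pred : ∀ j' v', ¬ (j' = j + 1 ∧ v' = v) → s'.nat 17 j' v' = s.nat 17 j' v'
  dist : ∀ j' v', ¬ (j' = j + 1 ∧ v' = v) → s'.real 2 j' v' = s.real 2 j' v'

theorem relax_spec {Arc : ℕ → ℕ → Prop} {ℓ : ℕ → ℝ} (s : Store) {j v u : ℕ} (h1 : s.nat 3 0 1 = j)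
    (h2 : s.nat 3 0 2 = v) (h3 : s.nat 3 0 3 = u) (hu : u < 5 * n)
    (harc : s.nat 13 u v ≠ 0 ↔ Arc u v) (hlen : s.real 6 0 v = ℓ v) :
    SameBut j v s (relax.den O s) ∧
      (EntryOK n Arc ℓ s j v u → EntryOK n Arc ℓ (relax.den O s) j v (u + 1)) := by
  have hex : ∀ p : ℕ → Prop, (∃ u' < u + 1, p u') ↔ (∃ u' < u, p u') ∨ p u := by
    intro p
    constructor
    · rintro ⟨u', hu', hp⟩
      rcases Nat.lt_succ_iff_lt_or_eq.1 hu' with h | rfl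
      · exact Or.inl ⟨u', h, hp⟩
      · exact Or.inr hp
    · rintro (⟨u', hu', hp⟩ | hp)
      · exact ⟨u', by omega, hp⟩
      · exact ⟨u, by omega, hp⟩
  have hall : ∀ p : ℕ → Prop, (∀ u' < u + 1, p u') ↔ (∀ u' < u, p u') ∧ p u := by
    intro p
    constructor
    · intro h
      exact ⟨fun u' hu' => h u' (by omega), h u (by omega)⟩
    · rintro ⟨h, h'⟩ u' hu'
      rcases Nat.lt_succ_iff_lt_or_eq.1 hu' with h'' | rfl
      · exact h u' h''
      · exact h'
  by_cases hc : s.nat 16 j u ≠ 0 ∧ Arc u v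
  · by_cases hd : s.nat 16 (j + 1) v ≠ 0 ∧ s.real 2 (j + 1) v ≤ s.real 2 j u + ℓ v
    · rw [relax, den_ite_neg O (by
        intro h
        simp only [Test.holds, NatExpr.eval, RealExpr.eval, h1, h2, h3, hlen, Nat.le_zero] at h
        exact h.2 hd)]
      refine ⟨⟨by simp, by simp, by simp⟩, ?_⟩
      rintro ⟨h4, h5⟩
      rw [den_skip, EntryOK, hex, hall]
      refine ⟨iff_of_true hd.1 (Or.inr hc), fun h => ⟨(h5 h).1, (h5 h).2, fun _ _ => hd.2⟩⟩
    · rw [relax, den_ite_pos O (by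
        have h6 := harc.2 hc.2
        have h7 := hc.1
        simp only [Test.holds, NatExpr.eval, RealExpr.eval, h1, h2, h3, hlen, Nat.le_zero]
        exact ⟨⟨h7, h6⟩, hd⟩)]
      have hden : (setNat 16 (.add (ctr 1) (.const 1)) (ctr 2) (.const 1) ;;
          setReal 2 (.add (ctr 1) (.const 1)) (ctr 2)
            (.add (.read 2 (ctr 1) (ctr 3)) (.read 6 (.const 0) (ctr 2))) ;;
          setNat 17 (.add (ctr 1) (.const 1)) (ctr 2) (ctr 3)).den O s =
          ((s.writeNat 16 (j + 1) v 1).writeReal 2 (j + 1) v (s.real 2 j u + ℓ v)).writeNat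
            17 (j + 1) v u := by
        simp [h1, h2, h3, hlen]
      rw [hden]
      refine ⟨⟨fun j' v' h => by simp [h], fun j' v' h => by simp [h], fun j' v' h => by simp [h]⟩,
        ?_⟩
      rintro ⟨h4, h5⟩
      rw [EntryOK, hex, hall]
      have hj : ∀ v', ¬ (j = j + 1 ∧ v' = v) := fun v' h => by omega
      simp only [ne_eq, Nat.reduceEqDiff, not_false_eq_true, writeNat_nat_of_ne, writeReal_nat,
        writeNat_nat_self, and_self, if_true, writeNat_real, writeReal_real_self, hj, if_false]
      refine ⟨iff_of_true trivial (Or.inr hc), fun _ => ⟨⟨hu, hc.1, hc.2, trivial⟩, ?_, ?_⟩⟩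
      · intro u' hu' h6 h7
        by_cases hv : s.nat 16 (j + 1) v = 0
        · exact absurd (h4.2 ⟨u', hu', h6, h7⟩) (not_not.2 hv)
        · exact (not_le.1 fun h => hd ⟨hv, h⟩).le.trans ((h5 hv).2 u' hu' h6 h7)
      · exact fun _ _ => le_rfl
  · rw [relax, den_ite_neg O (by
      intro h
      simp only [Test.holds, NatExpr.eval, h1, h2, h3, Nat.le_zero] at h
      exact hc ⟨h.1.1, harc.1 h.1.2⟩)]
    refine ⟨⟨by simp, by simp, by simp⟩, ?_⟩
    rintro ⟨h4, h5⟩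
    rw [den_skip, EntryOK, hex, hall, h4]
    exact ⟨⟨Or.inl, fun h => h.resolve_right hc⟩,
      fun h => ⟨(h5 (h4.2 h)).1, (h5 (h4.2 h)).2, fun h6 h7 => absurd ⟨h6, h7⟩ hc⟩⟩

attribute [irreducible] relax

/-- The row `j` of the table is correct. -/
def RowOK (n : ℕ) (Src : ℕ → Prop) (Arc : ℕ → ℕ → Prop) (ℓ : ℕ → ℝ) (s : Store) (j : ℕ) : Prop :=
  ∀ v < 5 * n, (s.nat 16 j v ≠ 0 ↔ ∃ r, DiWalk Src Arc ℓ j v r) ∧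
    (s.nat 16 j v ≠ 0 → DiWalk Src Arc ℓ j v (s.real 2 j v) ∧
      ∀ r, DiWalk Src Arc ℓ j v r → s.real 2 j v ≤ r)

theorem RowOK.succ {Src : ℕ → Prop} {Arc : ℕ → ℕ → Prop} {ℓ : ℕ → ℝ} {s : Store} {j : ℕ}
    (hA : ∀ u v, Arc u v → u < 5 * n ∧ v < 5 * n) (h : RowOK n Src Arc ℓ s j)
    (he : ∀ v < 5 * n, EntryOK n Arc ℓ s j v (5 * n)) : RowOK n Src Arc ℓ s (j + 1) := by
  intro v hv
  obtain ⟨h1, h2⟩ := he v hv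
  have hstep : ∀ r, DiWalk Src Arc ℓ (j + 1) v r →
      ∃ u < 5 * n, ∃ r', DiWalk Src Arc ℓ j u r' ∧ Arc u v ∧ r = r' + ℓ v := by
    intro r hw
    cases hw with
    | step hw ha => exact ⟨_, (hA _ _ ha).1, _, hw, ha, rfl⟩
  refine ⟨h1.trans ⟨?_, ?_⟩, fun hne => ⟨?_, ?_⟩⟩
  · rintro ⟨u, hu, hu', ha⟩
    exact ⟨_, ((h u hu).2 hu').1.step ha⟩
  · rintro ⟨r, hw⟩
    obtain ⟨u, hu, r', hw', ha, -⟩ := hstep r hw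
    exact ⟨u, hu, (h u hu).1.2 ⟨r', hw'⟩, ha⟩
  · obtain ⟨⟨h3, h4, h5, h6⟩, -⟩ := h2 hne
    rw [h6]
    exact ((h _ h3).2 h4).1.step h5
  · intro r hw
    obtain ⟨u, hu, r', hw', ha, rfl⟩ := hstep r hw
    have hu' := (h u hu).1.2 ⟨r', hw'⟩
    have h3 := (h2 hne).2 u hu hu' ha
    have h4 := ((h u hu).2 hu').2 r' hw'
    linarith

theorem RowOK.congr {Src : ℕ → Prop} {Arc : ℕ → ℕ → Prop} {ℓ : ℕ → ℝ} {s s' : Store} {j : ℕ}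
    (h : RowOK n Src Arc ℓ s j) (h1 : s'.nat 16 j = s.nat 16 j) (h2 : s'.real 2 j = s.real 2 j) :
    RowOK n Src Arc ℓ s' j := by
  rw [RowOK, h1, h2]
  exact h

theorem fillTable_spec {Src : ℕ → Prop} {Arc : ℕ → ℕ → Prop} {ℓ : ℕ → ℝ}
    (hA : ∀ u v, Arc u v → u < 5 * n ∧ v < 5 * n) (s : Store) (hn : s.nat 0 0 0 = n)
    (harc : ∀ u < 5 * n, ∀ v < 5 * n, s.nat 13 u v ≠ 0 ↔ Arc u v)
    (hlen : ∀ v < 5 * n, s.real 6 0 v = ℓ v) (h0 : RowOK n Src Arc ℓ s 0) :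
    (∀ j ≤ 5 * n, RowOK n Src Arc ℓ (fillTable.den O s) j) ∧
      ∀ j < 5 * n, ∀ v < 5 * n, EntryOK n Arc ℓ (fillTable.den O s) j v (5 * n) := by
  have key := den_loop_frame O (d := 1) (K := 5)
    (p := loop 2 5 (setNat 16 (.add (ctr 1) (.const 1)) (ctr 2) (.const 0) ;; loop 3 5 relax))
    (by simp [writesNat, relax]) (s := s)
    (fun i s' => (∀ j ≤ i, RowOK n Src Arc ℓ s' j) ∧
      ∀ j < i, ∀ v < 5 * n, EntryOK n Arc ℓ s' j v (5 * n)) ⟨?_, by simp⟩ ?_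
  · rw [hn] at key
    exact key
  · rintro j hj
    obtain rfl : j = 0 := by omega
    exact h0.congr (by simp) rfl
  rintro i s1 hi hf1 hc1 ⟨hR1, hE1⟩
  have hn1 : s1.nat 0 0 0 = n := by rw [hf1.nat 0 (by simp [writesNat, relax]) (by decide), hn]
  have h13 : s1.nat 13 = s.nat 13 := hf1.nat 13 (by simp [writesNat, relax]) (by decide)
  have h6 : s1.real 6 = s.real 6 := hf1.real 6 (by simp [writesReal, relax])
  have key2 := den_loop_frame O (d := 2) (K := 5)
    (p := setNat 16 (.add (ctr 1) (.const 1)) (ctr 2) (.const 0) ;; loop 3 5 relax)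
    (by simp [writesNat, relax]) (s := s1)
    (fun k s' => (∀ j ≤ i, s'.nat 16 j = s1.nat 16 j ∧ s'.nat 17 j = s1.nat 17 j ∧
        s'.real 2 j = s1.real 2 j) ∧ ∀ v < k, EntryOK n Arc ℓ s' i v (5 * n)) ⟨?_, by simp⟩ ?_
  · rw [hn1] at key2
    obtain ⟨hsame, hE⟩ := key2
    set s2 := (loop 2 5 (setNat 16 (.add (ctr 1) (.const 1)) (ctr 2) (.const 0) ;;
      loop 3 5 relax)).den O s1 with hs2
    have hR : ∀ j ≤ i, RowOK n Src Arc ℓ s2 j := fun j hj =>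
      (hR1 j hj).congr (hsame j hj).1 (hsame j hj).2.2
    have hRs := (hR i le_rfl).succ hA hE
    refine ⟨fun j hj => ?_, fun j hj v hv => ?_⟩
    · rcases Nat.le_succ_iff.1 hj with hj | rfl
      · exact (hR j hj).congr (by simp) rfl
      · exact hRs.congr (by simp) rfl
    · rcases Nat.lt_succ_iff_lt_or_eq.1 hj with hj | rfl
      · have h1 := hsame j hj.le
        have h2 := hsame (j + 1) hj
        exact (hE1 j hj v hv).congr (by simp [h1]) (by simp [h1]) (by simp [h2]) (by simp [h2])
          (by simp [h2])
      · exact (hE v hv).congr (by simp) rfl (by simp) (by simp) rfl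
  · intro j _
    simp
  rintro k s2 hk hf2 hc2 ⟨hS2, hE2⟩
  rw [hn1] at hk
  have hc12 : s2.nat 3 0 1 = i := by rw [hf2.ctr 1 (by simp [usesCtr, relax]) (by decide), hc1]
  have hn2 : s2.nat 0 0 0 = n := by rw [hf2.nat 0 (by simp [writesNat, relax]) (by decide), hn1]
  have h132 : s2.nat 13 = s.nat 13 := by
    rw [hf2.nat 13 (by simp [writesNat, relax]) (by decide), h13]
  have h62 : s2.real 6 = s.real 6 := by rw [hf2.real 6 (by simp [writesReal, relax]), h6]
  set s3 := s2.writeNat 16 (i + 1) k 0 with hs3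
  have hden : (setNat 16 (.add (ctr 1) (.const 1)) (ctr 2) (.const 0) ;; loop 3 5 relax).den O s2 =
      (loop 3 5 relax).den O s3 := by
    simp [hc12, hc2, hs3]
  rw [hden]
  have key3 := den_loop_frame O (d := 3) (K := 5) (p := relax) (by simp [writesNat, relax])
    (s := s3)
    (fun l s' => (∀ j ≤ i, s'.nat 16 j = s1.nat 16 j ∧ s'.nat 17 j = s1.nat 17 j ∧
        s'.real 2 j = s1.real 2 j) ∧ (∀ v < k, EntryOK n Arc ℓ s' i v (5 * n)) ∧
        EntryOK n Arc ℓ s' i k l) ?_ ?_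
  · rw [show s3.nat 0 0 0 = n by rw [hs3, writeNat_nat_of_ne _ _ _ _ _ _ (by decide), hn2]] at key3
    obtain ⟨h1, h2, h3⟩ := key3
    refine ⟨fun j hj => by simpa using h1 j hj, fun v hv => ?_⟩
    rcases Nat.lt_succ_iff_lt_or_eq.1 hv with hv | rfl
    · exact (h2 v hv).congr (by simp) rfl (by simp) (by simp) rfl
    · exact h3.congr (by simp) rfl (by simp) (by simp) rfl
  · refine ⟨fun j hj => ?_, fun v hv => ?_, ?_⟩
    · refine ⟨?_, by simpa [hs3] using (hS2 j hj).2.1, (hS2 j hj).2.2⟩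
      funext v
      have : j ≠ i + 1 := by omega
      simp [hs3, this, (hS2 j hj).1]
    · exact (hE2 v hv).congr (by funext v; simp [hs3]) rfl (by simp [hs3, hv.ne])
        (by simp [hs3]) rfl
    · simp [EntryOK, hs3]
  rintro l s4 hl hf3 hc3 ⟨hS4, hE4, hk4⟩
  rw [show s3.nat 0 0 0 = n by rw [hs3, writeNat_nat_of_ne _ _ _ _ _ _ (by decide), hn2]] at hl
  have hc14 : s4.nat 3 0 1 = i := by
    rw [hf3.ctr 1 (by simp [usesCtr, relax]) (by decide), hs3,
      writeNat_nat_of_ne _ _ _ _ _ _ (by decide), hc12]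
  have hc24 : s4.nat 3 0 2 = k := by
    rw [hf3.ctr 2 (by simp [usesCtr, relax]) (by decide), hs3,
      writeNat_nat_of_ne _ _ _ _ _ _ (by decide), hc2]
  have h134 : s4.nat 13 = s.nat 13 := by
    rw [hf3.nat 13 (by simp [writesNat, relax]) (by decide), hs3,
      writeNat_nat_of_ne _ _ _ _ _ _ (by decide), h132]
  have h64 : s4.real 6 = s.real 6 := by
    rw [hf3.real 6 (by simp [writesReal, relax]), hs3, writeNat_real, h62]
  obtain ⟨hb1, hb2⟩ := relax_spec O (Arc := Arc) (ℓ := ℓ) s4 hc14 hc24 hc3 hl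
    (by rw [h134]; exact harc l hl k hk) (by rw [h64]; exact hlen k hk)
  have hrow : ∀ j ≤ i, (relax.den O s4).nat 16 j = s4.nat 16 j ∧
      (relax.den O s4).nat 17 j = s4.nat 17 j ∧ (relax.den O s4).real 2 j = s4.real 2 j := by
    intro j hj
    refine ⟨funext fun v => hb1.valid j v (by omega), funext fun v => hb1.pred j v (by omega),
      funext fun v => hb1.dist j v (by omega)⟩
  refine ⟨fun j hj => ?_, fun v hv => ?_, ?_⟩
  · simpa [hrow j hj] using hS4 j hj
  · refine (hE4 v hv).congr (by simp [hrow i le_rfl]) (by simp [hrow i le_rfl]) ?_ ?_ ?_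
    · rw [writeNat_nat_of_ne _ _ _ _ _ _ (by decide), hb1.valid _ _ (by omega)]
    · rw [writeNat_nat_of_ne _ _ _ _ _ _ (by decide), hb1.pred _ _ (by omega)]
    · rw [writeNat_real, hb1.dist _ _ (by omega)]
  · exact (hb2 hk4).congr (by simp) rfl (by simp) (by simp) rfl

end Cmd

end OracleRAM

/-! ### Choosing a shortest walk and exchanging along it -/

namespace OracleRAM

namespace Cmd

variable {n : ℕ} (O : Oracles n)

/-- Compare the best walk found so far with the walks with `ctr 1` arcs to the sink `ctr 2`. -/
def selectBody : Cmd :=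
  when (.and (.and (nonZero (.read 16 (ctr 1) (ctr 2))) (nonZero (at0 15 (ctr 2))))
      (.not (.and (nonZero (var 18))
        (.realLe (.read 3 (.const 0) (.const 0)) (.read 2 (ctr 1) (ctr 2))))))
    (setVar 18 (.const 1) ;; setVar 19 (ctr 1) ;; setVar 20 (ctr 2) ;;
      setReal 3 (.const 0) (.const 0) (.read 2 (ctr 1) (ctr 2)))

/-- Choose a table entry of a sink with minimum length and, among these, with the fewest arcs. -/
def select : Cmd := setVar 18 (.const 0) ;; loop 1 5 (loop 2 5 selectBody)

/-- The stored choice is the best one among the candidates `C` in the domain `D`. -/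
def SelectOK (C : ℕ → ℕ → Prop) (dist : ℕ → ℕ → ℝ) (D : ℕ → ℕ → Prop) (s : Store) : Prop :=
  (s.nat 18 0 0 ≠ 0 ↔ ∃ j v, D j v ∧ C j v) ∧
  (s.nat 18 0 0 ≠ 0 → D (s.nat 19 0 0) (s.nat 20 0 0) ∧ C (s.nat 19 0 0) (s.nat 20 0 0) ∧
    s.real 3 0 0 = dist (s.nat 19 0 0) (s.nat 20 0 0) ∧
    ∀ j v, D j v → C j v → s.real 3 0 0 ≤ dist j v ∧
      (dist j v = s.real 3 0 0 → s.nat 19 0 0 ≤ j))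

theorem SelectOK.congr {C : ℕ → ℕ → Prop} {dist : ℕ → ℕ → ℝ} {D D' : ℕ → ℕ → Prop} {s s' : Store}
    (h : SelectOK C dist D s) (hD : ∀ j v, D j v ↔ D' j v) (h18 : s'.nat 18 = s.nat 18)
    (h19 : s'.nat 19 = s.nat 19) (h20 : s'.nat 20 = s.nat 20) (h3 : s'.real 3 = s.real 3) :
    SelectOK C dist D' s' := by
  obtain rfl : D = D' := by
    funext j v
    exact propext (hD j v)
  rw [SelectOK, h18, h19, h20, h3]
  exact h

theorem selectBody_spec {C : ℕ → ℕ → Prop} {dist : ℕ → ℕ → ℝ} {D : ℕ → ℕ → Prop} (s : Store)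
    {i k : ℕ} (h1 : s.nat 3 0 1 = i) (h2 : s.nat 3 0 2 = k)
    (hC : C i k ↔ s.nat 16 i k ≠ 0 ∧ s.nat 15 0 k ≠ 0) (hd : s.real 2 i k = dist i k)
    (hD : ∀ j v, D j v → j ≤ i) (h : SelectOK C dist D s) :
    SelectOK C dist (fun j v => D j v ∨ (j = i ∧ v = k)) (selectBody.den O s) := by
  obtain ⟨h3, h4⟩ := h
  by_cases hc : C i k
  · by_cases hb : s.nat 18 0 0 ≠ 0 ∧ s.real 3 0 0 ≤ dist i k
    · rw [selectBody, den_ite_neg O (by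
        intro h
        simp only [Test.holds, NatExpr.eval, RealExpr.eval, h1, h2, hd, Nat.le_zero] at h
        exact h.2 hb)]
      obtain ⟨h5, h6, h7, h8⟩ := h4 hb.1
      refine ⟨iff_of_true hb.1 ⟨i, k, Or.inr ⟨rfl, rfl⟩, hc⟩, fun _ => ⟨Or.inl h5, h6, h7, ?_⟩⟩
      rintro j v (hj | ⟨rfl, rfl⟩) hjv
      · exact h8 j v hj hjv
      · exact ⟨hb.2, fun _ => hD _ _ h5⟩
    · rw [selectBody, den_ite_pos O (by
        simp only [Test.holds, NatExpr.eval, RealExpr.eval, h1, h2, hd, Nat.le_zero]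
        exact ⟨hC.1 hc, hb⟩)]
      have hden : (setVar 18 (.const 1) ;; setVar 19 (ctr 1) ;; setVar 20 (ctr 2) ;;
          setReal 3 (.const 0) (.const 0) (.read 2 (ctr 1) (ctr 2))).den O s =
          (((s.writeNat 18 0 0 1).writeNat 19 0 0 i).writeNat 20 0 0 k).writeReal 3 0 0
            (dist i k) := by
        simp [h1, h2, hd]
      rw [hden]
      simp only [SelectOK, writeReal_nat, writeReal_real_self, ne_eq, Nat.reduceEqDiff,
        not_false_eq_true, writeNat_nat_of_ne, writeNat_nat_self, and_self, if_true, one_ne_zero,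
        true_iff, forall_const]
      refine ⟨⟨i, k, Or.inr ⟨rfl, rfl⟩, hc⟩, Or.inr trivial, hc, trivial, ?_⟩
      rintro j v (hj | ⟨rfl, rfl⟩) hjv
      · have hf : s.nat 18 0 0 ≠ 0 := h3.2 ⟨j, v, hj, hjv⟩
        have h5 := ((h4 hf).2.2.2 j v hj hjv).1
        have h6 := not_le.1 fun h => hb ⟨hf, h⟩
        exact ⟨by linarith, fun h7 => by linarith⟩
      · exact ⟨le_rfl, fun _ => le_rfl⟩
  · rw [selectBody, den_ite_neg O (by
      intro h
      simp only [Test.holds, NatExpr.eval, h1, h2, Nat.le_zero] at h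
      exact hc (hC.2 h.1))]
    refine ⟨?_, ?_⟩
    · rw [den_skip, h3]
      constructor
      · rintro ⟨j, v, hj, hjv⟩
        exact ⟨j, v, Or.inl hj, hjv⟩
      · rintro ⟨j, v, hj | ⟨rfl, rfl⟩, hjv⟩
        · exact ⟨j, v, hj, hjv⟩
        · exact absurd hjv hc
    · intro hf
      obtain ⟨h5, h6, h7, h8⟩ := h4 hf
      refine ⟨Or.inl h5, h6, h7, ?_⟩
      rintro j v (hj | ⟨rfl, rfl⟩) hjv
      · exact h8 j v hj hjv
      · exact absurd hjv hc

theorem select_spec (s : Store) (hn : s.nat 0 0 0 = n) :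
    SelectOK (fun j v => s.nat 16 j v ≠ 0 ∧ s.nat 15 0 v ≠ 0) (s.real 2)
      (fun j v => j < 5 * n ∧ v < 5 * n) (select.den O s) := by
  set C : ℕ → ℕ → Prop := fun j v => s.nat 16 j v ≠ 0 ∧ s.nat 15 0 v ≠ 0 with hC
  set s0 := s.writeNat 18 0 0 0 with hs0
  have hden : select.den O s = (loop 1 5 (loop 2 5 selectBody)).den O s0 := rfl
  have hn0 : s0.nat 0 0 0 = n := by rw [hs0, writeNat_nat_of_ne _ _ _ _ _ _ (by decide), hn]
  rw [hden]
  have key := den_loop_frame O (d := 1) (K := 5) (p := loop 2 5 selectBody) rfl (s := s0)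
    (fun i s' => SelectOK C (s.real 2) (fun j v => j < i ∧ v < 5 * n) s') ?_ ?_
  · rwa [hn0] at key
  · simp [SelectOK, hs0]
  intro i s1 hi hf1 hc1 hP1
  have hn1 : s1.nat 0 0 0 = n := by rw [hf1.nat 0 rfl (by decide), hn0]
  have key2 := den_loop_frame O (d := 2) (K := 5) (p := selectBody) rfl (s := s1)
    (fun k s' => SelectOK C (s.real 2) (fun j v => (j < i ∧ v < 5 * n) ∨ (j = i ∧ v < k)) s') ?_ ?_
  · rw [hn1] at key2
    refine key2.congr (fun j v => ?_) (by simp) (by simp) (by simp) rfl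
    omega
  · exact hP1.congr (fun j v => by simp) (by simp) (by simp) (by simp) rfl
  intro k s2 hk hf2 hc2 hP2
  have h := selectBody_spec O s2 (i := i) (k := k) (by rw [hf2.ctr 1 rfl (by decide), hc1]) hc2
    (by rw [hf2.nat 16 rfl (by decide), hf2.nat 15 rfl (by decide), hf1.nat 16 rfl (by decide),
          hf1.nat 15 rfl (by decide), hs0, writeNat_nat_of_ne _ _ _ _ _ _ (by decide),
          writeNat_nat_of_ne _ _ _ _ _ _ (by decide)])
    (by rw [hf2.real 2 rfl, hf1.real 2 rfl, hs0, writeNat_real]) (by omega) hP2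
  refine h.congr (fun j v => ?_) (by simp) (by simp) (by simp) rfl
  omega

/-- The vertices met on the way back from `v` along the stored predecessors, where `v` is reached by
a walk with `j` arcs. -/
def backward (s : Store) (j v : ℕ) : ℕ → ℕ
  | 0 => v
  | t + 1 => s.nat 17 (j - t) (backward s j v t)

theorem isShortestPath_backward {Src Snk : ℕ → Prop} {Arc : ℕ → ℕ → Prop} {ℓ φ : ℕ → ℝ}
    {s : Store} (hφ : ∀ u v, Arc u v → φ v ≤ φ u + ℓ v) (hS : ∀ v, Src v → v < 5 * n)
    (hA : ∀ u v, Arc u v → v < 5 * n) (hR : ∀ j ≤ 5 * n, RowOK n Src Arc ℓ s j)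
    (hE : ∀ j < 5 * n, ∀ v < 5 * n, EntryOK n Arc ℓ s j v (5 * n)) {j v : ℕ} (hj : j < 5 * n)
    (hv : v < 5 * n) (hjv : s.nat 16 j v ≠ 0) (hT : Snk v)
    (hmin : ∀ j' v', j' < 5 * n → v' < 5 * n → s.nat 16 j' v' ≠ 0 → Snk v' →
      s.real 2 j v ≤ s.real 2 j' v' ∧ (s.real 2 j' v' = s.real 2 j v → j ≤ j')) :
    IsShortestPath Src Snk Arc ℓ (fun i => backward s j v (j - i)) j ∧
      ∀ t ≤ j, backward s j v t < 5 * n := by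
  have hb : ∀ t ≤ j, backward s j v t < 5 * n ∧ s.nat 16 (j - t) (backward s j v t) ≠ 0 := by
    intro t
    induction t with
    | zero => exact fun _ => ⟨hv, hjv⟩
    | succ t ih =>
      intro ht
      obtain ⟨h1, h2⟩ := ih (by omega)
      have h3 := (hE (j - (t + 1)) (by omega) _ h1).2
      rw [show j - (t + 1) + 1 = j - t by omega] at h3
      exact ⟨(h3 h2).1.1, (h3 h2).1.2.1⟩
  have hstep : ∀ t < j, Arc (backward s j v (t + 1)) (backward s j v t) ∧
      s.real 2 (j - t) (backward s j v t) =
        s.real 2 (j - (t + 1)) (backward s j v (t + 1)) + ℓ (backward s j v t) := by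
    intro t ht
    obtain ⟨h1, h2⟩ := hb t ht.le
    have h3 := (hE (j - (t + 1)) (by omega) _ h1).2
    rw [show j - (t + 1) + 1 = j - t by omega] at h3
    exact ⟨(h3 h2).1.2.2.1, (h3 h2).1.2.2.2⟩
  have hlen : ∀ i ≤ j, pathLen ℓ (fun i => backward s j v (j - i)) i =
      s.real 2 i (backward s j v (j - i)) := by
    intro i
    induction i with
    | zero =>
      intro _
      obtain ⟨h1, h2⟩ := hb j le_rfl
      rw [Nat.sub_self] at h2
      have h3 := ((hR 0 (Nat.zero_le _) _ h1).2 h2).1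
      rw [pathLen_zero, Nat.sub_zero]
      generalize s.real 2 0 (backward s j v j) = r at h3
      cases h3
      rfl
    | succ i ih =>
      intro hi
      rw [pathLen_succ, ih (by omega)]
      have h1 := (hstep (j - (i + 1)) (by omega)).2
      rw [show j - (j - (i + 1)) = i + 1 by omega, show j - (i + 1) + 1 = j - i by omega,
        show j - (j - i) = i by omega] at h1
      rw [h1]
  refine ⟨⟨?_, ?_, ?_, ?_⟩, fun t ht => (hb t ht).1⟩
  · obtain ⟨h1, h2⟩ := hb j le_rfl
    rw [Nat.sub_self] at h2
    obtain ⟨h3, -⟩ := (hR 0 (Nat.zero_le _) _ h1).2 h2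
    generalize s.real 2 0 (backward s j v j) = r at h3
    cases h3 with
    | start h => simpa using h
  · intro i hi
    have h1 := (hstep (j - (i + 1)) (by omega)).1
    rwa [show j - (i + 1) + 1 = j - i by omega] at h1
  · simpa [backward] using hT
  · intro l v' r hw hT'
    rw [hlen j le_rfl, Nat.sub_self]
    have hv' : v' < 5 * n := Finset.mem_range.1 (hw.mem (E := Finset.range (5 * n))
      (fun v h => Finset.mem_range.2 (hS v h)) (fun u v h => Finset.mem_range.2 (hA u v h)))
    obtain ⟨l', r', h1, h2, h3, h4⟩ := hw.exists_lt_card hφ (E := Finset.range (5 * n))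
      (fun v h => Finset.mem_range.2 (hS v h)) (fun u v h => Finset.mem_range.2 (hA u v h))
    rw [Finset.card_range] at h1
    have h5 := (hR l' h1.le v' hv').1.2 ⟨r', h4⟩
    have h6 := ((hR l' h1.le v' hv').2 h5).2 r' h4
    have h7 := hmin l' v' h1 hv' h5 hT'
    change s.real 2 j v ≤ r ∧ (r = s.real 2 j v → j ≤ l)
    refine ⟨by linarith [h7.1], fun hr => (h7.2 ?_).trans h2⟩
    linarith [h7.1]

/-- Move one step backward along the chosen walk, and change the membership of the vertex that is
left. -/
def flipBody : Cmd :=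
  when (.natLe (ctr 1) (var 19))
    (set0 8 (var 20) (.sub (.const 1) (at0 8 (var 20))) ;;
      setVar 20 (.read 17 (.sub (var 19) (ctr 1)) (var 20)))

/-- Replace the current set by its symmetric difference with the chosen walk. -/
def flip : Cmd := loop 1 5 flipBody

theorem flip_spec (s : Store) (hn : s.nat 0 0 0 = n) {j v : ℕ} (hj : s.nat 19 0 0 = j)
    (hv : s.nat 20 0 0 = v) (hjn : j < 5 * n) (hb : ∀ t ≤ j, backward s j v t < 5 * n)
    (hinj : Set.InjOn (backward s j v) (Set.Iic j)) :
    members n (flip.den O s) 8 =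
      symmDiff (members n s 8) ((Finset.range (j + 1)).image (backward s j v)) := by
  have key := den_loop_frame O (d := 1) (K := 5) (p := flipBody) rfl (s := s)
    (fun i s' => (i ≤ j + 1 → s'.nat 20 0 0 = backward s j v i) ∧
      ∀ x, s'.nat 8 0 x ≠ 0 ↔ ((s.nat 8 0 x ≠ 0) ↔ ¬ ∃ t < i, t ≤ j ∧ backward s j v t = x)) ?_ ?_
  · rw [hn] at key
    ext x
    rw [mem_members, Finset.mem_symmDiff, mem_members]
    have h1 := key.2 x
    have h2 : (∃ t < 5 * n, t ≤ j ∧ backward s j v t = x) ↔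
        x ∈ (Finset.range (j + 1)).image (backward s j v) := by
      simp only [Finset.mem_image, Finset.mem_range]
      constructor
      · rintro ⟨t, -, ht, h⟩
        exact ⟨t, by omega, h⟩
      · rintro ⟨t, ht, h⟩
        exact ⟨t, by omega, by omega, h⟩
    rw [h2] at h1
    have h3 : x ∈ (Finset.range (j + 1)).image (backward s j v) → x < 5 * n := by
      simp only [Finset.mem_image, Finset.mem_range]
      rintro ⟨t, ht, rfl⟩
      exact hb t (by omega)
    change x < 5 * n ∧ ((loop 1 5 flipBody).den O s).nat 8 0 x ≠ 0 ↔ _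
    rw [h1]
    by_cases hT : x ∈ (Finset.range (j + 1)).image (backward s j v)
    · simp only [hT, h3 hT, true_and, not_true, and_false, iff_false, false_or]
    · simp only [hT, not_false_eq_true, iff_true, and_true, false_and, or_false]
  · simp [hv, backward]
  rintro i s1 hi hf hc ⟨h1, h2⟩
  have h19 : s1.nat 19 0 0 = j := by rw [hf.nat 19 rfl (by decide), hj]
  have h17 : s1.nat 17 = s.nat 17 := hf.nat 17 rfl (by decide)
  by_cases hij : i ≤ j
  · have h20 := h1 (by omega)
    rw [flipBody, den_ite_pos O (by simp [hc, h19, hij])]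
    refine ⟨fun _ => by simp [hc, h19, h17, h20, backward], fun x => ?_⟩
    have hex : (∃ t < i + 1, t ≤ j ∧ backward s j v t = x) ↔
        (∃ t < i, t ≤ j ∧ backward s j v t = x) ∨ backward s j v i = x := by
      constructor
      · rintro ⟨t, ht, htj, h⟩
        rcases Nat.lt_succ_iff_lt_or_eq.1 ht with ht | rfl
        · exact Or.inl ⟨t, ht, htj, h⟩
        · exact Or.inr h
      · rintro (⟨t, ht, htj, h⟩ | h)
        · exact ⟨t, by omega, htj, h⟩
        · exact ⟨i, by omega, hij, h⟩
    rw [hex]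
    by_cases hx : x = backward s j v i
    · have h3 := h2 x
      have h4 : ¬ ∃ t < i, t ≤ j ∧ backward s j v t = x := by
        rintro ⟨t, ht, htj, h⟩
        rw [hx] at h
        exact ht.ne (hinj (Set.mem_Iic.2 htj) (Set.mem_Iic.2 hij) h)
      have h5 : (s1.nat 8 0 x ≠ 0) ↔ s.nat 8 0 x ≠ 0 := h3.trans (iff_true_right h4)
      have h6 : (((set0 8 (var 20) (.sub (.const 1) (at0 8 (var 20))) ;;
          setVar 20 (.read 17 (.sub (var 19) (ctr 1)) (var 20))).den O s1).writeNat 3 0 1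
            (i + 1)).nat 8 0 x = 1 - s1.nat 8 0 x := by
        simp [h20, hx]
      rw [h6]
      have h7 : 1 - s1.nat 8 0 x ≠ 0 ↔ ¬ (s1.nat 8 0 x ≠ 0) := by omega
      rw [h7, h5]
      simp only [hx.symm, or_true, not_true, iff_false]
    · have h6 : (((set0 8 (var 20) (.sub (.const 1) (at0 8 (var 20))) ;;
          setVar 20 (.read 17 (.sub (var 19) (ctr 1)) (var 20))).den O s1).writeNat 3 0 1
            (i + 1)).nat 8 0 x = s1.nat 8 0 x := by
        simp [h20, hx]
      have h8 : ¬ backward s j v i = x := fun h => hx h.symm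
      rw [h6, h2]
      simp only [h8, or_false]
  · rw [flipBody, den_ite_neg O (by simpa [hc, h19] using hij)]
    refine ⟨fun h => by omega, fun x => ?_⟩
    rw [den_skip, writeNat_nat_of_ne _ _ _ _ _ _ (by decide), h2]
    have hex : (∃ t < i + 1, t ≤ j ∧ backward s j v t = x) ↔
        (∃ t < i, t ≤ j ∧ backward s j v t = x) := by
      constructor
      · rintro ⟨t, ht, htj, h⟩
        exact ⟨t, by omega, htj, h⟩
      · rintro ⟨t, ht, htj, h⟩
        exact ⟨t, by omega, htj, h⟩
    rw [hex]

end Cmd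

end OracleRAM

/-! ### Maximum-weight common independent sets by successive shortest walks -/

namespace OracleRAM

namespace Cmd

variable {n : ℕ}

/-- Search for a shortest walk from a source to a sink in the exchange graph of the current set. -/
def searchWalk : Cmd :=
  buildArcs ;; buildEnds ;; buildLen ;; initTable ;; fillTable ;; select

theorem buildArcs_writesNat {A : ℕ} (hA : A ∉ [3, 9, 10, 11, 12, 13]) :
    buildArcs.writesNat A = false := by
  simp only [List.mem_cons, List.not_mem_nil, or_false, not_or] at hA
  obtain ⟨h3, h9, h10, h11, h12, h13⟩ := hA
  simp [buildArcs, writesNat, arcBody_writesNat h3 h9 h10 h11 h12 h13, h3]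

theorem buildEnds_writesNat {A : ℕ} (hA : A ∉ [3, 9, 10, 11, 12, 14, 15]) :
    buildEnds.writesNat A = false := by
  simp only [List.mem_cons, List.not_mem_nil, or_false, not_or] at hA
  obtain ⟨h3, h9, h10, h11, h12, h14, h15⟩ := hA
  simp [buildEnds, writesNat, endBody_writesNat h3 h9 h10 h11 h12 h14 h15, h3]

theorem probe_writesReal {j : Fin 2} {F dy dx A : ℕ} : (probe j F dy dx).writesReal A = false := by
  simp [probe, testSlots, copyRow, clearRow, markSlots, greedy, checkSpanning, writesReal]

theorem probe_wf {j : Fin 2} {F dy dx : ℕ} : (probe j F dy dx).wf = true := by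
  simp [probe, testSlots, copyRow, clearRow, markSlots, greedy, checkSpanning, wf, usesCtr,
    writesNat]

theorem buildArcs_writesReal {A : ℕ} : buildArcs.writesReal A = false := by
  simp [buildArcs, arcBody, writesReal, probe_writesReal]

theorem buildEnds_writesReal {A : ℕ} : buildEnds.writesReal A = false := by
  simp [buildEnds, endBody, writesReal, probe_writesReal]

theorem searchWalk_writesNat {A : ℕ}
    (hA : A ∉ [3, 9, 10, 11, 12, 13, 14, 15, 16, 17, 18, 19, 20]) :
    searchWalk.writesNat A = false := by
  have h1 : buildArcs.writesNat A = false := buildArcs_writesNat fun h => hA (by simp at h ⊢; omega)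
  have h2 : buildEnds.writesNat A = false := buildEnds_writesNat fun h => hA (by simp at h ⊢; omega)
  simp only [List.mem_cons, List.not_mem_nil, or_false, not_or] at hA
  simp [searchWalk, writesNat, h1, h2, buildLen, initTable, fillTable, relax, select, selectBody]
  omega

theorem searchWalk_writesReal {A : ℕ} (hA : A ∉ [2, 3, 6]) :
    searchWalk.writesReal A = false := by
  simp only [List.mem_cons, List.not_mem_nil, or_false, not_or] at hA
  simp [searchWalk, writesReal, buildArcs_writesReal, buildEnds_writesReal, buildLen, initTable,
    fillTable, relax, select, selectBody]
  omega

theorem searchWalk_wf : searchWalk.wf = true := by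
  simp [searchWalk, wf, buildArcs, arcBody, probe_wf, buildEnds, endBody, buildLen, initTable,
    fillTable, relax, select, selectBody, usesCtr, writesNat, probe_usesCtr, probe_writesNat]

theorem searchWalk_usesCtr : searchWalk.usesCtr 0 = false := by
  simp [searchWalk, buildArcs, arcBody, buildEnds, endBody, buildLen, initTable,
    fillTable, relax, select, selectBody, usesCtr, probe_usesCtr]

variable {M : Fin 2 → Matroid (Fin n)} {L R : Matroid ℕ}

theorem searchWalk_spec (hM : ∀ j, (M j).E = Set.univ) (s : Store) (hs : Ready n s)
    (hr : Represents M L R s) (hL : L.E ⊆ Finset.range (5 * n)) (hR : R.E ⊆ Finset.range (5 * n))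
    {I : Finset ℕ} (hI : members n s 8 = I) (hext : IsExtremeCommon L R (s.real 1 0) I) {s' : Store}
    (hs' : searchWalk.den (fun j => (M j).Indep) s = s') :
    (s'.nat 18 0 0 = 0 → ∀ l v r, DiWalk (AugSource L I) (ExchangeArc L R I)
      (exchangeLen (s.real 1 0) I) l v r → ¬ AugSource R I v) ∧
    (s'.nat 18 0 0 ≠ 0 → s'.nat 19 0 0 < 5 * n ∧
      IsShortestPath (AugSource L I) (AugSource R I) (ExchangeArc L R I)
        (exchangeLen (s.real 1 0) I)
        (fun i => backward s' (s'.nat 19 0 0) (s'.nat 20 0 0) (s'.nat 19 0 0 - i))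
        (s'.nat 19 0 0) ∧
      ∀ t ≤ s'.nat 19 0 0, backward s' (s'.nat 19 0 0) (s'.nat 20 0 0) t < 5 * n) := by
  obtain ⟨φ, hφ⟩ := hext.exists_potential
  set ℓ := exchangeLen (s.real 1 0) I with hℓ
  have hIn : ∀ x ∈ I, x < 5 * n := fun x hx => (mem_members.1 (hI ▸ hx)).1
  have hLn : ∀ {v : ℕ} {X : Set ℕ}, L.Indep (insert v X) → v < 5 * n := fun h =>
    Finset.mem_range.1 (hL (h.subset_ground (Set.mem_insert _ _)))
  have hRn : ∀ {v : ℕ} {X : Set ℕ}, R.Indep (insert v X) → v < 5 * n := fun h =>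
    Finset.mem_range.1 (hR (h.subset_ground (Set.mem_insert _ _)))
  have hS : ∀ v, AugSource L I v → v < 5 * n := fun v h => hLn h.2
  have hA : ∀ u v, ExchangeArc L R I u v → u < 5 * n ∧ v < 5 * n := by
    rintro u v (⟨hu, hv, h⟩ | ⟨hu, hv, h⟩)
    · exact ⟨hRn h, hIn v hv⟩
    · exact ⟨hIn u hu, hLn h⟩
  set O : Oracles n := fun j => (M j).Indep with hO
  set s1 := buildArcs.den O s with hs1
  set s2 := buildEnds.den O s1 with hs2
  set s3 := buildLen.den O s2 with hs3
  set s4 := initTable.den O s3 with hs4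
  set s5 := fillTable.den O s4 with hs5
  have h_end : s' = select.den O s5 := hs'.symm
  have e1 : ∀ A, A ∉ [3, 9, 10, 11, 12, 13] → s1.nat A = s.nat A := fun A h =>
    den_nat_of_not_writesNat O _ (buildArcs_writesNat h) s
  have e2 : ∀ A, A ∉ [3, 9, 10, 11, 12, 14, 15] → s2.nat A = s1.nat A := fun A h =>
    den_nat_of_not_writesNat O _ (buildEnds_writesNat h) s1
  have e3 : ∀ A, A ≠ 3 → s3.nat A = s2.nat A := fun A h =>
    den_nat_of_not_writesNat O _ (by simpa [buildLen, writesNat] using h) s2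
  have e4 : ∀ A, A ∉ [3, 16] → s4.nat A = s3.nat A := fun A h =>
    den_nat_of_not_writesNat O _ (by
      simp at h
      simp [initTable, writesNat]
      omega) s3
  have e5 : ∀ A, A ∉ [3, 16, 17] → s5.nat A = s4.nat A := fun A h =>
    den_nat_of_not_writesNat O _ (by
      simp at h
      simp [fillTable, writesNat, relax]
      omega) s4
  have e6 : ∀ A, A ∉ [3, 18, 19, 20] → s'.nat A = s5.nat A := fun A h => by
    rw [h_end]
    exact den_nat_of_not_writesNat O _ (by
      simp at h
      simp [select, selectBody, writesNat]
      omega) s5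
  have n1 : s1.nat 0 0 0 = n := by rw [e1 0 (by decide), hs.size]
  have n2 : s2.nat 0 0 0 = n := by rw [e2 0 (by decide), n1]
  have n3 : s3.nat 0 0 0 = n := by rw [e3 0 (by decide), n2]
  have n4 : s4.nat 0 0 0 = n := by rw [e4 0 (by decide), n3]
  have n5 : s5.nat 0 0 0 = n := by rw [e5 0 (by decide), n4]
  have r2 : ∀ A, s2.real A = s.real A := fun A => by
    rw [hs2, den_real_of_not_writesReal O _ buildEnds_writesReal, hs1,
      den_real_of_not_writesReal O _ buildArcs_writesReal]
  have r6 : s'.real 2 = s5.real 2 := by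
    rw [h_end]
    exact den_real_of_not_writesReal O _ rfl s5
  have hends := buildEnds_spec hM s1 (hs.congr (e1 0 (by decide)) (e1 4 (by decide))
    (e1 6 (by decide)) (e1 7 (by decide))) (hr.congr (e1 4 (by decide)) (e1 6 (by decide))
    (e1 7 (by decide)))
  rw [members_congr (e1 8 (by decide)), hI] at hends
  have harc : ∀ u < 5 * n, ∀ v < 5 * n, s4.nat 13 u v ≠ 0 ↔ ExchangeArc L R I u v := by
    intro u hu v hv
    rw [e4 13 (by decide), e3 13 (by decide), e2 13 (by decide), hs1,
      buildArcs_spec hM s hs hr u v hu hv, hI]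
  have h8 : members n s2 8 = I := by
    rw [members_congr (e2 8 (by decide)), members_congr (e1 8 (by decide)), hI]
  have hlen3 : ∀ v < 5 * n, s3.real 6 0 v = ℓ v := by
    intro v hv
    rw [hs3, buildLen_spec O s2 n2 v hv, r2, h8]
  have hlen4 : ∀ v < 5 * n, s4.real 6 0 v = ℓ v := by
    intro v hv
    rw [hs4, den_real_of_not_writesReal O _ rfl, hlen3 v hv]
  have hrow0 : RowOK n (AugSource L I) (ExchangeArc L R I) ℓ s4 0 := by
    intro v hv
    obtain ⟨h1, h2⟩ := initTable_spec O s3 n3 v hv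
    rw [hs4, h1, h2, hlen3 v hv, e3 14 (by decide), (hends v hv).1]
    refine ⟨⟨fun h => ⟨_, .start h⟩, ?_⟩, fun h => ⟨.start h, ?_⟩⟩
    · rintro ⟨r, hw⟩
      cases hw with
      | start h => exact h
    · intro r hw
      cases hw
      exact le_rfl
  obtain ⟨hrows, hentries⟩ := fillTable_spec O hA s4 n4 harc hlen4 hrow0
  rw [← hs5] at hrows hentries
  have hsel := select_spec O s5 n5
  rw [← h_end] at hsel
  obtain ⟨hf, hsel⟩ := hsel
  have h15 : ∀ v < 5 * n, s5.nat 15 0 v ≠ 0 ↔ AugSource R I v := by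
    intro v hv
    rw [e5 15 (by decide), e4 15 (by decide), e3 15 (by decide), (hends v hv).2]
  constructor
  · intro h18 l v r hw hT
    have hv : v < 5 * n := hRn hT.2
    obtain ⟨l', r', h1, -, -, h4⟩ := hw.exists_lt_card hφ (E := Finset.range (5 * n))
      (fun v h => Finset.mem_range.2 (hS v h)) (fun u v h => Finset.mem_range.2 (hA u v h).2)
    rw [Finset.card_range] at h1
    exact hf.2 ⟨l', v, ⟨h1, hv⟩, (hrows l' h1.le v hv).1.2 ⟨r', h4⟩, (h15 v hv).2 hT⟩ h18
  · intro h18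
    obtain ⟨⟨hj, hv⟩, ⟨hc1, hc2⟩, hd, hmin⟩ := hsel h18
    rw [hd] at hmin
    have hrows' : ∀ j ≤ 5 * n, RowOK n (AugSource L I) (ExchangeArc L R I) ℓ s' j := fun j hj =>
      (hrows j hj).congr (by rw [e6 16 (by decide)]) (by rw [r6])
    have hentries' : ∀ j < 5 * n, ∀ v < 5 * n,
        EntryOK n (ExchangeArc L R I) ℓ s' j v (5 * n) := fun j hj v hv =>
      (hentries j hj v hv).congr (by rw [e6 16 (by decide)]) (by rw [r6])
        (by rw [e6 16 (by decide)]) (by rw [e6 17 (by decide)]) (by rw [r6])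
    refine ⟨hj, isShortestPath_backward hφ hS (fun u v h => (hA u v h).2) hrows' hentries' hj hv
      (by rwa [e6 16 (by decide)]) ((h15 _ hv).1 hc2) ?_⟩
    intro j' v' hj' hv' h16 hT
    rw [e6 16 (by decide)] at h16
    rw [r6]
    exact hmin j' v' ⟨hj', hv'⟩ ⟨h16, (h15 v' hv').2 hT⟩

/-- Compute the weight of the current set. -/
def weigh : Cmd :=
  setReal 5 (.const 0) (.const 0) .zero ;;
  loop 1 5 (when (nonZero (at0 8 (ctr 1)))
    (setReal 5 (.const 0) (.const 0) (.add (.read 5 (.const 0) (.const 0))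
      (.read 1 (.const 0) (ctr 1)))))

theorem weigh_spec (O : Oracles n) (s : Store) (hn : s.nat 0 0 0 = n) :
    (weigh.den O s).real 5 0 0 = ∑ x ∈ members n s 8, s.real 1 0 x := by
  set s0 := s.writeReal 5 0 0 0 with hs0
  have key := den_loop_frame O (d := 1) (K := 5) (p := when (nonZero (at0 8 (ctr 1)))
    (setReal 5 (.const 0) (.const 0) (.add (.read 5 (.const 0) (.const 0))
      (.read 1 (.const 0) (ctr 1))))) rfl (s := s0)
    (fun i s' => s'.real 5 0 0 = ∑ x ∈ (Finset.range i).filter (s.nat 8 0 · ≠ 0), s.real 1 0 x)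
    ?_ ?_
  · rw [show s0.nat 0 0 0 = n from hn] at key
    exact key
  · simp [hs0]
  intro i s1 hi hf hc hP
  have h8 : s1.nat 8 = s.nat 8 := by rw [hf.nat 8 rfl (by decide), hs0, writeReal_nat]
  have h1 : s1.real 1 = s.real 1 := by
    rw [hf.real 1 rfl, hs0, writeReal_real_of_ne _ _ _ _ _ _ (by decide)]
  rw [Finset.range_add_one, Finset.filter_insert]
  by_cases h : s.nat 8 0 i = 0
  · rw [den_ite_neg O (by simp [hc, h8, h]), if_neg (by simpa using h)]
    simpa using hP
  · rw [den_ite_pos O (by simp [hc, h8, h]), if_pos h, Finset.sum_insert (by simp)]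
    simp [hc, h1, hP, add_comm]

/-- Replace the stored best set by the current set if the current set has larger weight. -/
def keepBest : Cmd :=
  when (.not (.realLe (.read 5 (.const 0) (.const 0)) (.read 4 (.const 0) (.const 0))))
    (copyRow 1 5 21 8 ;; setReal 4 (.const 0) (.const 0) (.read 5 (.const 0) (.const 0)))

theorem keepBest_spec (O : Oracles n) (s : Store) (hn : s.nat 0 0 0 = n) :
    (keepBest.den O s).real 4 0 0 = max (s.real 4 0 0) (s.real 5 0 0) ∧
    (s.real 5 0 0 ≤ s.real 4 0 0 → members n (keepBest.den O s) 21 = members n s 21) ∧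
    (¬ s.real 5 0 0 ≤ s.real 4 0 0 → members n (keepBest.den O s) 21 = members n s 8) := by
  by_cases h : s.real 5 0 0 ≤ s.real 4 0 0
  · rw [keepBest, den_ite_neg O (by simpa using h)]
    exact ⟨by simp [h], fun _ => rfl, fun h' => absurd h h'⟩
  · rw [keepBest, den_ite_pos O (by simpa using h), den_seq]
    have hreal : ((copyRow 1 5 21 8).den O s).real 5 = s.real 5 :=
      den_real_of_not_writesReal O _ rfl s
    refine ⟨?_, fun h' => absurd h' h, fun _ => ?_⟩
    · simp [hreal, (not_le.1 h).le]
    · ext x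
      rw [mem_members, mem_members, den_setReal, writeReal_nat, copyRow_spec (by decide)
        (by decide) (by decide) (by decide), hn]
      by_cases hx : x < 5 * n <;> simp [hx]

/-- One round of the algorithm: augment the current set along a shortest walk, and keep the best of
all sets found so far in the row `21[0]`. -/
def round : Cmd :=
  searchWalk ;;
  when (nonZero (var 18))
    (flip ;; weigh ;; keepBest)

/-- The current set is extreme, it has at least `t` elements unless it is a largest common
independent set, and the stored best set is at least as good as all common independent sets that
are not larger than the current set. -/
structure RoundOK (n : ℕ) (M : Fin 2 → Matroid (Fin n)) (L R : Matroid ℕ) (wt : ℕ → ℝ) (t : ℕ)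
    (s : Store) : Prop where
  ready : Ready n s
  rep : Represents M L R s
  weight : s.real 1 0 = wt
  extreme : IsExtremeCommon L R wt (members n s 8)
  card : t ≤ (members n s 8).card ∨
    ∀ K : Finset ℕ, L.Indep K → R.Indep K → K.card ≤ (members n s 8).card
  bestL : L.Indep (members n s 21)
  bestR : R.Indep (members n s 21)
  bestSum : s.real 4 0 0 = ∑ x ∈ members n s 21, wt x
  best : ∀ K : Finset ℕ, L.Indep K → R.Indep K → K.card ≤ (members n s 8).card →
    ∑ x ∈ K, wt x ≤ s.real 4 0 0

theorem RoundOK.congr {wt : ℕ → ℝ} {t : ℕ} {s s' : Store} (h : RoundOK n M L R wt t s)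
    (h0 : s'.nat 0 = s.nat 0) (h4 : s'.nat 4 = s.nat 4) (h6 : s'.nat 6 = s.nat 6)
    (h7 : s'.nat 7 = s.nat 7) (h8 : s'.nat 8 = s.nat 8) (h21 : s'.nat 21 = s.nat 21)
    (r1 : s'.real 1 = s.real 1) (r4 : s'.real 4 = s.real 4) : RoundOK n M L R wt t s' := by
  have h1 : members n s' 8 = members n s 8 := members_congr h8
  have h2 : members n s' 21 = members n s 21 := members_congr h21
  exact ⟨h.ready.congr h0 h4 h6 h7, h.rep.congr h4 h6 h7, by rw [r1, h.weight],
    by rw [h1]; exact h.extreme, by rw [h1]; exact h.card, by rw [h2]; exact h.bestL,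
    by rw [h2]; exact h.bestR, by rw [h2, r4]; exact h.bestSum, by rw [h1, r4]; exact h.best⟩

theorem round_writesNat {A : ℕ}
    (hA : A ∉ [3, 8, 9, 10, 11, 12, 13, 14, 15, 16, 17, 18, 19, 20, 21]) :
    round.writesNat A = false := by
  have h1 : searchWalk.writesNat A = false :=
    searchWalk_writesNat fun h => hA (by simp at h ⊢; omega)
  simp only [List.mem_cons, List.not_mem_nil, or_false, not_or] at hA
  simp [round, writesNat, h1, flip, flipBody, weigh, keepBest, copyRow]
  omega

theorem round_wf : round.wf = true := by
  simp [round, wf, searchWalk_wf, flip, flipBody, weigh, keepBest, copyRow, usesCtr, writesNat]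

theorem round_usesCtr : round.usesCtr 0 = false := by
  simp [round, searchWalk_usesCtr, flip, flipBody, weigh, keepBest, copyRow, usesCtr]

set_option maxHeartbeats 400000 in
theorem round_spec (hM : ∀ j, (M j).E = Set.univ) (hL : L.E ⊆ Finset.range (5 * n))
    (hR : R.E ⊆ Finset.range (5 * n)) {wt : ℕ → ℝ} {t : ℕ} (s : Store)
    (h : RoundOK n M L R wt t s) :
    RoundOK n M L R wt (t + 1) (round.den (fun j => (M j).Indep) s) := by
  set O : Oracles n := fun j => (M j).Indep with hO
  set s1 := searchWalk.den O s with hs1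
  set I := members n s 8 with hI
  have e1 : ∀ A, A ∉ [3, 9, 10, 11, 12, 13, 14, 15, 16, 17, 18, 19, 20] →
      s1.nat A = s.nat A := fun A h => den_nat_of_not_writesNat O _ (searchWalk_writesNat h) s
  have r1 : ∀ A, A ∉ [2, 3, 6] → s1.real A = s.real A := fun A h =>
    den_real_of_not_writesReal O _ (searchWalk_writesReal h) s
  have h1 : RoundOK n M L R wt t s1 := h.congr (e1 0 (by decide)) (e1 4 (by decide))
    (e1 6 (by decide)) (e1 7 (by decide)) (e1 8 (by decide)) (e1 21 (by decide)) (r1 1 (by decide))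
    (r1 4 (by decide))
  have hI1 : members n s1 8 = I := members_congr (e1 8 (by decide))
  obtain ⟨hno, hyes⟩ := searchWalk_spec hM s h.ready h.rep hL hR rfl
    (by rw [h.weight]; exact h.extreme) hs1.symm
  rw [← hI] at hno hyes
  rw [round, den_seq, ← hs1]
  obtain ⟨c, hcL, hcR⟩ := h.extreme
  by_cases h18 : s1.nat 18 0 0 = 0
  · rw [den_ite_neg O (by simp [h18]), den_skip]
    refine { h1 with card := Or.inr fun K hKL hKR => ?_ }
    rw [hI1]
    exact card_le_of_no_walk hcL.1 hcR.1 (hno h18) hKL hKR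
  · rw [den_ite_pos O (by simp [h18])]
    obtain ⟨hj, hpath, hb⟩ := hyes h18
    rw [h.weight] at hpath
    set j := s1.nat 19 0 0 with hjdef
    set v := s1.nat 20 0 0 with hvdef
    obtain ⟨hinj, hext, hcard⟩ := h.extreme.augment hL hR hpath
    have himg : (Finset.range (j + 1)).image (fun i => backward s1 j v (j - i)) =
        (Finset.range (j + 1)).image (backward s1 j v) := by
      ext x
      simp only [Finset.mem_image, Finset.mem_range]
      constructor
      · rintro ⟨i, hi, rfl⟩
        exact ⟨j - i, by omega, rfl⟩
      · rintro ⟨i, hi, rfl⟩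
        exact ⟨j - i, by omega, by rw [show j - (j - i) = i by omega]⟩
    have hinj' : Set.InjOn (backward s1 j v) (Set.Iic j) := by
      intro a ha b hb heq
      rw [Set.mem_Iic] at ha hb
      have := hinj (Set.mem_Iic.2 (Nat.sub_le j a)) (Set.mem_Iic.2 (Nat.sub_le j b)) (by
        simpa [Nat.sub_sub_self ha, Nat.sub_sub_self hb] using heq)
      omega
    set s2 := flip.den O s1 with hs2
    have h8 : members n s2 8 = symmDiff I ((Finset.range (j + 1)).image
        (fun i => backward s1 j v (j - i))) := by
      rw [hs2, flip_spec O s1 h1.ready.size rfl rfl hj hb hinj', hI1, himg]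
    set I' := symmDiff I ((Finset.range (j + 1)).image (fun i => backward s1 j v (j - i))) with hI'
    set s3 := weigh.den O s2 with hs3
    have e2 : ∀ A, A ∉ [3, 8, 20] → s2.nat A = s1.nat A := fun A h =>
      den_nat_of_not_writesNat O _ (by
        simp at h
        simp [flip, flipBody, writesNat]
        omega) s1
    have r2 : ∀ A, s2.real A = s1.real A := fun A => den_real_of_not_writesReal O _ rfl s1
    have e3 : ∀ A, A ≠ 3 → s3.nat A = s2.nat A := fun A h =>
      den_nat_of_not_writesNat O _ (by simpa [weigh, writesNat] using h) s2
    have r3 : ∀ A, A ≠ 5 → s3.real A = s2.real A := fun A h =>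
      den_real_of_not_writesReal O _ (by simpa [weigh, writesReal] using h.symm) s2
    have hn3 : s3.nat 0 0 0 = n := by
      rw [e3 0 (by decide), e2 0 (by decide), h1.ready.size]
    have h53 : s3.real 5 0 0 = ∑ x ∈ I', wt x := by
      rw [hs3, weigh_spec O s2 (by rw [e2 0 (by decide), h1.ready.size]), h8, r2, h1.weight]
    have h83 : members n s3 8 = I' := by rw [members_congr (e3 8 (by decide)), h8]
    have h213 : members n s3 21 = members n s 21 := by
      rw [members_congr (e3 21 (by decide)), members_congr (e2 21 (by decide)),
        members_congr (e1 21 (by decide))]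
    have h43 : s3.real 4 = s.real 4 := by rw [r3 4 (by decide), r2, r1 4 (by decide)]
    have hready : Ready n s3 := h1.ready.congr
      (by rw [e3 0 (by decide), e2 0 (by decide)]) (by rw [e3 4 (by decide), e2 4 (by decide)])
      (by rw [e3 6 (by decide), e2 6 (by decide)]) (by rw [e3 7 (by decide), e2 7 (by decide)])
    have hrep : Represents M L R s3 := h1.rep.congr
      (by rw [e3 4 (by decide), e2 4 (by decide)]) (by rw [e3 6 (by decide), e2 6 (by decide)])
      (by rw [e3 7 (by decide), e2 7 (by decide)])
    have hw3 : s3.real 1 0 = wt := by rw [r3 1 (by decide), r2, h1.weight]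
    have hcard' : t + 1 ≤ I'.card ∨ ∀ K : Finset ℕ, L.Indep K → R.Indep K → K.card ≤ I'.card := by
      rw [hcard]
      rcases h.card with hc | hc
      · exact Or.inl (by omega)
      · exact Or.inr fun K h1 h2 => (hc K h1 h2).trans (Nat.le_succ _)
    have hbest : ∀ K : Finset ℕ, L.Indep K → R.Indep K → K.card ≤ I'.card →
        ∑ x ∈ K, wt x ≤ s.real 4 0 0 ∨ ∑ x ∈ K, wt x ≤ ∑ x ∈ I', wt x := by
      intro K hKL hKR hK
      rw [hcard] at hK
      rcases Nat.lt_succ_iff_lt_or_eq.1 (Nat.lt_succ_of_le hK) with hK | hK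
      · exact Or.inl (h.best K hKL hKR (Nat.le_of_lt_succ hK))
      · exact Or.inr (hext.sum_le hKL hKR (hK.trans hcard.symm))
    rw [den_seq, den_seq, ← hs2, ← hs3]
    obtain ⟨hk1, hk2, hk3⟩ := keepBest_spec O s3 hn3
    have e4 : ∀ A, A ≠ 3 → A ≠ 21 → (keepBest.den O s3).nat A = s3.nat A := fun A h h' =>
      den_nat_of_not_writesNat O _ (by simp [keepBest, copyRow, writesNat, h, h'.symm]) s3
    have r4 : (keepBest.den O s3).real 1 = s3.real 1 := den_real_of_not_writesReal O _ rfl s3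
    rw [h43, h53] at hk1 hk2 hk3
    rw [h213] at hk2
    rw [h83] at hk3
    have h84 : members n (keepBest.den O s3) 8 = I' := by
      rw [members_congr (e4 8 (by decide) (by decide)), h83]
    generalize keepBest.den O s3 = s4 at hk1 hk2 hk3 e4 r4 h84 ⊢
    obtain ⟨c', hcL', hcR'⟩ := hext
    have h214 : L.Indep (members n s4 21) ∧ R.Indep (members n s4 21) ∧
        s4.real 4 0 0 = ∑ x ∈ members n s4 21, wt x := by
      by_cases hle : ∑ x ∈ I', wt x ≤ s.real 4 0 0
      · rw [hk1, hk2 hle, max_eq_left hle]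
        exact ⟨h.bestL, h.bestR, h.bestSum⟩
      · rw [hk1, hk3 hle, max_eq_right (not_le.1 hle).le]
        exact ⟨hcL'.1, hcR'.1, rfl⟩
    exact ⟨hready.congr (e4 0 (by decide) (by decide)) (e4 4 (by decide) (by decide))
      (e4 6 (by decide) (by decide)) (e4 7 (by decide) (by decide)),
      hrep.congr (e4 4 (by decide) (by decide)) (e4 6 (by decide) (by decide))
      (e4 7 (by decide) (by decide)), by rw [r4, hw3], by rw [h84]; exact ⟨c', hcL', hcR'⟩,
      by rwa [h84], h214.1, h214.2.1, h214.2.2, by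
        rw [h84, hk1]
        exact fun K hKL hKR hK => le_max_iff.2 (hbest K hKL hKR hK)⟩

attribute [irreducible] round

/-- Compute a common independent set of maximum weight in the row `21[0]`. -/
def optimize : Cmd := loop 0 5 round

theorem optimize_writesNat {A : ℕ}
    (hA : A ∉ [3, 8, 9, 10, 11, 12, 13, 14, 15, 16, 17, 18, 19, 20, 21]) :
    optimize.writesNat A = false := by
  have h3 : A ≠ 3 := fun h => hA (by simp [h])
  simp [optimize, writesNat, round_writesNat hA, h3]

theorem optimize_wf : optimize.wf = true := by
  simp [optimize, wf, round_wf, round_usesCtr, round_writesNat]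

theorem optimize_spec (hM : ∀ j, (M j).E = Set.univ) (hL : L.E ⊆ Finset.range (5 * n))
    (hR : R.E ⊆ Finset.range (5 * n)) (s : Store) (hs : Ready n s) (hr : Represents M L R s)
    (h8 : members n s 8 = ∅) (h21 : members n s 21 = ∅) (h4 : s.real 4 0 0 = 0) {s' : Store}
    (hs' : optimize.den (fun j => (M j).Indep) s = s') :
    L.Indep (members n s' 21) ∧ R.Indep (members n s' 21) ∧
      ∀ K : Finset ℕ, L.Indep K → R.Indep K →
        ∑ x ∈ K, s.real 1 0 x ≤ ∑ x ∈ members n s' 21, s.real 1 0 x := by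
  have key := den_loop (fun j => (M j).Indep) (d := 0) (K := 5) (p := round)
    (round_writesNat (by decide)) (s := s)
    (fun t s' => RoundOK n M L R (s.real 1 0) t s') ?_ ?_
  · have h : RoundOK n M L R (s.real 1 0) (5 * s.nat 0 0 0) s' := hs' ▸ key
    rw [hs.size] at h
    refine ⟨h.bestL, h.bestR, fun K hKL hKR => ?_⟩
    rw [← h.bestSum]
    refine h.best K hKL hKR ?_
    rcases h.card with hc | hc
    · refine le_trans ?_ hc
      have := Finset.card_le_card (Finset.coe_subset.1 (hKL.subset_ground.trans hL))
      rwa [Finset.card_range] at this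
    · exact hc K hKL hKR
  · have h0 : RoundOK n M L R (s.real 1 0) 0 s := by
      refine ⟨hs, hr, rfl, ?_, Or.inl (Nat.zero_le _), ?_, ?_, ?_, ?_⟩
      · rw [h8]
        exact isExtremeCommon_empty
      · simp [h21]
      · simp [h21]
      · simp [h4, h21]
      · intro K _ _ hK
        rw [h8, Finset.card_empty, Nat.le_zero, Finset.card_eq_zero] at hK
        simp [hK, h4]
    exact h0.congr (by simp) (by simp) (by simp) (by simp) (by simp) (by simp) rfl rfl
  · intro i s' _ hP _ _
    exact (round_spec hM hL hR s' hP).congr (by simp) (by simp) (by simp) (by simp) (by simp)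
      (by simp) rfl rfl

attribute [irreducible] optimize

end Cmd

end OracleRAM

/-! ### Listing the edges and the elements -/

namespace OracleRAM

namespace Cmd

variable {n : ℕ}

/-- Store the slots `l` and `r` and the weight of the element number `N + i`, where `N` is the
current number of elements; its edge joins `ctr 1` and `ctr 2`. -/
def addElem (i : ℕ) (l r : NatExpr) : Cmd :=
  set0 6 (.add (var 4) (.const i)) l ;; set0 7 (.add (var 4) (.const i)) r ;;
    setReal 1 (.const 0) (.add (var 4) (.const i)) (.read 0 (ctr 1) (ctr 2))

/-- Append the edge between `ctr 1` and `ctr 2` to the list of edges, with its five elements. -/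
def addEdge : Cmd :=
  addElem 0 (ctr 1) (.add (var 0) (var 5)) ;; addElem 1 (ctr 2) (.add (var 0) (var 5)) ;;
  addElem 2 (.add (var 0) (var 5)) (ctr 1) ;; addElem 3 (.add (var 0) (var 5)) (ctr 2) ;;
  addElem 4 (.add (var 0) (var 5)) (.add (var 0) (var 5)) ;;
  setVar 4 (.add (var 4) (.const 5)) ;; setVar 5 (.add (var 5) (.const 1))

theorem addEdge_spec (O : Oracles n) (s : Store) {s' : Store} (hs' : addEdge.den O s = s') :
    s'.nat 4 0 0 = s.nat 4 0 0 + 5 ∧ s'.nat 5 0 0 = s.nat 5 0 0 + 1 ∧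
    (∀ x < s.nat 4 0 0, s'.nat 6 0 x = s.nat 6 0 x ∧ s'.nat 7 0 x = s.nat 7 0 x ∧
      s'.real 1 0 x = s.real 1 0 x) ∧
    ∀ r < 5,
      s'.nat 6 0 (s.nat 4 0 0 + r) = (if r = 0 then s.nat 3 0 1 else if r = 1 then s.nat 3 0 2 else
        s.nat 0 0 0 + s.nat 5 0 0) ∧
      s'.nat 7 0 (s.nat 4 0 0 + r) = (if r = 2 then s.nat 3 0 1 else if r = 3 then s.nat 3 0 2 else
        s.nat 0 0 0 + s.nat 5 0 0) ∧
      s'.real 1 0 (s.nat 4 0 0 + r) = s.real 0 (s.nat 3 0 1) (s.nat 3 0 2) := by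
  subst hs'
  refine ⟨by simp [addEdge, addElem], by simp [addEdge, addElem], fun x hx => ?_, fun r hr => ?_⟩
  · have h : ∀ i, x ≠ s.nat 4 0 0 + i := fun i => by omega
    have h0 : x ≠ s.nat 4 0 0 := by omega
    simp [addEdge, addElem, h, h0]
  · interval_cases r <;> simp [addEdge, addElem]

theorem addEdge_writesNat {A : ℕ} (hA : A ∉ [4, 5, 6, 7]) : addEdge.writesNat A = false := by
  simp at hA
  simp [addEdge, addElem, writesNat]
  omega

theorem addEdge_writesReal {A : ℕ} (hA : A ≠ 1) : addEdge.writesReal A = false := by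
  simp [addEdge, addElem, writesReal, hA.symm]

theorem addEdge_usesCtr {d : ℕ} : addEdge.usesCtr d = false := by
  simp [addEdge, addElem, usesCtr]

theorem addEdge_wf : addEdge.wf = true := by
  simp [addEdge, addElem, wf]

attribute [irreducible] addEdge

/-- Append the pair `ctr 1`, `ctr 2` to the list of edges if it is an edge. -/
def setupBody : Cmd :=
  when (.and (ltTest (ctr 1) (ctr 2)) (nonZero (.read 1 (ctr 1) (ctr 2)))) addEdge

/-- List the edges and the elements. -/
def setup : Cmd := loop 1 1 (loop 2 1 setupBody)

theorem setup_writesNat {A : ℕ} (hA : A ∉ [3, 4, 5, 6, 7]) : setup.writesNat A = false := by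
  have h : addEdge.writesNat A = false := addEdge_writesNat fun h => hA (by simp at h ⊢; omega)
  have h3 : A ≠ 3 := fun h => hA (by simp [h])
  simp [setup, setupBody, writesNat, h, h3]

theorem setup_writesReal {A : ℕ} (hA : A ≠ 1) : setup.writesReal A = false := by
  simp [setup, setupBody, writesReal, addEdge_writesReal hA]

theorem setup_wf : setup.wf = true := by
  simp [setup, setupBody, wf, usesCtr, addEdge_usesCtr, addEdge_wf, writesNat, addEdge_writesNat]

/-- The memory contains the elements of the edges `s(a e, b e)` for `e < m`. -/
structure Listed (a b : ℕ → Fin n) (m : ℕ) (ρ : ℕ → ℕ → ℝ) (s : Store) : Prop where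
  count : s.nat 5 0 0 = m
  elems : s.nat 4 0 0 = 5 * m
  left : ∀ x < 5 * m, s.nat 6 0 x = elemSlot a b 0 x
  right : ∀ x < 5 * m, s.nat 7 0 x = elemSlot a b 2 x
  weight : ∀ x < 5 * m, s.real 1 0 x = ρ (a (x / 5)) (b (x / 5))

theorem Listed.congr {a b : ℕ → Fin n} {m : ℕ} {ρ : ℕ → ℕ → ℝ} {s s' : Store}
    (h : Listed a b m ρ s) (h4 : s'.nat 4 = s.nat 4) (h5 : s'.nat 5 = s.nat 5)
    (h6 : s'.nat 6 = s.nat 6) (h7 : s'.nat 7 = s.nat 7) (r1 : s'.real 1 = s.real 1) :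
    Listed a b m ρ s' :=
  ⟨by rw [h5, h.count], by rw [h4, h.elems], by rw [h6]; exact h.left, by rw [h7]; exact h.right,
    by rw [r1]; exact h.weight⟩

theorem Listed.addEdge {a b : ℕ → Fin n} {m : ℕ} {ρ : ℕ → ℕ → ℝ} {s : Store} (O : Oracles n)
    (h : Listed a b m ρ s) (hn : s.nat 0 0 0 = n) {u v : Fin n} (hu : s.nat 3 0 1 = u)
    (hv : s.nat 3 0 2 = v) (hρ : s.real 0 = ρ) :
    Listed (Function.update a m u) (Function.update b m v) (m + 1) ρ (addEdge.den O s) := by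
  obtain ⟨h1, h2, h3, h4⟩ := addEdge_spec O s rfl
  rw [h.elems] at h1 h3 h4
  rw [h.count] at h2 h4
  rw [hn, hu, hv, hρ] at h4
  have hold : ∀ (p x : ℕ), x < 5 * m →
      elemSlot (Function.update a m u) (Function.update b m v) p x =
      elemSlot a b p x := by
    intro p x hx
    have : x / 5 ≠ m := by omega
    simp [elemSlot, this]
  have hsplit : ∀ x, x < 5 * (m + 1) → x < 5 * m ∨ ∃ r < 5, x = 5 * m + r := fun x hx => by
    by_cases hxm : x < 5 * m
    · exact Or.inl hxm
    · exact Or.inr ⟨x - 5 * m, by omega, by omega⟩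
  have hdiv : ∀ r < 5, (5 * m + r) / 5 = m := fun r hr => by omega
  have hmod : ∀ r < 5, (5 * m + r) % 5 = r := fun r hr => by omega
  refine ⟨h2, by rw [h1]; ring, fun x hx => ?_, fun x hx => ?_, fun x hx => ?_⟩
  · rcases hsplit x hx with hx | ⟨r, hr, rfl⟩
    · rw [(h3 x hx).1, hold 0 x hx, h.left x hx]
    · rw [(h4 r hr).1, elemSlot, hdiv r hr, hmod r hr]
      simp
  · rcases hsplit x hx with hx | ⟨r, hr, rfl⟩
    · rw [(h3 x hx).2.1, hold 2 x hx, h.right x hx]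
    · rw [(h4 r hr).2.1, elemSlot, hdiv r hr, hmod r hr]
      simp
  · rcases hsplit x hx with hx | ⟨r, hr, rfl⟩
    · have : x / 5 ≠ m := by omega
      rw [(h3 x hx).2.2, h.weight x hx]
      simp [this]
    · rw [(h4 r hr).2.2, hdiv r hr]
      simp

/-- The first `m` pairs `(a e, b e)` are the edges in the domain `D`, each listed once and with its
smaller vertex first. -/
structure ListsEdges (G : SimpleGraph (Fin n)) (D : Fin n → Fin n → Prop) (m : ℕ)
    (a b : ℕ → Fin n) : Prop where
  mem : ∀ e < m, a e < b e ∧ G.Adj (a e) (b e) ∧ D (a e) (b e)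
  inj : ∀ e < m, ∀ e' < m, a e = a e' → b e = b e' → e = e'
  surj : ∀ u v, u < v → G.Adj u v → D u v → ∃ e < m, a e = u ∧ b e = v

theorem ListsEdges.append {G : SimpleGraph (Fin n)} {D : Fin n → Fin n → Prop} {m : ℕ}
    {a b : ℕ → Fin n} (h : ListsEdges G D m a b) {u v : Fin n} (huv : u < v) (hadj : G.Adj u v)
    (hD : ¬ D u v) : ListsEdges G (fun p q => D p q ∨ (p = u ∧ q = v)) (m + 1)
      (Function.update a m u) (Function.update b m v) := by
  refine ⟨fun e he => ?_, fun e he e' he' h1 h2 => ?_, fun p q hpq hadj' hD' => ?_⟩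
  · rcases Nat.lt_succ_iff_lt_or_eq.1 he with he | rfl
    · have := h.mem e he
      simpa [he.ne] using ⟨this.1, this.2.1, Or.inl this.2.2⟩
    · simpa using ⟨huv, hadj⟩
  · rcases Nat.lt_succ_iff_lt_or_eq.1 he with he | rfl <;>
      rcases Nat.lt_succ_iff_lt_or_eq.1 he' with he' | rfl
    · simp only [Function.update_of_ne he.ne, Function.update_of_ne he'.ne] at h1 h2
      exact h.inj e he e' he' h1 h2
    · simp only [Function.update_of_ne he.ne, Function.update_self] at h1 h2
      exact absurd (h1 ▸ h2 ▸ (h.mem e he).2.2) hD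
    · simp only [Function.update_of_ne he'.ne, Function.update_self] at h1 h2
      exact absurd (h1 ▸ h2 ▸ (h.mem e' he').2.2) hD
    · rfl
  · rcases hD' with hD' | ⟨rfl, rfl⟩
    · obtain ⟨e, he, h1, h2⟩ := h.surj p q hpq hadj' hD'
      exact ⟨e, by omega, by simp [he.ne, h1], by simp [he.ne, h2]⟩
    · exact ⟨m, by omega, by simp, by simp⟩

theorem ListsEdges.of_iff {G : SimpleGraph (Fin n)} {D D' : Fin n → Fin n → Prop} {m : ℕ}
    {a b : ℕ → Fin n} (h : ListsEdges G D m a b)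
    (hD : ∀ u v, u < v → G.Adj u v → (D u v ↔ D' u v)) : ListsEdges G D' m a b := by
  refine ⟨fun e he => ?_, h.inj,
    fun u v huv hadj hD' => h.surj u v huv hadj ((hD u v huv hadj).2 hD')⟩
  obtain ⟨h1, h2, h3⟩ := h.mem e he
  exact ⟨h1, h2, (hD _ _ h1 h2).1 h3⟩

theorem ListsEdges.isEdgeList {G : SimpleGraph (Fin n)} {D : Fin n → Fin n → Prop} {m : ℕ}
    {a b : ℕ → Fin n} (h : ListsEdges G D m a b) (hD : ∀ u v, D u v) : IsEdgeList G m a b := by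
  refine ⟨fun e he => (h.mem e he).2.1, fun e he e' he' heq => ?_, fun u v hadj => ?_⟩
  · rw [Sym2.eq_iff] at heq
    rcases heq with ⟨h1, h2⟩ | ⟨h1, h2⟩
    · exact h.inj e he e' he' h1 h2
    · have h3 := (h.mem e he).1
      have h4 := (h.mem e' he').1
      rw [h1, h2] at h3
      exact absurd h3 h4.asymm
  · rcases lt_or_gt_of_ne hadj.ne with hlt | hlt
    · obtain ⟨e, he, rfl, rfl⟩ := h.surj u v hlt hadj (hD u v)
      exact ⟨e, he, rfl⟩
    · obtain ⟨e, he, rfl, rfl⟩ := h.surj v u hlt hadj.symm (hD v u)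
      exact ⟨e, he, Sym2.eq_swap⟩

theorem setup_spec (O : Oracles n) (G : SimpleGraph (Fin n)) (hpos : 0 < n) (s : Store)
    (hn : s.nat 0 0 0 = n) (h4 : s.nat 4 0 0 = 0) (h5 : s.nat 5 0 0 = 0)
    (hadj : ∀ u v : Fin n, s.nat 1 u v ≠ 0 ↔ G.Adj u v) :
    ∃ m a b, IsEdgeList G m a b ∧ Listed a b m (s.real 0) (setup.den O s) := by
  have key := den_loop_frame O (d := 1) (K := 1) (p := loop 2 1 setupBody)
    (by simp [setupBody, writesNat, addEdge_writesNat]) (s := s)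
    (fun i s' => ∃ m a b, ListsEdges G (fun u _ => (u : ℕ) < i) m a b ∧
      Listed a b m (s.real 0) s') ?_ ?_
  · rw [hn, one_mul] at key
    obtain ⟨m, a, b, h1, h2⟩ := key
    exact ⟨m, a, b, h1.isEdgeList fun u _ => u.2, h2⟩
  · refine ⟨0, fun _ => ⟨0, hpos⟩, fun _ => ⟨0, hpos⟩, ⟨by simp, by simp, by simp⟩,
      by simp [h5], by simp [h4], by simp, by simp, by simp⟩
  rintro i s1 hi hf1 hc1 ⟨m, a, b, hE, hLst⟩
  rw [hn, one_mul] at hi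
  have hn1 : s1.nat 0 0 0 = n := by
    rw [hf1.nat 0 (by simp [setupBody, writesNat, addEdge_writesNat]) (by decide), hn]
  have key2 := den_loop_frame O (d := 2) (K := 1) (p := setupBody)
    (by simp [setupBody, writesNat, addEdge_writesNat]) (s := s1)
    (fun k s' => ∃ m a b,
      ListsEdges G (fun u v => (u : ℕ) < i ∨ ((u : ℕ) = i ∧ (v : ℕ) < k)) m a b ∧
      Listed a b m (s.real 0) s') ?_ ?_
  · rw [hn1, one_mul] at key2
    obtain ⟨m, a, b, h1, h2⟩ := key2
    exact ⟨m, a, b, h1.of_iff fun u v _ _ => by have := v.2; omega,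
      h2.congr (by simp) (by simp) (by simp) (by simp) rfl⟩
  · exact ⟨m, a, b, hE.of_iff fun u v _ _ => by simp,
      hLst.congr (by simp) (by simp) (by simp) (by simp) rfl⟩
  rintro k s2 hk hf2 hc2 ⟨m, a, b, hE, hLst⟩
  rw [hn1, one_mul] at hk
  have hc12 : s2.nat 3 0 1 = i := by
    rw [hf2.ctr 1 (by simp [setupBody, usesCtr, addEdge_usesCtr]) (by decide), hc1]
  have hn2 : s2.nat 0 0 0 = n := by
    rw [hf2.nat 0 (by simp [setupBody, writesNat, addEdge_writesNat]) (by decide), hn1]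
  have h1 : s2.nat 1 = s.nat 1 := by
    rw [hf2.nat 1 (by simp [setupBody, writesNat, addEdge_writesNat]) (by decide),
      hf1.nat 1 (by simp [setupBody, writesNat, addEdge_writesNat]) (by decide)]
  have r0 : s2.real 0 = s.real 0 := by
    rw [hf2.real 0 (by simp [setupBody, writesReal, addEdge_writesReal]),
      hf1.real 0 (by simp [setupBody, writesReal, addEdge_writesReal])]
  set u : Fin n := ⟨i, hi⟩ with hu
  set v : Fin n := ⟨k, hk⟩ with hv
  have hadj' := hadj u v
  by_cases hc : i < k ∧ s.nat 1 i k ≠ 0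
  · rw [setupBody, den_ite_pos O (by simpa [hc12, hc2, h1] using hc)]
    refine ⟨m + 1, Function.update a m u, Function.update b m v,
      (hE.append (u := u) (v := v) hc.1 (hadj'.1 hc.2) (by simp [hu, hv])).of_iff ?_,
      (hLst.addEdge O hn2 (u := u) (v := v) hc12 hc2 r0).congr (by simp) (by simp) (by simp)
        (by simp) rfl⟩
    intro p q _ _
    rw [Fin.ext_iff, Fin.ext_iff]
    change _ ∨ ((p : ℕ) = i ∧ (q : ℕ) = k) ↔ _
    omega
  · rw [setupBody, den_ite_neg O (by simpa [hc12, hc2, h1] using hc), den_skip]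
    refine ⟨m, a, b, hE.of_iff ?_, hLst.congr (by simp) (by simp) (by simp) (by simp) rfl⟩
    intro p q hpq hadj1
    constructor
    · omega
    · rintro (h | ⟨h, h'⟩)
      · exact Or.inl h
      · refine Or.inr ⟨h, lt_of_le_of_ne (Nat.lt_succ_iff.1 h') fun hqk => hc ⟨?_, ?_⟩⟩
        · rw [← h, ← hqk]
          exact hpq
        · rw [← h, ← hqk]
          exact (hadj p q).2 hadj1

attribute [irreducible] setup

end Cmd

end OracleRAM

/-! ### Contracting the kept edges -/

namespace OracleRAM

/-- The state of one of the two matroids after the first `i` edges have been treated: `X` contains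
the endpoints assigned to kept edges, and every class of the labelling `lab` contains at most one
vertex outside `X`. -/
structure SideOK {n : ℕ} (a b : ℕ → Fin n) (p : ℕ) (I : Finset ℕ) (i : ℕ) (X : Set (Fin n))
    (lab : Fin n → ℕ) : Prop where
  sep : ∀ u v, u ∉ X → v ∉ X → lab u = lab v → u = v
  slots : ∀ v ∈ X, ∃ x ∈ I, x < 5 * i ∧ elemSlot a b p x = v

theorem SideOK.skip {n : ℕ} {a b : ℕ → Fin n} {p : ℕ} {I : Finset ℕ} {i : ℕ} {X : Set (Fin n)}
    {lab : Fin n → ℕ} (h : SideOK a b p I i X lab) : SideOK a b p I (i + 1) X lab :=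
  ⟨h.sep, fun v hv => let ⟨x, hx, hi, he⟩ := h.slots v hv; ⟨x, hx, by omega, he⟩⟩

open Classical in
theorem SideOK.merge {n : ℕ} {a b : ℕ → Fin n} {p : ℕ} {I : Finset ℕ} {i : ℕ} {X : Set (Fin n)}
    {lab lab' : Fin n → ℕ} (h : SideOK a b p I i X lab) (hp : p = 0 ∨ p = 2)
    (hinj : Set.InjOn (elemSlot a b p) I) (hI : 5 * i + p ∈ I ∨ 5 * i + p + 1 ∈ I)
    (hlab : ∀ v, lab' v = if lab v = lab (b i) then lab (a i) else lab v) :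
    SideOK a b p I (i + 1) (insert (if 5 * i + p ∈ I then a i else b i) X) lab' := by
  set t : Fin n := if 5 * i + p ∈ I then a i else b i with ht
  obtain ⟨x, hx, hxi, hxt⟩ : ∃ x ∈ I, (x = 5 * i + p ∨ x = 5 * i + p + 1) ∧
      elemSlot a b p x = t := by
    by_cases hc : 5 * i + p ∈ I
    · refine ⟨_, hc, Or.inl rfl, ?_⟩
      have h1 : (5 * i + p) % 5 = p := by omega
      have h2 : (5 * i + p) / 5 = i := by omega
      rw [elemSlot, h1, h2, ht, if_pos rfl, if_pos hc]
    · refine ⟨_, hI.resolve_left hc, Or.inr rfl, ?_⟩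
      have h1 : (5 * i + p + 1) % 5 = p + 1 := by omega
      have h2 : (5 * i + p + 1) / 5 = i := by omega
      rw [elemSlot, h1, h2, ht, if_neg (by omega), if_pos rfl, if_neg hc]
  have htX : t ∉ X := by
    intro htX
    obtain ⟨y, hy, hyi, hyt⟩ := h.slots t htX
    have := hinj hx hy (hxt.trans hyt.symm)
    omega
  refine ⟨eq_of_merge_label h.sep htX ?_ hlab, ?_⟩
  · rw [ht]
    split_ifs
    · exact Or.inl rfl
    · exact Or.inr rfl
  · rintro v (rfl | hv)
    · exact ⟨x, hx, by omega, hxt⟩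
    · exact h.skip.slots v hv

/-- A basis of the complement of a set of assigned endpoints is a basis of the matroid. -/
theorem SideOK.isBase {n : ℕ} {a b : ℕ → Fin n} {p : ℕ} {I : Finset ℕ} {i N : ℕ} {X : Set (Fin n)}
    {lab : Fin n → ℕ} (h : SideOK a b p I i X lab) {M : Matroid (Fin n)} (hM : M.E = Set.univ)
    (hI : SlotIndep M N (elemSlot a b p) I) {B : Set (Fin n)} (hB : M.IsBasis B Xᶜ) :
    M.IsBase B := by
  have hX : M.Coindep X := hI.2.2.subset fun v hv =>
    let ⟨x, hx, _, he⟩ := h.slots v hv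
    ⟨x, hx, he⟩
  rw [Matroid.coindep_iff_compl_spanning (by simp [hM]), hM, ← Set.compl_eq_univ_sdiff] at hX
  exact hB.isBase_of_spanning hX

namespace Cmd

variable {n : ℕ}

/-- The number of the first element of the edge `ctr 1`. -/
def fiveCtr : NatExpr := .add (ctr 1) (.add (ctr 1) (.add (ctr 1) (.add (ctr 1) (ctr 1))))

/-- The membership of the element number `r` of the edge `ctr 1` in the best set. -/
abbrev bestBit (r : ℕ) : NatExpr := at0 21 (.add fiveCtr (.const r))

/-- The first endpoint of the edge `ctr 1`. -/
abbrev fstEnd : NatExpr := at0 6 fiveCtr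

/-- The second endpoint of the edge `ctr 1`. -/
abbrev sndEnd : NatExpr := at0 6 (.add fiveCtr (.const 1))

theorem fiveCtr_eval (s : Store) : fiveCtr.eval s = 5 * s.nat 3 0 1 := by
  simp [fiveCtr]
  ring

/-- Mark in the row `A[0]` the endpoint that is assigned to the kept edge `ctr 1`. -/
def markEnd (A r : ℕ) : Cmd :=
  ite (nonZero (bestBit r)) (set0 A fstEnd (.const 1)) (set0 A sndEnd (.const 1))

theorem markEnd_spec (O : Oracles n) (A r : ℕ) (s : Store) :
    (markEnd A r).den O s = s.writeNat A 0 (if s.nat 21 0 (5 * s.nat 3 0 1 + r) ≠ 0 then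
      s.nat 6 0 (5 * s.nat 3 0 1) else s.nat 6 0 (5 * s.nat 3 0 1 + 1)) 1 := by
  by_cases h : s.nat 21 0 (5 * s.nat 3 0 1 + r) = 0
  · rw [markEnd, den_ite_neg O (by simpa [fiveCtr_eval] using h), if_neg (by simpa using h)]
    simp [fiveCtr_eval]
  · rw [markEnd, den_ite_pos O (by simpa [fiveCtr_eval] using h), if_pos h]
    simp [fiveCtr_eval]

/-- Replace the label `29[0][0]` by the label `28[0][0]`. -/
def relabel : Cmd :=
  loop 2 1 (when (.and (.natLe (at0 22 (ctr 2)) (var 29)) (.natLe (var 29) (at0 22 (ctr 2))))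
    (set0 22 (ctr 2) (var 28)))

theorem relabel_spec (O : Oracles n) (s : Store) (hn : s.nat 0 0 0 = n) (v : Fin n) :
    (relabel.den O s).nat 22 0 v =
      if s.nat 22 0 v = s.nat 29 0 0 then s.nat 28 0 0 else s.nat 22 0 v := by
  have key := (den_loop_fill (O := O) (A := 22) (d := 2) (K := 1) (r := 0)
    (p := when (.and (.natLe (at0 22 (ctr 2)) (var 29)) (.natLe (var 29) (at0 22 (ctr 2))))
      (set0 22 (ctr 2) (var 28))) (s := s) rfl
    (fun s' => s'.nat 28 = s.nat 28 ∧ s'.nat 29 = s.nat 29)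
    (fun v => if s.nat 22 0 v = s.nat 29 0 0 then s.nat 28 0 0 else s.nat 22 0 v) (by decide)
    (by simp) ?_).2 v
  · rw [hn, one_mul, if_pos v.2] at key
    exact key
  rintro i s' hi ⟨h1, h2⟩ hc hrow
  have hi' := hrow i
  rw [if_neg (lt_irrefl i)] at hi'
  by_cases h : s.nat 22 0 i = s.nat 29 0 0
  · rw [den_ite_pos O (by simp [hc, h2, hi', h])]
    simp [hc, h1, h2, h]
  · rw [den_ite_neg O (by simpa [hc, h2, hi'] using fun h1 h2 => h (le_antisymm h1 h2))]
    refine ⟨by simp [h1, h2], fun j => ?_⟩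
    by_cases hj : j = i
    · simp [hj, hi', h]
    · simp [hj]

/-- If the edge `ctr 1` is kept, mark the endpoints assigned to it, and merge the classes of its
endpoints. -/
def mergeBody : Cmd :=
  when (.and (nonZero (.add (bestBit 0) (bestBit 1))) (nonZero (.add (bestBit 2) (bestBit 3))))
    (markEnd 25 0 ;; markEnd 26 2 ;; setVar 28 (at0 22 fstEnd) ;; setVar 29 (at0 22 sndEnd) ;;
      relabel)

/-- The state after the first `i` edges have been treated. -/
structure MergeOK (n : ℕ) (a b : ℕ → Fin n) (I : Finset ℕ) (i : ℕ) (s : Store) : Prop where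
  left : SideOK a b 0 I i (vertexSet n s 25) fun v => s.nat 22 0 v
  right : SideOK a b 2 I i (vertexSet n s 26) fun v => s.nat 22 0 v
  kept : ∀ e < i, IsKept I e → s.nat 22 0 (a e) = s.nat 22 0 (b e)

theorem MergeOK.congr {a b : ℕ → Fin n} {I : Finset ℕ} {i : ℕ} {s s' : Store}
    (h : MergeOK n a b I i s) (h22 : s'.nat 22 = s.nat 22) (h25 : s'.nat 25 = s.nat 25)
    (h26 : s'.nat 26 = s.nat 26) : MergeOK n a b I i s' := by
  refine ⟨?_, ?_, ?_⟩
  · rw [vertexSet, h25, h22]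
    exact h.left
  · rw [vertexSet, h26, h22]
    exact h.right
  · rw [h22]
    exact h.kept

theorem mergeBody_spec (O : Oracles n) {a b : ℕ → Fin n} {I : Finset ℕ} {m i : ℕ} {s : Store}
    (hn : s.nat 0 0 0 = n) (hIm : ∀ x ∈ I, x < 5 * m)
    (hslot : ∀ x < 5 * m, s.nat 6 0 x = elemSlot a b 0 x)
    (hI : ∀ x < 5 * n, s.nat 21 0 x ≠ 0 ↔ x ∈ I) (h0 : Set.InjOn (elemSlot a b 0) I)
    (h2 : Set.InjOn (elemSlot a b 2) I) (hi : i < n) (hc : s.nat 3 0 1 = i)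
    (h : MergeOK n a b I i s) : MergeOK n a b I (i + 1) (mergeBody.den O s) := by
  classical
  have hbit : ∀ r < 5, s.nat 21 0 (5 * i + r) ≠ 0 ↔ 5 * i + r ∈ I := fun r hr =>
    hI _ (by omega)
  have htest : (s.nat 21 0 (5 * i) + s.nat 21 0 (5 * i + 1) ≠ 0 ∧
      s.nat 21 0 (5 * i + 2) + s.nat 21 0 (5 * i + 3) ≠ 0) ↔ IsKept I i := by
    have e0 := hbit 0 (by decide)
    have e1 := hbit 1 (by decide)
    have e2 := hbit 2 (by decide)
    have e3 := hbit 3 (by decide)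
    rw [add_zero] at e0
    rw [IsKept, Finset.mem_coe, Finset.mem_coe, Finset.mem_coe, Finset.mem_coe, ← e0, ← e1, ← e2,
      ← e3]
    omega
  by_cases hk : IsKept I i
  · have him : i < m := by
      rcases hk.1 with h | h
      · have := hIm _ h
        omega
      · have := hIm _ h
        omega
    have ha : s.nat 6 0 (5 * i) = a i := by
      rw [hslot _ (by omega), elemSlot, if_pos (by omega), show 5 * i / 5 = i by omega]
    have hb : s.nat 6 0 (5 * i + 1) = b i := by
      rw [hslot _ (by omega), elemSlot, if_neg (by omega), if_pos (by omega),
        show (5 * i + 1) / 5 = i by omega]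
    have hk' := htest.2 hk
    rw [mergeBody, den_ite_pos O (by
      simp only [Test.holds, NatExpr.eval, fiveCtr_eval, hc, Nat.le_zero, add_zero]
      exact hk')]
    set t0 : Fin n := if 5 * i + 0 ∈ I then a i else b i with ht0
    set t2 : Fin n := if 5 * i + 2 ∈ I then a i else b i with ht2
    have hm0 : (if s.nat 21 0 (5 * i + 0) ≠ 0 then s.nat 6 0 (5 * i) else s.nat 6 0 (5 * i + 1)) =
        (t0 : ℕ) := by
      rw [ht0, ha, hb]
      by_cases hx : 5 * i + 0 ∈ I
      · rw [if_pos ((hbit 0 (by decide)).2 hx), if_pos hx]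
      · rw [if_neg (mt (hbit 0 (by decide)).1 hx), if_neg hx]
    have hm2 : (if s.nat 21 0 (5 * i + 2) ≠ 0 then s.nat 6 0 (5 * i) else s.nat 6 0 (5 * i + 1)) =
        (t2 : ℕ) := by
      rw [ht2, ha, hb]
      by_cases hx : 5 * i + 2 ∈ I
      · rw [if_pos ((hbit 2 (by decide)).2 hx), if_pos hx]
      · rw [if_neg (mt (hbit 2 (by decide)).1 hx), if_neg hx]
    set s1 := (((s.writeNat 25 0 t0 1).writeNat 26 0 t2 1).writeNat 28 0 0
      (s.nat 22 0 (a i))).writeNat 29 0 0 (s.nat 22 0 (b i)) with hs1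
    have hden : (markEnd 25 0 ;; markEnd 26 2 ;; setVar 28 (at0 22 fstEnd) ;;
        setVar 29 (at0 22 sndEnd) ;; relabel).den O s = relabel.den O s1 := by
      simp only [den_seq, markEnd_spec, den_setNat, NatExpr.eval, fiveCtr_eval, ne_eq,
        Nat.reduceEqDiff, not_false_eq_true, writeNat_nat_of_ne, hc] at hm0 hm2 ⊢
      rw [hm0, hm2, ha, hb]
    rw [hden]
    have hn1 : s1.nat 0 0 0 = n := by simp [hs1, hn]
    have hlab : ∀ v : Fin n, (relabel.den O s1).nat 22 0 v =
        if s.nat 22 0 v = s.nat 22 0 (b i) then s.nat 22 0 (a i) else s.nat 22 0 v := by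
      intro v
      rw [relabel_spec O s1 hn1 v]
      simp [hs1]
    have h25 : vertexSet n (relabel.den O s1) 25 = insert t0 (vertexSet n s 25) := by
      rw [vertexSet, den_nat_of_not_writesNat O relabel rfl]
      ext v
      by_cases hv : v = t0
      · simp [hs1, hv]
      · simp [hs1, hv, vertexSet, Fin.val_inj]
    have h26 : vertexSet n (relabel.den O s1) 26 = insert t2 (vertexSet n s 26) := by
      rw [vertexSet, den_nat_of_not_writesNat O relabel rfl]
      ext v
      by_cases hv : v = t2
      · simp [hs1, hv]
      · simp [hs1, hv, vertexSet, Fin.val_inj]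
    refine ⟨?_, ?_, ?_⟩
    · rw [h25]
      exact h.left.merge (Or.inl rfl) h0 hk.1 hlab
    · rw [h26]
      exact h.right.merge (Or.inr rfl) h2 hk.2 hlab
    · intro e he hke
      rw [hlab, hlab]
      rcases Nat.lt_succ_iff_lt_or_eq.1 he with he | rfl
      · rw [h.kept e he hke]
      · simp
  · rw [mergeBody, den_ite_neg O (by
      simp only [Test.holds, NatExpr.eval, fiveCtr_eval, hc, Nat.le_zero, add_zero]
      exact mt htest.1 hk), den_skip]
    refine ⟨h.left.skip, h.right.skip, fun e he hke => ?_⟩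
    rcases Nat.lt_succ_iff_lt_or_eq.1 he with he | rfl
    · exact h.kept e he hke
    · exact absurd hke hk

/-- Label the vertices such that the endpoints of kept edges get the same label. -/
def merge : Cmd := loop 1 1 (set0 22 (ctr 1) (ctr 1)) ;; loop 1 1 mergeBody

theorem mergeBody_writesNat {A : ℕ} (hA : A ∉ [3, 22, 25, 26, 28, 29]) :
    mergeBody.writesNat A = false := by
  simp at hA
  simp [mergeBody, markEnd, relabel, writesNat]
  omega

theorem merge_writesNat {A : ℕ} (hA : A ∉ [3, 22, 25, 26, 28, 29]) :
    merge.writesNat A = false := by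
  have h := mergeBody_writesNat hA
  simp at hA
  simp [merge, writesNat, h]
  omega

theorem merge_wf : merge.wf = true := by
  simp [merge, mergeBody, markEnd, relabel, wf, usesCtr, writesNat]

theorem merge_spec (O : Oracles n) {a b : ℕ → Fin n} {I : Finset ℕ} {m : ℕ} {s : Store}
    (hn : s.nat 0 0 0 = n) (hIm : ∀ x ∈ I, x < 5 * m)
    (hslot : ∀ x < 5 * m, s.nat 6 0 x = elemSlot a b 0 x)
    (hI : ∀ x < 5 * n, s.nat 21 0 x ≠ 0 ↔ x ∈ I) (h0 : Set.InjOn (elemSlot a b 0) I)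
    (h2 : Set.InjOn (elemSlot a b 2) I) (h25 : ∀ v, s.nat 25 0 v = 0)
    (h26 : ∀ v, s.nat 26 0 v = 0) :
    MergeOK n a b I n (merge.den O s) := by
  set s1 := (loop 1 1 (set0 22 (ctr 1) (ctr 1))).den O s with hs1
  have e1 : ∀ A, A ≠ 3 → A ≠ 22 → s1.nat A = s.nat A := fun A h h' =>
    den_nat_of_not_writesNat O _ (by simp [writesNat, h, h'.symm]) s
  have hlab : ∀ v : Fin n, s1.nat 22 0 v = v := by
    intro v
    have := (den_loop_fill (O := O) (A := 22) (d := 1) (K := 1) (r := 0)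
      (p := set0 22 (ctr 1) (ctr 1)) (s := s) rfl (fun _ => True) (fun v => v) (by decide)
      trivial (by
        intro i s' _ _ hc _
        simp [hc])).2 v
    rw [hn, one_mul, if_pos v.2] at this
    exact this
  have hn1 : s1.nat 0 0 0 = n := by rw [e1 0 (by decide) (by decide), hn]
  rw [merge, den_seq, ← hs1]
  have key := den_loop_frame O (d := 1) (K := 1) (p := mergeBody) rfl (s := s1)
    (fun i s' => MergeOK n a b I i s') ?_ ?_
  · rwa [hn1, one_mul] at key
  · have hempty : ∀ A, s1.nat A = s.nat A → A ≠ 3 → (∀ v, s.nat A 0 v = 0) →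
        vertexSet n (s1.writeNat 3 0 1 0) A = ∅ := by
      intro A h1 h2 h3
      ext v
      simp [vertexSet, h2, h1, h3]
    refine ⟨⟨?_, ?_⟩, ⟨?_, ?_⟩, by simp⟩
    · intro u v _ _ huv
      simpa [hlab, Fin.val_inj] using huv
    · rw [hempty 25 (e1 25 (by decide) (by decide)) (by decide) h25]
      simp
    · intro u v _ _ huv
      simpa [hlab, Fin.val_inj] using huv
    · rw [hempty 26 (e1 26 (by decide) (by decide)) (by decide) h26]
      simp
  intro i s2 hi hf hc hP
  rw [hn1, one_mul] at hi
  exact (mergeBody_spec O (m := m) (by rw [hf.nat 0 rfl (by decide), hn1]) hIm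
    (by rw [hf.nat 6 rfl (by decide), e1 6 (by decide) (by decide)]; exact hslot)
    (by rw [hf.nat 21 rfl (by decide), e1 21 (by decide) (by decide)]; exact hI) h0 h2 hi hc
    hP).congr (by simp) (by simp) (by simp)

attribute [irreducible] merge

end Cmd

end OracleRAM

/-! ### Numbering the parts -/

namespace OracleRAM

namespace Cmd

variable {n : ℕ}

/-- The number given to the class of the vertex `ctr 1`. -/
abbrev partOf : NatExpr := at0 34 (at0 22 (ctr 1))

/-- Give the number `ctr 2 + 1` to the class of the vertex `ctr 1`, unless the class already has a
number or the number is in use. -/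
def numberBody : Cmd :=
  when (.and (isZero partOf) (isZero (at0 35 (.add (ctr 2) (.const 1)))))
    (set0 34 (at0 22 (ctr 1)) (.add (ctr 2) (.const 1)) ;;
      set0 35 (.add (ctr 2) (.const 1)) (.const 1))

/-- Give numbers to the classes of the vertices in the row `A[0]`. Classes that already have a
number keep it, and every other class gets the smallest number not used by the vertices in the row. -/
def number (A : ℕ) : Cmd :=
  clearRow 1 2 35 ;;
  loop 1 1 (when (nonZero (at0 A (ctr 1))) (set0 35 partOf (.const 1))) ;;
  loop 1 1 (when (nonZero (at0 A (ctr 1))) (loop 2 1 numberBody))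

/-- The numbers `pl` of the classes extend the numbers `pl0`, different vertices in `B` have
different numbers, and `used` describes the numbers of the vertices in `B`. -/
structure NumberOK (lab : Fin n → ℕ) (B : Set (Fin n)) (pl0 pl used : ℕ → ℕ) : Prop where
  inj : ∀ u ∈ B, ∀ v ∈ B, pl (lab u) ≠ 0 → pl (lab u) = pl (lab v) → u = v
  le : ∀ v ∈ B, pl (lab v) ≤ B.ncard
  used : ∀ q, 1 ≤ q → q ≤ n → (used q ≠ 0 ↔ ∃ v ∈ B, pl (lab v) = q)
  keep : ∀ l, pl0 l ≠ 0 → pl l = pl0 l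
  dom : ∀ l, pl l ≠ 0 → pl0 l ≠ 0 ∨ ∃ v ∈ B, lab v = l

/-- If all numbers up to `q` are in use, but some vertex in `B` has none, then `B` has more than `q`
elements. -/
theorem NumberOK.lt_ncard {lab : Fin n → ℕ} {B : Set (Fin n)} {pl0 pl used : ℕ → ℕ}
    (h : NumberOK lab B pl0 pl used) {v : Fin n} (hv : v ∈ B) (hpv : pl (lab v) = 0) {q : ℕ}
    (hqn : q ≤ n) (hq : ∀ r, 1 ≤ r → r ≤ q → used r ≠ 0) : q < B.ncard := by
  have hsub : Set.Icc 0 q ⊆ (fun u => pl (lab u)) '' B := by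
    rintro r ⟨-, hr⟩
    rcases Nat.eq_zero_or_pos r with rfl | hr0
    · exact ⟨v, hv, hpv⟩
    · obtain ⟨u, hu, hur⟩ := (h.used r hr0 (hr.trans hqn)).1 (hq r hr0 hr)
      exact ⟨u, hu, hur⟩
  have h1 := Set.ncard_le_ncard hsub (Set.toFinite _)
  have h2 := Set.ncard_image_le (f := fun u => pl (lab u)) (Set.toFinite B)
  have h3 : (Set.Icc 0 q).ncard = q + 1 := by
    rw [← Finset.coe_Icc, Set.ncard_coe_finset]
    simp
  omega

theorem NumberOK.update {lab : Fin n → ℕ} {B : Set (Fin n)} {pl0 pl used : ℕ → ℕ}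
    (hlab : Set.InjOn lab B) (h : NumberOK lab B pl0 pl used) {v : Fin n} (hv : v ∈ B)
    (hpv : pl (lab v) = 0) {q : ℕ} (hqn : q < n) (hq : ∀ r, 1 ≤ r → r ≤ q → used r ≠ 0)
    (hfree : used (q + 1) = 0) :
    NumberOK lab B pl0 (Function.update pl (lab v) (q + 1)) (Function.update used (q + 1) 1) := by
  have hlt := h.lt_ncard hv hpv hqn.le hq
  have hne : ∀ u ∈ B, u ≠ v → lab u ≠ lab v := fun u hu huv he => huv (hlab hu hv he)
  have hnew : ∀ u ∈ B, pl (lab u) ≠ q + 1 := fun u hu he =>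
    (h.used (q + 1) (by omega) (by omega)).2 ⟨u, hu, he⟩ hfree
  refine ⟨fun u hu u' hu' h0 he => ?_, fun u hu => ?_, fun r hr hrn => ?_, fun l hl => ?_,
    fun l hl => ?_⟩
  · by_cases h1 : u = v <;> by_cases h2 : u' = v
    · rw [h1, h2]
    · rw [h1, Function.update_self, Function.update_of_ne (hne u' hu' h2)] at he
      exact absurd he.symm (hnew u' hu')
    · rw [h2, Function.update_self, Function.update_of_ne (hne u hu h1)] at he
      exact absurd he (hnew u hu)
    · rw [Function.update_of_ne (hne u hu h1)] at h0 he
      rw [Function.update_of_ne (hne u' hu' h2)] at he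
      exact h.inj u hu u' hu' h0 he
  · by_cases h1 : u = v
    · rw [h1, Function.update_self]
      exact hlt
    · rw [Function.update_of_ne (hne u hu h1)]
      exact h.le u hu
  · by_cases hrq : r = q + 1
    · rw [hrq, Function.update_self]
      exact iff_of_true one_ne_zero ⟨v, hv, Function.update_self ..⟩
    · rw [Function.update_of_ne hrq, h.used r hr hrn]
      constructor
      · rintro ⟨u, hu, he⟩
        have huv : u ≠ v := by
          rintro rfl
          omega
        exact ⟨u, hu, by rw [Function.update_of_ne (hne u hu huv), he]⟩
      · rintro ⟨u, hu, he⟩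
        have huv : u ≠ v := by
          rintro rfl
          rw [Function.update_self] at he
          omega
        rw [Function.update_of_ne (hne u hu huv)] at he
        exact ⟨u, hu, he⟩
  · have hlv : l ≠ lab v := by
      rintro rfl
      rw [← h.keep _ hl, hpv] at hl
      exact hl rfl
    rw [Function.update_of_ne hlv, h.keep l hl]
  · by_cases hlv : l = lab v
    · exact Or.inr ⟨v, hv, hlv.symm⟩
    · rw [Function.update_of_ne hlv] at hl
      exact h.dom l hl

theorem number_spec (O : Oracles n) {A : ℕ} (hA : A ∉ [0, 3, 34, 35]) (s : Store)
    (hn : s.nat 0 0 0 = n) {lab : Fin n → ℕ} (hlabs : ∀ v : Fin n, s.nat 22 0 v = lab v)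
    {B : Set (Fin n)} (hB : vertexSet n s A = B) (hlab : Set.InjOn lab B)
    (hinj : ∀ u ∈ B, ∀ v ∈ B, s.nat 34 0 (lab u) ≠ 0 →
      s.nat 34 0 (lab u) = s.nat 34 0 (lab v) → u = v)
    (hle : ∀ v ∈ B, s.nat 34 0 (lab v) ≤ B.ncard) :
    (∀ v ∈ B, ((number A).den O s).nat 34 0 (lab v) ≠ 0) ∧
    ∃ used, NumberOK lab B (s.nat 34 0) (((number A).den O s).nat 34 0) used := by
  simp only [List.mem_cons, List.not_mem_nil, or_false, not_or] at hA
  obtain ⟨hA0, hA3, hA34, hA35⟩ := hA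
  have hmemB : ∀ v : Fin n, v ∈ B ↔ s.nat A 0 v ≠ 0 := fun v => by rw [← hB]; rfl
  have hBn : B.ncard ≤ n := by
    have := Set.ncard_le_ncard (Set.subset_univ B)
    rwa [Set.ncard_univ, Nat.card_eq_fintype_card, Fintype.card_fin] at this
  set s1 := (clearRow 1 2 35).den O s with hs1
  have e1 : ∀ A, A ≠ 3 → A ≠ 35 → s1.nat A = s.nat A := fun A h h' =>
    den_nat_of_not_writesNat O _ (by simp [clearRow, writesNat, h, h'.symm]) s
  have h351 : ∀ q < 2 * n, s1.nat 35 0 q = 0 := by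
    intro q hq
    rw [hs1, clearRow_spec (by decide) (by decide), hn, if_pos hq]
  have hn1 : s1.nat 0 0 0 = n := by rw [e1 0 (by decide) (by decide), hn]
  set s2 := (loop 1 1 (when (nonZero (at0 A (ctr 1))) (set0 35 partOf (.const 1)))).den O s1
    with hs2
  have e2 : ∀ A, A ≠ 3 → A ≠ 35 → s2.nat A = s.nat A := fun A' h h' => by
    rw [hs2, den_nat_of_not_writesNat O _ (by simp [writesNat, h, h'.symm]) s1, e1 A' h h']
  have hn2 : s2.nat 0 0 0 = n := by rw [e2 0 (by decide) (by decide), hn]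
  have h352 : ∀ q < 2 * n, s2.nat 35 0 q ≠ 0 ↔ ∃ v ∈ B, s.nat 34 0 (lab v) = q := by
    have key := den_loop_frame O (d := 1) (K := 1)
      (p := when (nonZero (at0 A (ctr 1))) (set0 35 partOf (.const 1))) rfl (s := s1)
      (fun i s' => ∀ q < 2 * n, s'.nat 35 0 q ≠ 0 ↔
        ∃ v ∈ B, (v : ℕ) < i ∧ s.nat 34 0 (lab v) = q) ?_ ?_
    · rw [hn1, one_mul] at key
      intro q hq
      rw [hs2, key q hq]
      simp
    · intro q hq
      simp [h351 q hq]
    intro i s' hi hf hc hP q hq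
    rw [hn1, one_mul] at hi
    set v : Fin n := ⟨i, hi⟩ with hv
    have hA' : s'.nat A = s.nat A := by
      rw [hf.nat A (by simp [writesNat, Ne.symm hA35]) hA3, e1 A hA3 hA35]
    have h22 : s'.nat 22 0 i = lab v := by
      rw [hf.nat 22 (by simp [writesNat]) (by decide), e1 22 (by decide) (by decide)]
      exact hlabs v
    have h34 : s'.nat 34 = s.nat 34 := by
      rw [hf.nat 34 (by simp [writesNat]) (by decide), e1 34 (by decide) (by decide)]
    have hex : (∃ u ∈ B, (u : ℕ) < i + 1 ∧ s.nat 34 0 (lab u) = q) ↔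
        (∃ u ∈ B, (u : ℕ) < i ∧ s.nat 34 0 (lab u) = q) ∨ (v ∈ B ∧ s.nat 34 0 (lab v) = q) := by
      constructor
      · rintro ⟨u, hu, hui, he⟩
        rcases Nat.lt_succ_iff_lt_or_eq.1 hui with hui | hui
        · exact Or.inl ⟨u, hu, hui, he⟩
        · obtain rfl : u = v := Fin.ext hui
          exact Or.inr ⟨hu, he⟩
      · rintro (⟨u, hu, hui, he⟩ | ⟨hv, he⟩)
        · exact ⟨u, hu, by omega, he⟩
        · exact ⟨v, hv, Nat.lt_succ_self i, he⟩
    rw [hex, ← hP q hq, hmemB]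
    by_cases h : s.nat A 0 i = 0
    · rw [den_ite_neg O (by simp [hc, hA', h])]
      simp [hv, h]
    · rw [den_ite_pos O (by simp [hc, hA', h])]
      by_cases hq' : q = s.nat 34 0 (lab v)
      · simp [hc, h22, h34, hq', hv, h]
      · simp [hc, h22, h34, hq', Ne.symm hq']
  have hOK2 : NumberOK lab B (s.nat 34 0) (s2.nat 34 0) (s2.nat 35 0) := by
    rw [e2 34 (by decide) (by decide)]
    exact ⟨hinj, hle, fun q hq hqn => h352 q (by omega), fun _ _ => rfl, fun _ h => Or.inl h⟩
  have hden : (number A).den O s =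
      (loop 1 1 (when (nonZero (at0 A (ctr 1))) (loop 2 1 numberBody))).den O s2 := rfl
  rw [hden]
  have key := den_loop_frame O (d := 1) (K := 1)
    (p := when (nonZero (at0 A (ctr 1))) (loop 2 1 numberBody)) rfl (s := s2)
    (fun i s' => NumberOK lab B (s.nat 34 0) (s'.nat 34 0) (s'.nat 35 0) ∧
      ∀ v ∈ B, (v : ℕ) < i → s'.nat 34 0 (lab v) ≠ 0) ⟨?_, by simp⟩ ?_
  · rw [hn2, one_mul] at key
    exact ⟨fun v hv => key.2 v hv v.2, _, key.1⟩
  · simpa using hOK2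
  rintro i s3 hi hf3 hc3 ⟨hOK3, hdone3⟩
  rw [hn2, one_mul] at hi
  set v : Fin n := ⟨i, hi⟩ with hv
  have hA' : s3.nat A = s.nat A := by
    rw [hf3.nat A (by simp [writesNat, numberBody, hA3, Ne.symm hA34, Ne.symm hA35]) hA3,
      e2 A hA3 hA35]
  have hn3 : s3.nat 0 0 0 = n := by rw [hf3.nat 0 rfl (by decide), hn2]
  have h223 : s3.nat 22 = s.nat 22 := by
    rw [hf3.nat 22 rfl (by decide), e2 22 (by decide) (by decide)]
  have hlast : ∀ u : Fin n, (u : ℕ) < i + 1 → (u : ℕ) < i ∨ u = v := fun u hu =>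
    (Nat.lt_succ_iff_lt_or_eq.1 hu).imp id fun h => Fin.ext h
  by_cases h : s.nat A 0 i = 0
  · rw [den_ite_neg O (by simp [hc3, hA', h]), den_skip]
    refine ⟨by simpa using hOK3, fun u hu hui => ?_⟩
    rcases hlast u hui with hui | rfl
    · simpa using hdone3 u hu hui
    · exact absurd h ((hmemB v).1 hu)
  rw [den_ite_pos O (by simp [hc3, hA', h])]
  have hvB : v ∈ B := (hmemB v).2 h
  have key2 := den_loop_frame O (d := 2) (K := 1) (p := numberBody) rfl (s := s3)
    (fun q s' => NumberOK lab B (s.nat 34 0) (s'.nat 34 0) (s'.nat 35 0) ∧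
      (∀ u ∈ B, (u : ℕ) < i → s'.nat 34 0 (lab u) ≠ 0) ∧
      (s'.nat 34 0 (lab v) ≠ 0 ∨ ∀ r, 1 ≤ r → r ≤ q → s'.nat 35 0 r ≠ 0)) ?_ ?_
  · rw [hn3, one_mul] at key2
    obtain ⟨h1, h2, h3⟩ := key2
    refine ⟨by simpa using h1, fun u hu hui => ?_⟩
    rw [writeNat_nat_of_ne _ _ _ _ _ _ (by decide)]
    rcases hlast u hui with hui | rfl
    · exact h2 u hu hui
    · rcases h3 with h3 | h3
      · exact h3
      · intro h0
        have := h1.lt_ncard hvB h0 le_rfl h3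
        omega
  · refine ⟨by simpa using hOK3, by simpa using hdone3, Or.inr fun r _ _ => by omega⟩
  rintro q s4 hq hf4 hc4 ⟨hOK4, hdone4, hv4⟩
  rw [hn3, one_mul] at hq
  have hc14 : s4.nat 3 0 1 = i := by rw [hf4.ctr 1 rfl (by decide), hc3]
  have h22 : s4.nat 22 0 i = lab v := by
    rw [hf4.nat 22 rfl (by decide), h223]
    exact hlabs v
  by_cases hc : s4.nat 34 0 (lab v) = 0 ∧ s4.nat 35 0 (q + 1) = 0
  · have hall := hv4.resolve_left (not_not.2 hc.1)
    rw [numberBody, den_ite_pos O (by simpa [hc14, hc4, h22] using hc)]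
    set s5 := (((set0 34 (at0 22 (ctr 1)) (.add (ctr 2) (.const 1)) ;;
      set0 35 (.add (ctr 2) (.const 1)) (.const 1)).den O s4).writeNat 3 0 2 (q + 1)) with hs5
    have h34 : s5.nat 34 0 = Function.update (s4.nat 34 0) (lab v) (q + 1) := by
      funext l
      simp [hs5, hc14, hc4, h22, Function.update_apply]
    have h35 : s5.nat 35 0 = Function.update (s4.nat 35 0) (q + 1) 1 := by
      funext l
      simp [hs5, hc4, Function.update_apply]
    rw [h34, h35]
    refine ⟨hOK4.update hlab hvB hc.1 hq hall hc.2, fun u hu hui => ?_,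
      Or.inl (by simp)⟩
    rw [Function.update_apply]
    split_ifs
    · exact Nat.succ_ne_zero q
    · exact hdone4 u hu hui
  · rw [numberBody, den_ite_neg O (by simpa [hc14, hc4, h22] using hc), den_skip]
    refine ⟨by simpa using hOK4, by simpa using hdone4, ?_⟩
    rw [writeNat_nat_of_ne _ _ _ _ _ _ (by decide), writeNat_nat_of_ne _ _ _ _ _ _ (by decide)]
    rcases hv4 with hv4 | hv4
    · exact Or.inl hv4
    · by_cases h0 : s4.nat 34 0 (lab v) = 0
      · refine Or.inr fun r hr hrq => ?_
        rcases Nat.lt_succ_iff_lt_or_eq.1 (Nat.lt_succ_of_le hrq) with hrq | rfl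
        · exact hv4 r hr (by omega)
        · exact fun h => hc ⟨h0, h⟩
      · exact Or.inl h0

attribute [irreducible] number

end Cmd

end OracleRAM

/-! ### The complete program -/

namespace OracleRAM

namespace Cmd

variable {n : ℕ}

/-- Store in the row `A[0]` a basis of the complement of the set in the row `X[0]`. -/
def basis (j : Fin 2) (X A : ℕ) : Cmd := copyRow 1 1 11 X ;; greedy j ;; copyRow 1 1 A 12

theorem basis_spec (M : Fin 2 → Matroid (Fin n)) (hM : ∀ j, (M j).E = Set.univ) (j : Fin 2)
    {X A : ℕ} (hX : X ∉ [3, 11]) (hA : A ∉ [0, 3, 12]) (s : Store) (hn : s.nat 0 0 0 = n) :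
    (M j).IsBasis (vertexSet n ((basis j X A).den (fun j => (M j).Indep) s) A)
      (vertexSet n s X)ᶜ := by
  simp only [List.mem_cons, List.not_mem_nil, or_false, not_or] at hX hA
  set O : Oracles n := fun j => (M j).Indep with hO
  set s1 := (copyRow 1 1 11 X).den O s with hs1
  have hn1 : s1.nat 0 0 0 = n := by rw [hs1, den_nat_of_not_writesNat O _ rfl, hn]
  set s2 := (greedy j).den O s1 with hs2
  have hn2 : s2.nat 0 0 0 = n := by rw [hs2, den_nat_of_not_writesNat O _ rfl, hn1]
  have h11 : vertexSet n s1 11 = vertexSet n s X := by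
    ext v
    simp only [vertexSet, Set.mem_ofPred_eq]
    rw [hs1, copyRow_spec (by decide) (by decide) hX.2 hX.1, hn, one_mul, if_pos v.2]
  have hA' : vertexSet n ((basis j X A).den O s) A = vertexSet n s2 12 := by
    ext v
    simp only [vertexSet, Set.mem_ofPred_eq]
    rw [basis, den_seq, den_seq, ← hs1, ← hs2, copyRow_spec hA.2.1 hA.1 (Ne.symm hA.2.2)
      (by decide), hn2, one_mul, if_pos v.2]
  rw [hA', ← h11]
  exact greedy_spec M hM j s1 hn1

/-- Store the final partition in the row `2[0]`. -/
def output : Cmd := loop 1 1 (set0 2 (ctr 1) (.sub partOf (.const 1)))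

theorem output_spec (O : Oracles n) (s : Store) (hn : s.nat 0 0 0 = n) (v : Fin n) :
    (output.den O s).nat 2 0 v = s.nat 34 0 (s.nat 22 0 v) - 1 := by
  have := (den_loop_fill (O := O) (A := 2) (d := 1) (K := 1) (r := 0)
    (p := set0 2 (ctr 1) (.sub partOf (.const 1))) (s := s) rfl
    (fun s' => s'.nat 22 = s.nat 22 ∧ s'.nat 34 = s.nat 34)
    (fun v => s.nat 34 0 (s.nat 22 0 v) - 1) (by decide) (by simp) (by
      rintro i s' _ ⟨h1, h2⟩ hc _
      simp [hc, h1, h2])).2 v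
  rwa [hn, one_mul, if_pos v.2] at this

attribute [irreducible] basis output

/-- Construct the partition from the common independent set in the row `21[0]`. -/
def construct : Cmd :=
  merge ;; basis 0 25 23 ;; basis 1 26 24 ;; number 23 ;; number 24 ;; output

theorem construct_spec {M : Fin 2 → Matroid (Fin n)} (hM : ∀ j, (M j).E = Set.univ) {k : ℕ}
    (hk1 : 1 ≤ k) (hk : ∀ j, (M j).eRank = k) {a b : ℕ → Fin n} {I : Finset ℕ} {m : ℕ} {s : Store}
    (hn : s.nat 0 0 0 = n) (h0 : SlotIndep (M 0) (5 * m) (elemSlot a b 0) I)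
    (h1 : SlotIndep (M 1) (5 * m) (elemSlot a b 2) I) (hmn : m ≤ n)
    (hslot : ∀ x < 5 * m, s.nat 6 0 x = elemSlot a b 0 x) (hI : members n s 21 = I)
    (h25 : ∀ v, s.nat 25 0 v = 0) (h26 : ∀ v, s.nat 26 0 v = 0) (h34 : ∀ l, s.nat 34 0 l = 0)
    {s' : Store} (hs' : construct.den (fun j => (M j).Indep) s = s') :
    IsFeasiblePartition M (outputParts n k s') ∧ ∃ π : Fin n → Fin k,
      (∀ v i, v ∈ outputParts n k s' i ↔ π v = i) ∧
      ∀ e < m, IsKept I e → π (a e) = π (b e) := by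
  set O : Oracles n := fun j => (M j).Indep with hO
  have hbasis : ∀ (j : Fin 2) (X A A' : ℕ), A' ∉ [3, 11, 12, A] →
      (basis j X A).writesNat A' = false := by
    intro j X A A' hA'
    simp only [List.mem_cons, List.not_mem_nil, or_false, not_or] at hA'
    simp [basis, copyRow, greedy, clearRow, writesNat]
    omega
  have hnumber : ∀ A A' : ℕ, A' ∉ [3, 34, 35] → (number A).writesNat A' = false := by
    intro A A' hA'
    simp only [List.mem_cons, List.not_mem_nil, or_false, not_or] at hA'
    simp [number, numberBody, clearRow, writesNat]
    omega
  set s1 := merge.den O s with hs1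
  set s2 := (basis 0 25 23).den O s1 with hs2
  set s3 := (basis 1 26 24).den O s2 with hs3
  set s4 := (number 23).den O s3 with hs4
  set s5 := (number 24).den O s4 with hs5
  have h_end : s' = output.den O s5 := by
    rw [← hs', construct, den_seq, den_seq, den_seq, den_seq, den_seq]
  have e1 : ∀ A, A ∉ [3, 22, 25, 26, 28, 29] → s1.nat A = s.nat A := fun A hA =>
    den_nat_of_not_writesNat O _ (merge_writesNat hA) s
  have e2 : ∀ A, A ∉ [3, 11, 12, 23] → s2.nat A = s1.nat A := fun A hA =>
    den_nat_of_not_writesNat O _ (hbasis 0 25 23 A hA) s1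
  have e3 : ∀ A, A ∉ [3, 11, 12, 24] → s3.nat A = s2.nat A := fun A hA =>
    den_nat_of_not_writesNat O _ (hbasis 1 26 24 A hA) s2
  have e4 : ∀ A, A ∉ [3, 34, 35] → s4.nat A = s3.nat A := fun A hA =>
    den_nat_of_not_writesNat O _ (hnumber 23 A hA) s3
  have e5 : ∀ A, A ∉ [3, 34, 35] → s5.nat A = s4.nat A := fun A hA =>
    den_nat_of_not_writesNat O _ (hnumber 24 A hA) s4
  have n1 : s1.nat 0 0 0 = n := by rw [e1 0 (by decide), hn]
  have n2 : s2.nat 0 0 0 = n := by rw [e2 0 (by decide), n1]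
  have n3 : s3.nat 0 0 0 = n := by rw [e3 0 (by decide), n2]
  have n4 : s4.nat 0 0 0 = n := by rw [e4 0 (by decide), n3]
  have n5 : s5.nat 0 0 0 = n := by rw [e5 0 (by decide), n4]
  have hmerge : MergeOK n a b I n s1 := merge_spec O hn h0.1 hslot
    (fun x hx => by rw [← hI, mem_members]; exact (and_iff_right hx).symm) h0.2.1 h1.2.1 h25 h26
  set lab : Fin n → ℕ := fun v => s1.nat 22 0 v with hlab
  have hlab3 : s3.nat 22 = s1.nat 22 := by rw [e3 22 (by decide), e2 22 (by decide)]
  have hlab4 : s4.nat 22 = s1.nat 22 := by rw [e4 22 (by decide), hlab3]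
  have hlab5 : s5.nat 22 = s1.nat 22 := by rw [e5 22 (by decide), hlab4]
  set B0 := vertexSet n s2 23 with hB0
  set B1 := vertexSet n s3 24 with hB1
  have hb0 := basis_spec M hM 0 (X := 25) (A := 23) (by decide) (by decide) s1 n1
  rw [← hO, ← hs2, ← hB0] at hb0
  have hb1 := basis_spec M hM 1 (X := 26) (A := 24) (by decide) (by decide) s2 n2
  rw [← hO, ← hs3, ← hB1, show vertexSet n s2 26 = vertexSet n s1 26 by
    rw [vertexSet, e2 26 (by decide)]; rfl] at hb1
  have hbase0 := hmerge.left.isBase (hM 0) h0 hb0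
  have hbase1 := hmerge.right.isBase (hM 1) h1 hb1
  have hinj0 : Set.InjOn lab B0 := fun u hu v hv he =>
    hmerge.left.sep u v (hb0.subset hu) (hb0.subset hv) he
  have hinj1 : Set.InjOn lab B1 := fun u hu v hv he =>
    hmerge.right.sep u v (hb1.subset hu) (hb1.subset hv) he
  have hcard0 := hbase0.ncard_eq_of_eRank (hk 0)
  have hcard1 := hbase1.ncard_eq_of_eRank (hk 1)
  have hpl3 : ∀ l, s3.nat 34 0 l = 0 := by
    intro l
    rw [e3 34 (by decide), e2 34 (by decide), e1 34 (by decide), h34]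
  obtain ⟨hne0, used0, hok0⟩ := number_spec O (A := 23) (by decide) s3 n3 (lab := lab)
    (fun v => by rw [hlab3]) (B := B0) (by rw [vertexSet, e3 23 (by decide)]; rfl) hinj0
    (fun u _ v _ h => absurd (hpl3 _) h) (fun v _ => by rw [hpl3]; exact Nat.zero_le _)
  rw [← hs4] at hne0 hok0
  have hdom0 : ∀ l, s4.nat 34 0 l ≠ 0 → ∃ v ∈ B0, lab v = l := fun l hl =>
    (hok0.dom l hl).resolve_left (not_not.2 (hpl3 l))
  have hle0 : ∀ l, s4.nat 34 0 l ≤ k := by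
    intro l
    by_cases hl : s4.nat 34 0 l = 0
    · omega
    · obtain ⟨v, hv, rfl⟩ := hdom0 l hl
      exact (hok0.le v hv).trans hcard0.le
  obtain ⟨hne1, used1, hok1⟩ := number_spec O (A := 24) (by decide) s4 n4 (lab := lab)
    (fun v => by rw [hlab4]) (B := B1) (by rw [vertexSet, e4 24 (by decide)]; rfl) hinj1
    (by
      intro u hu v hv h he
      obtain ⟨u', hu', hu''⟩ := hdom0 _ h
      obtain ⟨v', hv', hv''⟩ := hdom0 _ (he ▸ h)
      have huv : u' = v' := hok0.inj u' hu' v' hv' (by rwa [hu'']) (by rw [hu'', hv'', he])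
      exact hinj1 hu hv (by rw [← hu'', ← hv'', huv]))
    (fun v _ => by rw [hcard1]; exact hle0 _)
  rw [← hs5] at hne1 hok1
  set β : Fin n → ℕ := fun v => s5.nat 34 0 (lab v) with hβ
  have hβle : ∀ v, β v ≤ k := by
    intro v
    by_cases hl : β v = 0
    · omega
    · by_cases hl4 : s4.nat 34 0 (lab v) = 0
      · obtain ⟨u, hu, he⟩ := (hok1.dom _ hl).resolve_left (not_not.2 hl4)
        rw [hβ]
        dsimp only
        rw [← he, ← hcard1]
        exact hok1.le u hu
      · rw [hβ]
        dsimp only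
        rw [hok1.keep _ hl4]
        exact hle0 _
  have hβ0 : ∀ v ∈ B0, β v = s4.nat 34 0 (lab v) := fun v hv => hok1.keep _ (hne0 v hv)
  have hparts : ∀ i, outputParts n k s' i = {v | β v - 1 = i} := by
    intro i
    ext v
    rw [outputParts, Set.mem_ofPred_eq, Set.mem_ofPred_eq, h_end, output_spec O s5 n5, hlab5]
  have hlt : ∀ v, β v - 1 < k := fun v => by
    have := hβle v
    omega
  refine ⟨⟨fun v => ⟨⟨β v - 1, hlt v⟩, ?_, ?_⟩, ?_⟩, fun v => ⟨β v - 1, hlt v⟩, ?_, ?_⟩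
  · simp [hparts]
  · intro i hi
    rw [hparts] at hi
    exact Fin.ext hi.symm
  · intro j
    have h_two : j = 0 ∨ j = 1 := by omega
    rcases h_two with rfl | rfl
    · refine ⟨B0, hbase0, fun i => ?_⟩
      rw [hparts]
      refine ncard_inter_eq_one hcard0 (fun v hv => ⟨?_, hβle v⟩) ?_ i
      · rw [hβ0 v hv]
        exact Nat.one_le_iff_ne_zero.2 (hne0 v hv)
      · intro u hu v hv he
        rw [hβ0 u hu, hβ0 v hv] at he
        exact hok0.inj u hu v hv (hne0 u hu) he
    · refine ⟨B1, hbase1, fun i => ?_⟩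
      rw [hparts]
      refine ncard_inter_eq_one hcard1
        (fun v hv => ⟨Nat.one_le_iff_ne_zero.2 (hne1 v hv), hβle v⟩) ?_ i
      exact fun u hu v hv he => hok1.inj u hu v hv (hne1 u hu) he
  · intro v i
    rw [hparts, Fin.ext_iff]
    rfl
  · intro e he hke
    rw [Fin.ext_iff]
    have hlabe : lab (a e) = lab (b e) := hmerge.kept e (by omega) hke
    simp only [hβ, hlabe]

theorem construct_writesNat : construct.writesNat 0 = false := by
  simp [construct, writesNat, merge_writesNat, basis, copyRow, greedy, clearRow, number, numberBody,
    output]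

theorem construct_wf : construct.wf = true := by
  simp [construct, wf, merge_wf, basis, copyRow, greedy, clearRow, number, numberBody, output,
    usesCtr, writesNat]

attribute [irreducible] construct

/-- The program for double matroid-constrained multiway cut on trees. -/
def solve : Cmd := setup ;; optimize ;; construct

theorem solve_wf : solve.wf = true := by
  simp [solve, wf, setup_wf, optimize_wf, construct_wf]

theorem solve_writesNat : solve.writesNat 0 = false := by
  simp [solve, writesNat, setup_writesNat, optimize_writesNat, construct_writesNat]

theorem isOptimalPartition_solve {k : ℕ} {G : SimpleGraph (Fin n)} {w : Sym2 (Fin n) → ℝ}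
    {M : Fin 2 → Matroid (Fin n)} (hG : G.IsTree) (hw : ∀ e ∈ G.edgeSet, 0 ≤ w e) (hk1 : 1 ≤ k)
    (hM : ∀ j, (M j).E = Set.univ) (hk : ∀ j, (M j).eRank = k) :
    IsOptimalPartition G w M
      (outputParts n k (solve.den (fun j => (M j).Indep) (inputStore G w))) := by
  classical
  set O : Oracles n := fun j => (M j).Indep with hO
  set s := inputStore G w with hs
  have hn : s.nat 0 0 0 = n := by simp [hs, inputStore]
  have hzero : ∀ A, A ≠ 0 → A ≠ 1 → ∀ i j, s.nat A i j = 0 := by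
    intro A h h' i j
    simp [hs, inputStore, h, h']
  have hrzero : ∀ A, A ≠ 0 → ∀ i j, s.real A i j = 0 := by
    intro A h i j
    simp [hs, inputStore, h]
  have hadj : ∀ u v : Fin n, s.nat 1 u v ≠ 0 ↔ G.Adj u v := by
    intro u v
    simp [hs, inputStore, Fin.val_inj]
  have hweight : ∀ u v : Fin n, G.Adj u v → s.real 0 u v = w s(u, v) := by
    intro u v h
    simp [hs, inputStore, h]
  have hpos : 0 < n := by
    obtain ⟨v⟩ := hG.connected.nonempty
    exact v.pos
  obtain ⟨m, a, b, hE, hLst⟩ := setup_spec O G hpos s hn (hzero 4 (by decide) (by decide) 0 0)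
    (hzero 5 (by decide) (by decide) 0 0) hadj
  have hmn : m < n := by simpa using hE.lt_card hG
  set s1 := setup.den O s with hs1
  have e1 : ∀ A, A ∉ [3, 4, 5, 6, 7] → s1.nat A = s.nat A := fun A hA =>
    den_nat_of_not_writesNat O _ (setup_writesNat hA) s
  have n1 : s1.nat 0 0 0 = n := by rw [e1 0 (by decide), hn]
  obtain ⟨L, hLE, hL⟩ := exists_slotMatroid (M 0) (5 * m) (elemSlot a b 0)
  obtain ⟨R, hRE, hR⟩ := exists_slotMatroid (M 1) (5 * m) (elemSlot a b 2)
  have hcongr : ∀ (N : Matroid (Fin n)) (f f' : ℕ → ℕ) (I : Set ℕ), (∀ x < 5 * m, f x = f' x) →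
      SlotIndep N (5 * m) f I → SlotIndep N (5 * m) f' I := by
    rintro N f f' I hf ⟨h1, h2, h3⟩
    have heq : Set.EqOn f f' I := fun x hx => hf x (h1 x hx)
    exact ⟨h1, h2.congr heq, by rwa [← heq.image_eq]⟩
  have hsize : ∀ (p x : ℕ), x < 5 * m → elemSlot a b p x < 2 * n := by
    intro p x hx
    have h1 := (a (x / 5)).2
    have h2 := (b (x / 5)).2
    rw [elemSlot]
    split_ifs <;> omega
  have hready : Ready n s1 := by
    refine ⟨n1, fun x hx => ?_, fun x hx => ?_⟩
    · rw [hLst.elems] at hx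
      rw [hLst.left x hx]
      exact hsize 0 x hx
    · rw [hLst.elems] at hx
      rw [hLst.right x hx]
      exact hsize 2 x hx
  have hrep : Represents M L R s1 := by
    refine ⟨fun I => ?_, fun I => ?_⟩
    · rw [hL, hLst.elems]
      exact ⟨hcongr _ _ _ _ fun x hx => (hLst.left x hx).symm, hcongr _ _ _ _ hLst.left⟩
    · rw [hR, hLst.elems]
      exact ⟨hcongr _ _ _ _ fun x hx => (hLst.right x hx).symm, hcongr _ _ _ _ hLst.right⟩
  have hground : ∀ N : Matroid ℕ, N.E = Set.Iio (5 * m) → N.E ⊆ Finset.range (5 * n) := by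
    intro N hN x hx
    rw [hN, Set.mem_Iio] at hx
    rw [Finset.mem_coe, Finset.mem_range]
    omega
  have hnone : ∀ A, A ∉ [3, 4, 5, 6, 7] → A ≠ 0 → A ≠ 1 → members n s1 A = ∅ := by
    intro A h1 h2 h3
    ext x
    simp [mem_members, e1 A h1, hzero A h2 h3]
  obtain ⟨hIL, hIR, hmax⟩ := optimize_spec hM (hground L hLE) (hground R hRE) s1 hready hrep
    (hnone 8 (by decide) (by decide) (by decide)) (hnone 21 (by decide) (by decide) (by decide))
    (by rw [hs1, den_real_of_not_writesReal O _ (setup_writesReal (by decide)),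
      hrzero 4 (by decide)]) rfl
  rw [← hO] at hIL hIR hmax
  set s2 := optimize.den O s1 with hs2
  set I := members n s2 21 with hI
  have e2 : ∀ A, A ∉ [3, 8, 9, 10, 11, 12, 13, 14, 15, 16, 17, 18, 19, 20, 21] →
      s2.nat A = s1.nat A := fun A hA => den_nat_of_not_writesNat O _ (optimize_writesNat hA) s1
  have hz2 : ∀ A, A ∉ [3, 8, 9, 10, 11, 12, 13, 14, 15, 16, 17, 18, 19, 20, 21] →
      A ∉ [3, 4, 5, 6, 7] → A ≠ 0 → A ≠ 1 → ∀ v, s2.nat A 0 v = 0 := fun A h1 h2 h3 h4 v => by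
    rw [e2 A h1, e1 A h2, hzero A h3 h4]
  have hS0 := (hL I).1 hIL
  have hS1 := (hR I).1 hIR
  obtain ⟨hfeas, π, hπ, hkept⟩ := construct_spec hM hk1 hk (s := s2)
    (by rw [e2 0 (by decide), n1]) hS0 hS1 hmn.le
    (by rw [e2 6 (by decide)]; exact hLst.left) hI.symm
    (hz2 25 (by decide) (by decide) (by decide) (by decide))
    (hz2 26 (by decide) (by decide) (by decide) (by decide))
    (hz2 34 (by decide) (by decide) (by decide) (by decide)) rfl
  have hden : solve.den O s = construct.den O s2 := by rw [solve, den_seq, den_seq]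
  rw [hden]
  refine ⟨hfeas, fun Q hQ => ?_⟩
  have hle := hE.sum_cutWeight_le w hw hS0 hS1 _ π hπ hkept
  obtain ⟨K, hK0, hK1, hKeq⟩ := hE.exists_common_of_feasible hG.isAcyclic w hM hQ
  have hsum : ∀ K : Finset ℕ, (∀ x ∈ K, x < 5 * m) → ∑ x ∈ K, s1.real 1 0 x =
      ∑ x ∈ K, w s(a (x / 5), b (x / 5)) := fun K hK => Finset.sum_congr rfl fun x hx => by
    rw [hLst.weight x (hK x hx), hweight _ _ (hE.adj _ (by have := hK x hx; omega))]
  have hopt := hmax K ((hL K).2 hK0) ((hR K).2 hK1)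
  rw [hsum K hK0.1, hsum I hS0.1] at hopt
  linarith

end Cmd

end OracleRAM
theorem mainTheorem8 :
    ∃ (prog : OracleRAM.Program) (p : Polynomial ℕ),
      ∀ (n k : ℕ) (G : SimpleGraph (Fin n)) (w : Sym2 (Fin n) → ℝ) (M : Fin 2 → Matroid (Fin n)),
        G.IsTree → (∀ e ∈ G.edgeSet, 0 ≤ w e) →
        1 ≤ k → (∀ j, (M j).E = Set.univ) → (∀ j, (M j).eRank = k) →
        ∃ (s : OracleRAM.Store) (t : ℕ),
          OracleRAM.Exec (fun j => (M j).Indep) prog (OracleRAM.inputStore G w) s t ∧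
          t ≤ p.eval n ∧
          IsOptimalPartition G w M (OracleRAM.outputParts n k s) := by
  refine ⟨OracleRAM.Cmd.solve.compile, OracleRAM.Cmd.solve.timeBound, ?_⟩
  intro n k G w M hG hw hk1 hM hk
  obtain ⟨t, ht, hexec⟩ := OracleRAM.Cmd.exec_compile (fun j => (M j).Indep) OracleRAM.Cmd.solve
    OracleRAM.Cmd.solve_wf OracleRAM.Cmd.solve_writesNat (OracleRAM.inputStore G w)
  have hn : (OracleRAM.inputStore G w).nat 0 0 0 = n := by simp [OracleRAM.inputStore]
  rw [hn] at ht
  exact ⟨_, t, hexec, ht, OracleRAM.Cmd.isOptimalPartition_solve hG hw hk1 hM hk⟩
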